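/- Let $P_1,P_2$ be closed (compact, boundaryless) smooth manifolds of dimensions $p_1,p_2$, let $N$ be a smooth manifold of dimension $n$ without boundary, and write $I=[0,1]$ and $\Delta_N\subset N\times N$ for the diagonal. Work with spaces of smooth maps: a point of $\mathrm{map}(P,N)$ is a smooth map $P\to N$, a path is a smooth map $P\times I\to N$, and a homotopy of paths is a smooth map $P\times I\times I\to N$. Call $\mathrm{map}(P,N)$ simply connected if it is nonempty, any two of its points are joined by a path, and any two paths with the same endpoints are homotopic with endpoints fixed. A pair $(g_1,g_2)\in\mathrm{map}(P_1,N)\times\mathrm{map}(P_2,N)$ is a link map if $g_1(P_1)\cap g_2(P_2)=\emptyset$. Fix a link map $(f_1,f_2)$ (the basepoint, or chosen unlink). A *lift* is a point of $\mathrm{hofiber}(\mathrm{Link}(P_1,P_2;N)\to\mathrm{map}(P_1,N)\times\mathrm{map}(P_2,N))$ over $(f_1,f_2)$, i.e. a path $\alpha(t)=(f_{1,t},f_{2,t})$ with $\alpha(0)=(f_1,f_2)$ and $\alpha(1)$ a link map. Two lifts are *homotopic* if they are joined by a homotopy through lifts (all starting at $(f_1,f_2)$ and ending at link maps). Let $E_{12}$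 be the space of triples $(x_1,x_2,\omega)$ with $x_i\in P_i$ and $\omega:[-1,1]\to N$ a continuous path from $f_1(x_1)$ to $f_2(x_2)$; $TP_1\times TP_2$ and $TN$ are pulled back to $E_{12}$ along $(x_1,x_2,\omega)\mapsto(x_1,x_2)$ and $(x_1,x_2,\omega)\mapsto\omega(0)$. If $F(x_1,x_2,t)=(f_{1,t}(x_1),f_{2,t}(x_2))$ is transverse to $\Delta_N$, the *linking manifold* $L_\alpha$ is the closed manifold $F^{-1}(\Delta_N)\subset P_1\times P_2\times I$ of dimension $p_1+p_2+1-n$ (empty if this number is negative), together with the map $L_\alpha\to E_{12}$, $(x_1,x_2,t)\mapsto(x_1,x_2,\omega)$, where $\omega(s)=f_{1,(1+s)t}(x_1)$ for $s\le 0$ and $\omega(s)=f_{2,(1-s)t}(x_2)$ for $s\ge 0$, and with an isomorphism of vector bundles $TL_\alpha\oplus TN\cong (TP_1\times TP_2)\oplus\mathbb R$ which extends the derivative of the inclusion $L_\alpha\subset P_1\times P_2\times I$ and splits the identification, given by the derivative of $F$ and $T(N\times N)|_{\Delta_N}/T\Delta_N\cong TN$, $(u_1,u_2)\mapsto u_2-u_1$,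 of the normal bundle of $L_\alpha$ with $TN$. For an arbitrary lift $\alpha$, a linking manifold of $\alpha$ is the linking manifold of any lift homotopic to $\alpha$ whose map $F$ is transverse to $\Delta_N$. Two such manifolds are *cobordant* if they represent the same element of the cobordism group $\Omega^{TN-TP_1\times TP_2}_{p_1+p_2+1-n}(E_{12})$, i.e. if together they bound a compact manifold with a map to $E_{12}$ and a stable isomorphism of the sum of its tangent bundle and $TN$ with $TP_1\times TP_2$, all restricting to the given data on the two ends. Then: 1. Every lift has a linking manifold. 2. If $\alpha,\beta$ are lifts with $\alpha(1)=\beta(1)$ and $\alpha$ and $\beta$ are homotopic, then the linking manifolds $L_\alpha$ and $L_\beta$ are cobordant (for all choices made in their construction). 3. If $\mathrm{map}(P_1,N)$ and $\mathrm{map}(P_2,N)$ are simply connected, then for every link map $(g_1,g_2)$ there is a lift $\alpha$ with $\alpha(1)=(g_1,g_2)$, and for any two such lifts $\alpha,\beta$ the linking manifolds $L_\alpha$ and $L_\beta$ are cobordant. Thus the cobordism class of the linking manifold of $(g_1,g_2)$ depends only on the chosen basepoint $(f_1,f_2)$. -/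

import Mathlib

open scoped Manifold ContDiff Bundle unitInterval

universe u v

noncomputable section

/-! ### Stable cobordism with coefficients in a virtual vector bundle -/

namespace StableCobordism

open Bundle


/-- An isomorphism of vector bundles over `B`: a fibrewise linear isomorphism which is continuous
on total spaces (for bundles of finite rank its inverse is then continuous too). -/
structure BundleIso {B : Type*} (F : Type*) (E : B → Type*) (F' : Type*) (E' : B → Type*)
    [∀ b, TopologicalSpace (E b)] [∀ b, AddCommMonoid (E b)] [∀ b, Module ℝ (E b)]
    [∀ b, TopologicalSpace (E' b)] [∀ b, AddCommMonoid (E' b)] [∀ b, Module ℝ (E' b)]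
    [TopologicalSpace (TotalSpace F E)] [TopologicalSpace (TotalSpace F' E')] where
  /-- the isomorphism of fibres -/
  toEquiv : ∀ b, E b ≃L[ℝ] E' b
  continuous_total : Continuous fun z : TotalSpace F E =>
    (⟨z.proj, toEquiv z.proj z.snd⟩ : TotalSpace F' E')

/-- The pullback of a bundle over `X` along a continuous map `f : B → X`; its fibre over `b` is the
fibre `ξ (f b)`. -/
abbrev Pull {B X : Type*} [TopologicalSpace B] [TopologicalSpace X] (f : C(B, X))
    (ξ : X → Type*) : B → Type _ :=
  (f : B → X) *ᵖ ξ

/-- A representative `(W, f, φ)` of a class in the cobordism group `Ω_k^{ξ-η}(X)`: a closed smooth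
`k`-manifold `W`, a continuous map `f : W → X`, and a stable isomorphism `TW ⊕ f^*ξ ≅ f^*η`, that
is, an isomorphism of vector bundles `φ : TW ⊕ f^*ξ ⊕ ℝ^a ≅ f^*η ⊕ ℝ^b`. -/
structure StableCycle {X : Type*} [TopologicalSpace X]
    (Fξ : Type*) [NormedAddCommGroup Fξ] [NormedSpace ℝ Fξ] (ξ : X → Type*)
    [∀ x, TopologicalSpace (ξ x)] [∀ x, AddCommMonoid (ξ x)] [∀ x, Module ℝ (ξ x)]
    [TopologicalSpace (TotalSpace Fξ ξ)] [FiberBundle Fξ ξ] [VectorBundle ℝ Fξ ξ]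
    (Fη : Type*) [NormedAddCommGroup Fη] [NormedSpace ℝ Fη] (η : X → Type*)
    [∀ x, TopologicalSpace (η x)] [∀ x, AddCommMonoid (η x)] [∀ x, Module ℝ (η x)]
    [TopologicalSpace (TotalSpace Fη η)] [FiberBundle Fη η] [VectorBundle ℝ Fη η]
    (k a b : ℕ) where
  /-- the underlying closed manifold -/
  W : Type u
  [topologicalSpace : TopologicalSpace W]
  [chartedSpace : ChartedSpace (EuclideanSpace ℝ (Fin k)) W]
  [isManifold : IsManifold (𝓡 k) ∞ W]
  [compactSpace : CompactSpace W]
  [t2Space : T2Space W]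
  /-- the reference map -/
  f : C(W, X)
  /-- the stable isomorphism -/
  φ : BundleIso
    (EuclideanSpace ℝ (Fin k) × (Fξ × (Fin a → ℝ)))
    ((TangentSpace (𝓡 k) : W → Type) ×ᵇ (Pull f ξ ×ᵇ Trivial W (Fin a → ℝ)))
    (Fη × (Fin b → ℝ))
    (Pull f η ×ᵇ Trivial W (Fin b → ℝ))

attribute [instance] StableCycle.topologicalSpace StableCycle.chartedSpace StableCycle.isManifold
  StableCycle.compactSpace StableCycle.t2Space

/-- A `(k+1)`-dimensional compact smooth manifold `W` with boundary, with a smooth function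
`s : W → [0,1]` such that `∂W = s⁻¹{0, 1}`, a continuous map `f : W → X` and a stable isomorphism
`TW ⊕ f^*ξ ≅ f^*η`, given as a bundle isomorphism
`φ : TW ⊕ f^*ξ ⊕ ℝ^a ⊕ ℝ^m ≅ f^*η ⊕ ℝ^b ⊕ (ℝ ⊕ ℝ^m)`. The two ends `s⁻¹{0}` and `s⁻¹{1}`
are identified with given closed manifolds in `IsEnd` below. -/
structure Film {X : Type*} [TopologicalSpace X]
    (Fξ : Type*) [NormedAddCommGroup Fξ] [NormedSpace ℝ Fξ] (ξ : X → Type*)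
    [∀ x, TopologicalSpace (ξ x)] [∀ x, AddCommMonoid (ξ x)] [∀ x, Module ℝ (ξ x)]
    [TopologicalSpace (TotalSpace Fξ ξ)] [FiberBundle Fξ ξ] [VectorBundle ℝ Fξ ξ]
    (Fη : Type*) [NormedAddCommGroup Fη] [NormedSpace ℝ Fη] (η : X → Type*)
    [∀ x, TopologicalSpace (η x)] [∀ x, AddCommMonoid (η x)] [∀ x, Module ℝ (η x)]
    [TopologicalSpace (TotalSpace Fη η)] [FiberBundle Fη η] [VectorBundle ℝ Fη η]
    (k a b : ℕ) where
  /-- the underlying manifold with boundary -/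
  W : Type u
  [topologicalSpace : TopologicalSpace W]
  [chartedSpace : ChartedSpace (EuclideanHalfSpace (k + 1)) W]
  [isManifold : IsManifold (𝓡∂ (k + 1)) ∞ W]
  [compactSpace : CompactSpace W]
  [t2Space : T2Space W]
  /-- the function to the interval -/
  s : W → ℝ
  contMDiff_s : ContMDiff (𝓡∂ (k + 1)) 𝓘(ℝ) ∞ s
  s_mem : ∀ w, s w ∈ Set.Icc (0 : ℝ) 1
  boundary_eq : (𝓡∂ (k + 1)).boundary W = s ⁻¹' {0, 1}
  /-- the reference map -/
  f : C(W, X)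
  /-- the amount of additional stabilization -/
  m : ℕ
  /-- the stable isomorphism -/
  φ : BundleIso
    (EuclideanSpace ℝ (Fin (k + 1)) × (Fξ × ((Fin a → ℝ) × (Fin m → ℝ))))
    ((TangentSpace (𝓡∂ (k + 1)) : W → Type) ×ᵇ
      (Pull f ξ ×ᵇ Trivial W ((Fin a → ℝ) × (Fin m → ℝ))))
    (Fη × ((Fin b → ℝ) × (ℝ × (Fin m → ℝ))))
    (Pull f η ×ᵇ Trivial W ((Fin b → ℝ) × (ℝ × (Fin m → ℝ))))

attribute [instance] Film.topologicalSpace Film.chartedSpace Film.isManifold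
  Film.compactSpace Film.t2Space

section

variable {X : Type*} [TopologicalSpace X]
  {Fξ : Type*} [NormedAddCommGroup Fξ] [NormedSpace ℝ Fξ] {ξ : X → Type*}
  [∀ x, TopologicalSpace (ξ x)] [∀ x, AddCommMonoid (ξ x)] [∀ x, Module ℝ (ξ x)]
  [TopologicalSpace (TotalSpace Fξ ξ)] [FiberBundle Fξ ξ] [VectorBundle ℝ Fξ ξ]
  {Fη : Type*} [NormedAddCommGroup Fη] [NormedSpace ℝ Fη] {η : X → Type*}
  [∀ x, TopologicalSpace (η x)] [∀ x, AddCommMonoid (η x)] [∀ x, Module ℝ (η x)]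
  [TopologicalSpace (TotalSpace Fη η)] [FiberBundle Fη η] [VectorBundle ℝ Fη η]

/-- The map `ι` identifies the cycle `L` with the end `s⁻¹{r}` (`r = 0` or `1`) of the film `V`:
it is a smooth embedding of manifolds with image `s⁻¹{r}`, the reference maps agree, and for
some field `ν` of transverse vectors along the end (with `ds(ν) > 0`: inward at `r = 0`, outward at
`r = 1`), the stable isomorphism of `V` restricts, under `TV|_L = TL ⊕ ℝν`, to the stabilization
`φ_L ⊕ id_ℝ ⊕ id_{ℝ^m}` of the one of `L`. Elements of `ξ` and `η` over the equal points
`V.f (ι x)` and `L.f x` are compared in the total spaces. -/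
structure IsEnd {k a b : ℕ} (V : Film.{u} Fξ ξ Fη η k a b) (L : StableCycle.{u} Fξ ξ Fη η k a b)
    (r : ℝ) (ι : L.W → V.W) : Prop where
  contMDiff : ContMDiff (𝓡 k) (𝓡∂ (k + 1)) ∞ ι
  injective : Function.Injective ι
  immersion : ∀ x, Function.Injective (mfderiv (𝓡 k) (𝓡∂ (k + 1)) ι x)
  range_eq : Set.range ι = V.s ⁻¹' {r}
  f_eq : ∀ x, V.f (ι x) = L.f x
  φ_eq : ∃ ν : ∀ x, TangentSpace (𝓡∂ (k + 1)) (ι x),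
    (∀ x, 0 < (show ℝ from mfderiv (𝓡∂ (k + 1)) 𝓘(ℝ) V.s (ι x) (ν x))) ∧
    ∀ (x : L.W) (v : TangentSpace (𝓡 k) x) (u : ξ (L.f x)) (u' : ξ (V.f (ι x))),
      TotalSpace.mk' Fξ (V.f (ι x)) u' = TotalSpace.mk' Fξ (L.f x) u →
      ∀ (y : Fin a → ℝ) (c : ℝ) (z : Fin V.m → ℝ),
        TotalSpace.mk' Fη (V.f (ι x)) (V.φ.toEquiv (ι x)
            (mfderiv (𝓡 k) (𝓡∂ (k + 1)) ι x v + c • ν x, (u', (y, z)))).1 =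
          TotalSpace.mk' Fη (L.f x) (L.φ.toEquiv x (v, (u, y))).1 ∧
        (V.φ.toEquiv (ι x)
            (mfderiv (𝓡 k) (𝓡∂ (k + 1)) ι x v + c • ν x, (u', (y, z)))).2 =
          ((L.φ.toEquiv x (v, (u, y))).2, (c, z))

/-- Two cycles are cobordant: together they form the boundary of a compact `(k+1)`-manifold over
`X` with stable isomorphism restricting to the given ones. -/
def Cobordant {k a b : ℕ} (L₀ L₁ : StableCycle.{u} Fξ ξ Fη η k a b) : Prop :=
  ∃ (V : Film.{u} Fξ ξ Fη η k a b) (ι₀ : L₀.W → V.W) (ι₁ : L₁.W → V.W),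
    IsEnd V L₀ 0 ι₀ ∧ IsEnd V L₁ 1 ι₁

end
end StableCobordism

/-! ### Spaces of smooth maps, link maps and the homotopy fibre -/

namespace LinkMaps

open StableCobordism

section MappingSpaces

variable (p n : ℕ)
  (P : Type*) [TopologicalSpace P] [ChartedSpace (EuclideanSpace ℝ (Fin p)) P]
  (N : Type*) [TopologicalSpace N] [ChartedSpace (EuclideanSpace ℝ (Fin n)) N]

/-- A point of `map(P, N)`: a smooth map. -/
abbrev SmoothMap := C^∞⟮𝓡 p, P; 𝓡 n, N⟯

/-- A path in `map(P, N)`: a smooth map `P × [0,1] → N`. -/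
abbrev SmoothPath := C^∞⟮(𝓡 p).prod (𝓡∂ 1), P × I; 𝓡 n, N⟯

/-- A homotopy of paths in `map(P, N)`: a smooth map `(P × [0,1]) × [0,1] → N`. The first interval
is the parameter of the paths, the second one the parameter of the homotopy. -/
abbrev SmoothSquare := C^∞⟮((𝓡 p).prod (𝓡∂ 1)).prod (𝓡∂ 1), (P × I) × I; 𝓡 n, N⟯

/-- The space `map(P, N)` of smooth maps is simply connected: it is nonempty, any two points are
joined by a path, and any two paths with the same endpoints are homotopic through paths with the
endpoints fixed. -/
structure MapSimplyConnected : Prop where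
  nonempty : Nonempty (SmoothMap p n P N)
  joined : ∀ f g : SmoothMap p n P N, ∃ F : SmoothPath p n P N,
    ∀ x, F (x, 0) = f x ∧ F (x, 1) = g x
  homotopic : ∀ F G : SmoothPath p n P N,
    (∀ x, F (x, 0) = G (x, 0) ∧ F (x, 1) = G (x, 1)) →
    ∃ H : SmoothSquare p n P N,
      (∀ x t, H ((x, t), 0) = F (x, t) ∧ H ((x, t), 1) = G (x, t)) ∧
      (∀ x s, H ((x, 0), s) = F (x, 0) ∧ H ((x, 1), s) = F (x, 1))

end MappingSpaces

section Linking

variable {p₁ p₂ n : ℕ}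
  {P₁ : Type*} [TopologicalSpace P₁] [ChartedSpace (EuclideanSpace ℝ (Fin p₁)) P₁]
  {P₂ : Type*} [TopologicalSpace P₂] [ChartedSpace (EuclideanSpace ℝ (Fin p₂)) P₂]
  {N : Type*} [TopologicalSpace N] [ChartedSpace (EuclideanSpace ℝ (Fin n)) N]

/-- `(g₁, g₂)` is a link map: the images are disjoint. -/
def IsLinkMap (g₁ : P₁ → N) (g₂ : P₂ → N) : Prop :=
  Disjoint (Set.range g₁) (Set.range g₂)

/-- A point of `hofiber(Link(P₁,P₂;N) → map(P₁,N) × map(P₂,N))` over the basepoint `(f₁, f₂)`: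
a path `α` in `map(P₁,N) × map(P₂,N)` with `α(0) = (f₁, f₂)` and `α(1)` a link map. -/
structure Lift (f₁ : SmoothMap p₁ n P₁ N) (f₂ : SmoothMap p₂ n P₂ N) where
  /-- the first component `(x, t) ↦ f_{1,t}(x)` -/
  F₁ : SmoothPath p₁ n P₁ N
  /-- the second component `(x, t) ↦ f_{2,t}(x)` -/
  F₂ : SmoothPath p₂ n P₂ N
  start₁ : ∀ x, F₁ (x, 0) = f₁ x
  start₂ : ∀ x, F₂ (x, 0) = f₂ x
  isLinkMap : IsLinkMap (fun x => F₁ (x, 1)) (fun x => F₂ (x, 1))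

/-- The homotopy pullback `E₁₂ = holim(P₁ → N ← P₂)`: the space of all `(x₁, x₂, ω)` with
`ω : [-1,1] → N` a path from `f₁ x₁` to `f₂ x₂`. -/
abbrev HoPullback (f₁ : P₁ → N) (f₂ : P₂ → N) :=
  {e : P₁ × P₂ × C(Set.Icc (-1 : ℝ) 1, N) //
    e.2.2 ⟨-1, by norm_num⟩ = f₁ e.1 ∧ e.2.2 ⟨1, by norm_num⟩ = f₂ e.2.1}

/-- The projection `E₁₂ → P₁ × P₂`. -/
def HoPullback.proj (f₁ : P₁ → N) (f₂ : P₂ → N) : C(HoPullback f₁ f₂, P₁ × P₂) where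
  toFun e := (e.1.1, e.1.2.1)
  continuous_toFun := by fun_prop

/-- The evaluation `E₁₂ → N`, `(x₁, x₂, ω) ↦ ω(0)`. -/
def HoPullback.eval (f₁ : P₁ → N) (f₂ : P₂ → N) : C(HoPullback f₁ f₂, N) where
  toFun e := e.1.2.2 ⟨0, by norm_num⟩
  continuous_toFun := by fun_prop

namespace Lift

variable {f₁ : SmoothMap p₁ n P₁ N} {f₂ : SmoothMap p₂ n P₂ N}

/-- `α(1) = (g₁, g₂)`. -/
def EndsAt (α : Lift f₁ f₂) (g₁ : P₁ → N) (g₂ : P₂ → N) : Prop :=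
  (∀ x, α.F₁ (x, 1) = g₁ x) ∧ (∀ x, α.F₂ (x, 1) = g₂ x)

/-- `α(1) = β(1)`. -/
def SameEnd (α β : Lift f₁ f₂) : Prop :=
  α.EndsAt (fun x => β.F₁ (x, 1)) (fun x => β.F₂ (x, 1))

/-- `α` and `β` are homotopic, i.e. joined by a path in the homotopy fibre: all paths of the
homotopy start at `(f₁, f₂)` and end at a link map. -/
def Homotopic (α β : Lift f₁ f₂) : Prop :=
  ∃ (H₁ : SmoothSquare p₁ n P₁ N) (H₂ : SmoothSquare p₂ n P₂ N),
    (∀ x t, H₁ ((x, t), 0) = α.F₁ (x, t) ∧ H₁ ((x, t), 1) = β.F₁ (x, t)) ∧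
    (∀ x t, H₂ ((x, t), 0) = α.F₂ (x, t) ∧ H₂ ((x, t), 1) = β.F₂ (x, t)) ∧
    (∀ x s, H₁ ((x, 0), s) = f₁ x) ∧ (∀ x s, H₂ ((x, 0), s) = f₂ x) ∧
    (∀ s, IsLinkMap (fun x => H₁ ((x, 1), s)) (fun x => H₂ ((x, 1), s)))

/-- The map `F : P₁ × P₂ × [0,1] → N × N`, `F(x₁, x₂, t) = (f_{1,t}(x₁), f_{2,t}(x₂))`. -/
def pairMap (α : Lift f₁ f₂) (z : (P₁ × P₂) × I) : N × N :=
  (α.F₁ (z.1.1, z.2), α.F₂ (z.1.2, z.2))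

/-- The preimage `F⁻¹(Δ_N)` of the diagonal. -/
def coincidence (α : Lift f₁ f₂) : Set ((P₁ × P₂) × I) :=
  α.pairMap ⁻¹' Set.diagonal N

/-- The derivative of `F` at `z`. At a point of `F⁻¹(Δ_N)` both components of `F z` are the same
point `y` of `N`, so that both factors of the target are `T_y N`. -/
def pairDeriv (α : Lift f₁ f₂) (z : (P₁ × P₂) × I) :
    TangentSpace (((𝓡 p₁).prod (𝓡 p₂)).prod (𝓡∂ 1)) z →L[ℝ]
      EuclideanSpace ℝ (Fin n) × EuclideanSpace ℝ (Fin n) :=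
  mfderiv (((𝓡 p₁).prod (𝓡 p₂)).prod (𝓡∂ 1)) ((𝓡 n).prod (𝓡 n)) α.pairMap z

/-- `F` is transverse to the diagonal `Δ_N`: at each point of `F⁻¹(Δ_N)`, the image of the
derivative and the tangent space of the diagonal together span the tangent space of `N × N`. -/
def Transverse (α : Lift f₁ f₂) : Prop :=
  ∀ z ∈ α.coincidence, ∀ q : EuclideanSpace ℝ (Fin n) × EuclideanSpace ℝ (Fin n),
    ∃ (c : TangentSpace (((𝓡 p₁).prod (𝓡 p₂)).prod (𝓡∂ 1)) z) (d : EuclideanSpace ℝ (Fin n)),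
      q = α.pairDeriv z c + (d, d)

end Lift


variable {P₁ P₂ : Type u} [TopologicalSpace P₁] [ChartedSpace (EuclideanSpace ℝ (Fin p₁)) P₁]
  [IsManifold (𝓡 p₁) ∞ P₁]
  [TopologicalSpace P₂] [ChartedSpace (EuclideanSpace ℝ (Fin p₂)) P₂] [IsManifold (𝓡 p₂) ∞ P₂]
  [IsManifold (𝓡 n) ∞ N]

/-- Representatives of classes in the cobordism group `Ω_{p₁+p₂+1-n}^{TN-TP₁×TP₂}(E₁₂)`, with
stable isomorphism `TL ⊕ TN ≅ (TP₁ × TP₂) ⊕ ℝ`.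
If `n > p₁ + p₂ + 1`, the dimension is negative and the manifolds to be considered are empty;
the truncated difference is harmless then, as there is no such bundle isomorphism over a nonempty
base. -/
abbrev LinkingCycle (f₁ : SmoothMap p₁ n P₁ N) (f₂ : SmoothMap p₂ n P₂ N) :=
  StableCycle.{u}
    (EuclideanSpace ℝ (Fin n))
    (Pull (HoPullback.eval f₁ f₂) (TangentSpace (𝓡 n) : N → Type))
    (EuclideanSpace ℝ (Fin p₁) × EuclideanSpace ℝ (Fin p₂))
    (Pull (HoPullback.proj f₁ f₂) (TangentSpace ((𝓡 p₁).prod (𝓡 p₂)) : P₁ × P₂ → Type))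
    (p₁ + p₂ + 1 - n) 0 1

namespace LinkingCycle

variable {f₁ : SmoothMap p₁ n P₁ N} {f₂ : SmoothMap p₂ n P₂ N}

/-- The point of `P₁ × P₂` under a point of the cycle. -/
def base (L : LinkingCycle f₁ f₂) (w : L.W) : P₁ × P₂ :=
  HoPullback.proj f₁ f₂ (L.f w)

/-- The path `ω` over a point of the cycle. -/
def path (L : LinkingCycle f₁ f₂) (w : L.W) : C(Set.Icc (-1 : ℝ) 1, N) :=
  (L.f w).1.2.2

/-- The cycle `L` is the preimage `F⁻¹(Δ_N) ⊆ P₁ × P₂ × [0,1]` of the diagonal under the map `F`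
of the lift `α` (assumed to be transverse to the diagonal), embedded in `P₁ × P₂ × [0,1]` by the map
`w ↦ (x₁, x₂, t)`, with its canonical structure. -/
structure IsPreimage (L : LinkingCycle f₁ f₂) (α : Lift f₁ f₂) (t : L.W → I) : Prop where
  contMDiff : ContMDiff (𝓡 (p₁ + p₂ + 1 - n)) (((𝓡 p₁).prod (𝓡 p₂)).prod (𝓡∂ 1)) ∞
    fun w => (L.base w, t w)
  injective : Function.Injective fun w => (L.base w, t w)
  immersion : ∀ w, Function.Injective
    (mfderiv (𝓡 (p₁ + p₂ + 1 - n)) (((𝓡 p₁).prod (𝓡 p₂)).prod (𝓡∂ 1))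
      (fun w => (L.base w, t w)) w)
  range_eq : Set.range (fun w => (L.base w, t w)) = α.coincidence
  /-- The path `ω` follows `f_{1,·}(x₁)` from time `0` to time `t`, then `f_{2,·}(x₂)` back from
  time `t` to time `0`. -/
  path_left : ∀ (w : L.W) (s : Set.Icc (-1 : ℝ) 1) (τ : I), (s : ℝ) ≤ 0 →
    (τ : ℝ) = (1 + s) * t w → L.path w s = α.F₁ ((L.base w).1, τ)
  path_right : ∀ (w : L.W) (s : Set.Icc (-1 : ℝ) 1) (τ : I), 0 ≤ (s : ℝ) →
    (τ : ℝ) = (1 - s) * t w → L.path w s = α.F₂ ((L.base w).2, τ)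
  /-- On `TL`, the isomorphism `TL ⊕ TN ≅ (TP₁ × TP₂) ⊕ ℝ` is the derivative of the inclusion of
  `L` in `P₁ × P₂ × [0,1]`. -/
  φ_tangent : ∀ (w : L.W) (v : TangentSpace (𝓡 (p₁ + p₂ + 1 - n)) w),
    L.φ.toEquiv w (v, (0, 0)) =
      (mfderiv (𝓡 (p₁ + p₂ + 1 - n)) ((𝓡 p₁).prod (𝓡 p₂)) L.base w v,
        fun _ => mfderiv (𝓡 (p₁ + p₂ + 1 - n)) 𝓘(ℝ) (fun w => (t w : ℝ)) w v)
  /-- On `TN`, it splits the identification of the normal bundle of `L` with `TN` which is given by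
  the derivative of `F` and `T(N × N)/TΔ_N ≅ TN`, `(u₁, u₂) ↦ u₂ - u₁`. -/
  φ_normal : ∀ (w : L.W) (u : EuclideanSpace ℝ (Fin n)),
    let y := L.φ.toEquiv w (0, (u, 0))
    let d := α.pairDeriv (L.base w, t w) (y.1, y.2 0 • (1 : TangentSpace (𝓡∂ 1) (t w)))
    d.2 - d.1 = u

/-- The cycle `L` is a linking manifold `L_α` of the lift `α`: it is the preimage of the diagonal
for a lift `α'` in the path component of `α` in the homotopy fibre which is transverse to the
diagonal (`α' = α` is possible if `α` itself is transverse). -/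
def IsLinkingManifold (L : LinkingCycle f₁ f₂) (α : Lift f₁ f₂) : Prop :=
  ∃ α' : Lift f₁ f₂, α.Homotopic α' ∧ α'.Transverse ∧ ∃ t : L.W → I, L.IsPreimage α' t

end LinkingCycle
end Linking
end LinkMaps
end

open StableCobordism LinkMaps

open scoped Topology
set_option linter.unusedSectionVars false

/-! Write `F₁`, `F₂` for the two components of a lift, viewed as maps on P₁ × P₂ × ℝ, and D = DF₂ -
DF₁ for the difference of their derivatives. At a coincidence both derivatives take values in the
same tangent space of N, and transversality to the diagonal says that D is onto
(`Lift.transverse_iff`). Coincidences never occur at the times 0 and 1, because both ends of a lift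
are link maps. By compactness they stay away from the ends, so boundaries in the time direction play
no role and everything can be done over the open interval (0,1).

For a transverse lift the coincidence set L is a compact submanifold with TL = ker D. A continuous
family s of right inverses of D then gives the required isomorphism (v, u) ↦ di(v) + s(u) from TL ⊕
TN to T(P₁ × P₂) ⊕ ℝ, where i is the inclusion of L. Right inverses of a surjection form a convex
set, so local families are glued with a partition of unity (`exists_continuous_family`). This
produces linking manifolds (`Lift.Transverse.exists_isPreimage`), once every lift has been deformed
to a transverse one (`Lift.exists_transverse`).

Given a homotopy between transverse lifts, with homotopy parameter τ, it is made constant in τ near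
its two ends and then put in general position relative to these ends
(`Lift.Homotopic.exists_families`). Its coincidence set is a compact manifold with boundary over τ =
0 and τ = 1, and the two boundary pieces are the given linking manifolds. These come with their own
splittings s, which are arbitrary. Since the homotopy is constant near the ends, each splitting
extends to a collar. Agreement with it over the end is again a convex condition, so one splitting of
the film restricts to both (`LinkingCycle.IsPreimage.cobordant`).

General position rests on `exists_affine_perturbation`: for most affine maps q, the map g + q is
transverse to 0. The affine maps for which this fails are the C¹ image of finitely many spaces of
smaller dimension, so Hausdorff dimension replaces Sard's theorem. Cutting off in charts and using
that transversality is open over compact sets (`eventually_transverseAt`), a finite chain of such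
perturbations makes two families transverse over a compact set (`exists_transverse_deformation`).

If the mapping spaces are simply connected, lifts ending at a given link map exist, and any two of
them are homotopic with fixed ends. The third assertion therefore reduces to the second. -/

noncomputable section

namespace GeneralPosition

/-! ### Generic affine perturbations, by counting dimensions. -/

section Affine

variable {E : Type*} [NormedAddCommGroup E] [NormedSpace ℝ E]

/-- Rows of a matrix whose `i`-th row is the combination of the other rows. -/
def dependentRows {n : ℕ} (i : Fin n) (c : {j : Fin n // j ≠ i} → ℝ × (E →L[ℝ] ℝ)) (k : Fin n) :
    E →L[ℝ] ℝ :=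
  if h : k = i then ∑ j, (c j).1 • (c j).2 else (c ⟨k, h⟩).2

theorem contDiff_dependentRows {n : ℕ} (i k : Fin n) :
    ContDiff ℝ 1 fun c : {j : Fin n // j ≠ i} → ℝ × (E →L[ℝ] ℝ) => dependentRows i c k := by
  unfold dependentRows
  split_ifs with h
  · fun_prop
  · fun_prop

/-- A nonzero functional `l` which kills the range is a linear relation between the rows. It can be
solved for any row `i` whose coefficient in the relation is not zero. -/
theorem exists_dependentRows {n : ℕ} (M : E →L[ℝ] EuclideanSpace ℝ (Fin n))
    (hM : ¬ Function.Surjective M) :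
    ∃ i c, ∀ k, dependentRows i c k = (EuclideanSpace.proj k).comp M := by
  have hlt : LinearMap.range (M : E →ₗ[ℝ] EuclideanSpace ℝ (Fin n)) < ⊤ := by
    rw [lt_top_iff_ne_top]
    intro h
    exact hM (LinearMap.range_eq_top.1 h)
  obtain ⟨l, hl0, hl⟩ := Submodule.exists_le_ker_of_lt_top _ hlt
  have hsum : ∀ y : EuclideanSpace ℝ (Fin n),
      l y = ∑ k, y k * l (EuclideanSpace.single k 1) := by
    intro y
    conv_lhs => rw [← (EuclideanSpace.basisFun (Fin n) ℝ).sum_repr y]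
    simp [map_sum]
  obtain ⟨i, hi⟩ : ∃ i, l (EuclideanSpace.single i 1) ≠ 0 := by
    by_contra! h
    apply hl0
    ext y
    simp [hsum y, h]
  refine ⟨i, fun j => (-(l (EuclideanSpace.single j.1 1)) / l (EuclideanSpace.single i 1),
    (EuclideanSpace.proj j.1).comp M), fun k => ?_⟩
  unfold dependentRows
  split_ifs with h
  · subst h
    ext v
    have h0 : ∑ j, M v j * l (EuclideanSpace.single j 1) = 0 := by
      rw [← hsum]
      exact hl ⟨v, rfl⟩
    rw [← Finset.add_sum_erase _ _ (Finset.mem_univ k)] at h0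
    have h1 : ∑ j ∈ Finset.univ.erase k, M v j * l (EuclideanSpace.single j 1) =
        ∑ j : {j : Fin n // j ≠ k}, M v j * l (EuclideanSpace.single j.1 1) := by
      rw [← Finset.sum_subtype (Finset.univ.erase k) (by simp)
        (fun j => M v j * l (EuclideanSpace.single j 1))]
    rw [h1] at h0
    simp only [sum_apply, smul_apply, smul_eq_mul,
      ContinuousLinearMap.comp_apply, PiLp.proj_apply, neg_div, neg_mul,
      Finset.sum_neg_distrib, div_mul_eq_mul_div, ← Finset.sum_div]
    rw [← neg_div, div_eq_iff hi, eq_comm, eq_neg_iff_add_eq_zero, ← h0]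
    congr 1
    exact Finset.sum_congr rfl fun j _ => mul_comm _ _
  · rfl

variable [FiniteDimensional ℝ E]

/-- The affine map `x ↦ (q k).1 + (q k).2 x` as a pair of a constant and a linear map. -/
def affineOfRows (E : Type*) [NormedAddCommGroup E] [NormedSpace ℝ E] (n : ℕ) :
    (Fin n → ℝ × (E →L[ℝ] ℝ)) →ₗ[ℝ]
      EuclideanSpace ℝ (Fin n) × (E →L[ℝ] EuclideanSpace ℝ (Fin n)) where
  toFun q := (WithLp.toLp 2 fun k => (q k).1,
    ((EuclideanSpace.equiv (Fin n) ℝ).symm : (Fin n → ℝ) →L[ℝ] EuclideanSpace ℝ (Fin n)).comp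
      (ContinuousLinearMap.pi fun k => (q k).2))
  map_add' p q := by ext <;> simp
  map_smul' c q := by ext <;> simp

/-- A map to `ℝⁿ` becomes transverse to `0` after adding a suitable affine map with
arbitrarily small coefficients. -/
theorem exists_affine_perturbation {n : ℕ} {U : Set E} (hU : IsOpen U)
    {g : E → EuclideanSpace ℝ (Fin n)} (hg : ContDiffOn ℝ 2 g U)
    {O : Set (EuclideanSpace ℝ (Fin n) × (E →L[ℝ] EuclideanSpace ℝ (Fin n)))}
    (hO : O ∈ nhds 0) :
    ∃ q ∈ O, ∀ x ∈ U, g x + (q.1 + q.2 x) = 0 → Function.Surjective (fderiv ℝ g x + q.2) := by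
  -- For n = 0 every linear map is onto; the dimension count below needs n ≥ 1.
  rcases Nat.eq_zero_or_pos n with rfl | hn
  · exact ⟨0, mem_of_mem_nhds hO, fun x _ _ y => ⟨0, Subsingleton.elim _ _⟩⟩
  -- `Θ i` parametrizes the bad perturbations. A point x and dependent rows c of the perturbed
  -- derivative determine the linear part as c - Dg(x), and the vanishing of the perturbed map at x
  -- then forces the constant term. Since Dg enters, g has to be C² for `Θ i` to be C¹.
  let Θ (i : Fin n) (p : E × ({j : Fin n // j ≠ i} → ℝ × (E →L[ℝ] ℝ))) (k : Fin n) :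
      ℝ × (E →L[ℝ] ℝ) :=
    (- g p.1 k - (dependentRows i p.2 k - (EuclideanSpace.proj k).comp (fderiv ℝ g p.1)) p.1,
      dependentRows i p.2 k - (EuclideanSpace.proj k).comp (fderiv ℝ g p.1))
  have hΘ : ∀ i, ∀ p ∈ U ×ˢ (Set.univ : Set ({j : Fin n // j ≠ i} → ℝ × (E →L[ℝ] ℝ))),
      ContDiffAt ℝ 1 (Θ i) p := by
    rintro i ⟨x, c⟩ ⟨hx, -⟩
    have hx : x ∈ U := hx
    have h1 : ContDiffAt ℝ 2 g x := hg.contDiffAt (hU.mem_nhds hx)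
    have h2 : ContDiffAt ℝ 1 (fderiv ℝ g) x := h1.fderiv_right (by norm_num)
    have h3 : ContDiffAt ℝ 1 (fun p : E × ({j : Fin n // j ≠ i} → ℝ × (E →L[ℝ] ℝ)) => g p.1)
        (x, c) := ContDiffAt.comp (x, c) (h1.of_le (by norm_num)) contDiffAt_fst
    have h4 : ContDiffAt ℝ 1
        (fun p : E × ({j : Fin n // j ≠ i} → ℝ × (E →L[ℝ] ℝ)) => fderiv ℝ g p.1)
        (x, c) := ContDiffAt.comp (x, c) h2 contDiffAt_fst
    rw [contDiffAt_pi]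
    intro k
    have h5 : ContDiffAt ℝ 1 (fun p : E × ({j : Fin n // j ≠ i} → ℝ × (E →L[ℝ] ℝ)) =>
        dependentRows i p.2 k - (EuclideanSpace.proj k).comp (fderiv ℝ g p.1)) (x, c) := by
      refine ContDiffAt.sub ?_ (contDiffAt_const.clm_comp h4)
      exact (contDiff_dependentRows i k).contDiffAt.comp (x, c) contDiffAt_snd
    refine ContDiffAt.prodMk (ContDiffAt.sub (ContDiffAt.neg ?_) (h5.clm_apply contDiffAt_fst)) h5
    exact (contDiffAt_euclidean.1 h3) k
  let B : Set (Fin n → ℝ × (E →L[ℝ] ℝ)) := ⋃ i, Θ i '' (U ×ˢ Set.univ)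
  -- With d = dim E, the sources have dimension d + (n - 1)(1 + d), one less than the dimension n(1
  -- + d) of the space of perturbations. Locally Lipschitz maps do not raise the Hausdorff
  -- dimension.
  have hB : dimH B < Module.finrank ℝ (Fin n → ℝ × (E →L[ℝ] ℝ)) := by
    have hdual : Module.finrank ℝ (E →L[ℝ] ℝ) = Module.finrank ℝ E := by
      rw [← (LinearMap.toContinuousLinearMap (𝕜 := ℝ) (E := E) (F' := ℝ)).finrank_eq]
      simp
    have hle : ∀ i, dimH (Θ i '' (U ×ˢ Set.univ)) ≤
        (Module.finrank ℝ (E × ({j : Fin n // j ≠ i} → ℝ × (E →L[ℝ] ℝ))) : ℕ) := by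
      intro i
      refine le_trans (dimH_image_le_of_locally_lipschitzOn fun p hp => ?_)
        ((dimH_mono (Set.subset_univ _)).trans_eq (Real.dimH_univ_eq_finrank _))
      obtain ⟨K, t, ht, h⟩ := (hΘ i p hp).exists_lipschitzOnWith
      exact ⟨K, t, mem_nhdsWithin_of_mem_nhds ht, h⟩
    rw [dimH_iUnion]
    refine lt_of_le_of_lt (iSup_le (a := ((Module.finrank ℝ E + (n - 1) *
      (1 + Module.finrank ℝ E) : ℕ) : ENNReal)) fun i => (hle i).trans_eq ?_) ?_
    · congr 1
      rw [Module.finrank_prod, Module.finrank_pi_fintype]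
      simp [hdual, Module.finrank_prod]
    · rw [Module.finrank_pi_fintype]
      simp only [Module.finrank_prod, hdual, Module.finrank_self, Finset.sum_const,
        Finset.card_univ, Fintype.card_fin, smul_eq_mul]
      obtain ⟨m, rfl⟩ : ∃ m, n = m + 1 := ⟨n - 1, by omega⟩
      exact_mod_cast (by simp; nlinarith : Module.finrank ℝ E + (m + 1 - 1) * (1 + Module.finrank ℝ E) <
        (m + 1) * (1 + Module.finrank ℝ E))
  have hd := dense_compl_of_dimH_lt_finrank hB
  have hc : Continuous (affineOfRows E n) := LinearMap.continuous_of_finiteDimensional _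
  obtain ⟨q, hqB, hqO⟩ := hd.inter_nhds_nonempty
    (hc.continuousAt.preimage_mem_nhds (x := 0) (by rwa [map_zero]))
  refine ⟨affineOfRows E n q, hqO, fun x hx h0 => ?_⟩
  by_contra hns
  obtain ⟨i, c, hic⟩ := exists_dependentRows _ hns
  apply hqB
  refine Set.mem_iUnion.2 ⟨i, (x, c), ⟨hx, trivial⟩, ?_⟩
  funext k
  have hA : (EuclideanSpace.proj k).comp (affineOfRows E n q).2 = (q k).2 := by
    ext v; simp [affineOfRows]
  have h2 : dependentRows i c k - (EuclideanSpace.proj k).comp (fderiv ℝ g x) = (q k).2 := by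
    rw [hic k, ContinuousLinearMap.comp_add, add_sub_cancel_left, hA]
  have h1 : g x k + ((q k).1 + (q k).2 x) = 0 := by
    have := congrArg (fun y => y.ofLp k) h0
    simpa [affineOfRows] using this
  refine Prod.ext ?_ h2
  simp only [Θ, h2]
  linarith

end Affine
end GeneralPosition
end

/-! ### Submanifolds, with or without boundary, given by slice charts. -/

noncomputable section

namespace GeneralPosition

variable {E : Type*} [NormedAddCommGroup E] [NormedSpace ℝ E] {H : Type*} [TopologicalSpace H]
  (J : ModelWithCorners ℝ E H) {X : Type*} [TopologicalSpace X] [ChartedSpace H X]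
  {E' : Type*} [NormedAddCommGroup E'] [NormedSpace ℝ E'] {H' : Type*} [TopologicalSpace H']
  (I' : ModelWithCorners ℝ E' H') (F : Type*) [NormedAddCommGroup F] [NormedSpace ℝ F]

/-- Charts of the manifold `X` in which the subset `W` is the standard slice
`{0} × range I'` of `F × E'`. -/
structure SliceAtlas (W : Set X) where
  /-- the slice chart around a point -/
  e : W → OpenPartialHomeomorph X (F × E')
  mem_source : ∀ w, (w : X) ∈ (e w).source
  contMDiffOn : ∀ w, ContMDiffOn J 𝓘(ℝ, F × E') ∞ (e w) (e w).source
  contMDiffOn_symm : ∀ w, ContMDiffOn 𝓘(ℝ, F × E') J ∞ (e w).symm (e w).target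
  mem_iff : ∀ w, ∀ x ∈ (e w).source, x ∈ W ↔ (e w x).1 = 0 ∧ (e w x).2 ∈ Set.range I'

namespace SliceAtlas

variable {J I' F} {W : Set X} (S : SliceAtlas J I' F W)

/-- The subset `W` with the manifold structure given by the slice charts. -/
def Carrier (_ : SliceAtlas J I' F W) : Type _ := W

instance : TopologicalSpace S.Carrier := inferInstanceAs (TopologicalSpace W)

/-- The inclusion in the ambient manifold. -/
def incl (w : S.Carrier) : X := w.1

/-- A point of `W` as a point of the slice. -/
def point (x : X) (hx : x ∈ W) : S.Carrier := ⟨x, hx⟩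

@[simp]
theorem incl_point (x : X) (hx : x ∈ W) : S.incl (S.point x hx) = x := rfl

theorem isEmbedding_incl : Topology.IsEmbedding S.incl := Topology.IsEmbedding.subtypeVal

theorem continuous_incl : Continuous S.incl := S.isEmbedding_incl.continuous

theorem injective_incl : Function.Injective S.incl := S.isEmbedding_incl.injective

theorem range_incl : Set.range S.incl = W := Subtype.range_coe

theorem incl_mem (w : S.Carrier) : S.incl w ∈ W := w.2

/-- The slice chart around a point of the slice. -/
def ambient (w : S.Carrier) : OpenPartialHomeomorph X (F × E') := S.e w

theorem mem_ambient_source (w : S.Carrier) : S.incl w ∈ (S.ambient w).source := S.mem_source w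

theorem contMDiffOn_ambient (w : S.Carrier) :
    ContMDiffOn J 𝓘(ℝ, F × E') ∞ (S.ambient w) (S.ambient w).source := S.contMDiffOn w

theorem contMDiffOn_ambient_symm (w : S.Carrier) :
    ContMDiffOn 𝓘(ℝ, F × E') J ∞ (S.ambient w).symm (S.ambient w).target := S.contMDiffOn_symm w

theorem mem_iff_ambient (w : S.Carrier) (x : X) (hx : x ∈ (S.ambient w).source) :
    x ∈ W ↔ (S.ambient w x).1 = 0 ∧ (S.ambient w x).2 ∈ Set.range I' := S.mem_iff w x hx

theorem symm_mem (w : S.Carrier) {h : H'} (hh : ((0 : F), I' h) ∈ (S.ambient w).target) :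
    (S.ambient w).symm (0, I' h) ∈ W := by
  rw [S.mem_iff_ambient w _ ((S.ambient w).map_target hh), (S.ambient w).right_inv hh]
  exact ⟨rfl, h, rfl⟩

theorem apply_eq (w : S.Carrier) {x : S.Carrier} (hx : S.incl x ∈ (S.ambient w).source) :
    S.ambient w (S.incl x) = (0, I' (I'.symm (S.ambient w (S.incl x)).2)) := by
  obtain ⟨h1, h2⟩ := (S.mem_iff_ambient w _ hx).1 x.2
  rw [I'.right_inv h2]
  exact Prod.ext h1 rfl

open Classical in
/-- The inverse of the chart of the slice. -/
def chartInv (w : S.Carrier) (h : H') : S.Carrier :=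
  if hh : ((0 : F), I' h) ∈ (S.ambient w).target then S.point _ (S.symm_mem w hh) else w

theorem incl_chartInv (w : S.Carrier) {h : H'} (hh : ((0 : F), I' h) ∈ (S.ambient w).target) :
    S.incl (S.chartInv w h) = (S.ambient w).symm (0, I' h) := by
  rw [chartInv, dif_pos hh, incl_point]

/-- The chart of the slice. -/
def chart (w : S.Carrier) : OpenPartialHomeomorph S.Carrier H' where
  toFun x := I'.symm (S.ambient w (S.incl x)).2
  invFun := S.chartInv w
  source := S.incl ⁻¹' (S.ambient w).source
  target := {h | ((0 : F), I' h) ∈ (S.ambient w).target}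
  map_source' x hx := by
    change _ ∈ (S.ambient w).target
    rw [← S.apply_eq w hx]
    exact (S.ambient w).map_source hx
  map_target' h hh := by
    rw [Set.mem_preimage, S.incl_chartInv w hh]
    exact (S.ambient w).map_target hh
  left_inv' x hx := by
    have h0 := S.apply_eq w hx
    have h1 := (S.ambient w).map_source hx
    rw [h0] at h1
    apply S.injective_incl
    rw [S.incl_chartInv w h1, ← h0, (S.ambient w).left_inv hx]
  right_inv' h hh := by
    rw [S.incl_chartInv w hh, (S.ambient w).right_inv hh, I'.left_inv]
  open_source := (S.ambient w).open_source.preimage S.continuous_incl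
  open_target := (S.ambient w).open_target.preimage (by fun_prop)
  continuousOn_toFun := by
    refine I'.continuous_symm.comp_continuousOn (continuous_snd.comp_continuousOn ?_)
    exact (S.ambient w).continuousOn.comp S.continuous_incl.continuousOn fun x hx => hx
  continuousOn_invFun := by
    rw [S.isEmbedding_incl.isInducing.continuousOn_iff]
    refine ContinuousOn.congr (f := fun h => (S.ambient w).symm (0, I' h)) ?_ fun h hh => ?_
    · exact (S.ambient w).continuousOn_symm.comp (by fun_prop) fun h hh => hh
    · exact S.incl_chartInv w hh

theorem model_chart (w : S.Carrier) {x : S.Carrier} (hx : S.incl x ∈ (S.ambient w).source) :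
    I' (S.chart w x) = (S.ambient w (S.incl x)).2 :=
  I'.right_inv ((S.mem_iff_ambient w _ hx).1 x.2).2

theorem incl_chart_symm (w : S.Carrier) {h : H'} (hh : h ∈ (S.chart w).target) :
    S.incl ((S.chart w).symm h) = (S.ambient w).symm (0, I' h) :=
  S.incl_chartInv w hh

instance : ChartedSpace H' S.Carrier where
  atlas := Set.range S.chart
  chartAt := S.chart
  mem_chart_source w := S.mem_ambient_source w
  chart_mem_atlas w := ⟨w, rfl⟩

/-- A transition map of slices is the ambient transition map restricted to {0} × E' and followed by
the second projection. It is therefore the restriction of a map which is smooth on an open subset of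
E', also at points of the frontier of `range I'`. -/
instance : IsManifold I' ∞ S.Carrier := by
  refine isManifold_of_contDiffOn I' ∞ S.Carrier ?_
  rintro _ _ ⟨w, rfl⟩ ⟨w', rfl⟩
  have key : ContDiffOn ℝ ∞ (fun v : E' => (S.ambient w' ((S.ambient w).symm (0, v))).2)
      {v | ((0 : F), v) ∈ (S.ambient w).target ∧ (S.ambient w).symm (0, v) ∈ (S.ambient w').source} := by
    have h1 : ContMDiffOn 𝓘(ℝ, F × E') 𝓘(ℝ, F × E') ∞ (S.ambient w' ∘ (S.ambient w).symm)
        ((S.ambient w).target ∩ (S.ambient w).symm ⁻¹' (S.ambient w').source) :=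
      (S.contMDiffOn_ambient w').comp (S.contMDiffOn_ambient_symm w |>.mono Set.inter_subset_left)
        fun x hx => hx.2
    rw [contMDiffOn_iff_contDiffOn] at h1
    exact contDiff_snd.comp_contDiffOn (h1.comp (f := fun v : E' => ((0 : F), v))
      (by fun_prop) fun v hv => hv)
  refine (key.congr_mono (f₁ := I' ∘ ((S.chart w).symm.trans (S.chart w')) ∘ I'.symm)
    (s₁ := I'.symm ⁻¹' ((S.chart w).symm.trans (S.chart w')).source ∩ Set.range I') ?_ ?_)
  · rintro _ ⟨⟨h1, h2⟩, h, rfl⟩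
    simp only [Set.mem_preimage, ModelWithCorners.left_inv] at h1 h2
    have h2 : S.incl ((S.chart w).symm h) ∈ (S.ambient w').source := h2
    simp only [Function.comp_apply, ModelWithCorners.left_inv, OpenPartialHomeomorph.coe_trans]
    rw [S.model_chart w' h2, S.incl_chart_symm w h1]
  · rintro _ ⟨⟨h1, h2⟩, h, rfl⟩
    simp only [Set.mem_preimage, ModelWithCorners.left_inv] at h1 h2
    have h2 : S.incl ((S.chart w).symm h) ∈ (S.ambient w').source := h2
    rw [S.incl_chart_symm w h1] at h2
    exact ⟨h1, h2⟩

theorem extChartAt_apply (w : S.Carrier) {x : S.Carrier} (hx : S.incl x ∈ (S.ambient w).source) :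
    extChartAt I' w x = (S.ambient w (S.incl x)).2 := S.model_chart w hx

theorem eventually_mem_source (w : S.Carrier) : ∀ᶠ x in 𝓝 w, S.incl x ∈ (S.ambient w).source :=
  S.continuous_incl.continuousAt.preimage_mem_nhds
    ((S.ambient w).open_source.mem_nhds (S.mem_ambient_source w))

theorem contMDiff_incl : ContMDiff I' J ∞ S.incl := by
  intro w
  have h1 : ContMDiffAt I' 𝓘(ℝ, F × E') ∞ (fun x => ((0 : F), extChartAt I' w x)) w :=
    contMDiffAt_const.prodMk_space (contMDiffAt_extChartAt)
  have h2 : S.ambient w (S.incl w) = ((0 : F), extChartAt I' w w) := by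
    rw [S.extChartAt_apply w (S.mem_ambient_source w)]
    exact Prod.ext ((S.mem_iff_ambient w _ (S.mem_ambient_source w)).1 w.2).1 rfl
  have h3 : ContMDiffAt 𝓘(ℝ, F × E') J ∞ (S.ambient w).symm ((0 : F), extChartAt I' w w) := by
    rw [← h2]
    exact (S.contMDiffOn_ambient_symm w).contMDiffAt
      ((S.ambient w).open_target.mem_nhds ((S.ambient w).map_source (S.mem_ambient_source w)))
  refine (ContMDiffAt.comp w h3 h1).congr_of_eventuallyEq ?_
  filter_upwards [S.eventually_mem_source w] with x hx
  simp only [Function.comp_apply]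
  rw [S.extChartAt_apply w hx]
  have : ((0 : F), (S.ambient w (S.incl x)).2) = S.ambient w (S.incl x) :=
    Prod.ext ((S.mem_iff_ambient w _ hx).1 x.2).1.symm rfl
  rw [this, (S.ambient w).left_inv hx]

theorem contMDiffAt_chart (w : S.Carrier) : ContMDiffAt J 𝓘(ℝ, F × E') ∞ (S.ambient w) (S.incl w) :=
  (S.contMDiffOn_ambient w).contMDiffAt ((S.ambient w).open_source.mem_nhds (S.mem_ambient_source w))

/-- Continuity holds because the inclusion is an embedding. In the slice chart, the coordinates of
`f` are the second components of the ambient coordinates of `S.incl ∘ f`. -/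
theorem contMDiff_of_incl_comp {EM HM M : Type*} [NormedAddCommGroup EM] [NormedSpace ℝ EM]
    [TopologicalSpace HM] {K : ModelWithCorners ℝ EM HM} [TopologicalSpace M] [ChartedSpace HM M]
    {f : M → S.Carrier} (hf : ContMDiff K J ∞ (S.incl ∘ f)) : ContMDiff K I' ∞ f := by
  have hc : Continuous f := S.isEmbedding_incl.isInducing.continuous_iff.2 hf.continuous
  intro m
  rw [contMDiffAt_iff_target]
  refine ⟨hc.continuousAt, ?_⟩
  have h1 : ContMDiffAt K 𝓘(ℝ, F × E') ∞ (S.ambient (f m) ∘ (S.incl ∘ f)) m :=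
    (S.contMDiffAt_chart (f m)).comp m (hf m)
  have h2 : ContMDiffAt K 𝓘(ℝ, E') ∞ (fun y => ((S.ambient (f m) ∘ (S.incl ∘ f)) y).2) m :=
    (contDiff_snd.contMDiff).contMDiffAt.comp m h1
  refine h2.congr_of_eventuallyEq ?_
  filter_upwards [hc.continuousAt.eventually (S.eventually_mem_source (f m))] with y hy
  exact S.extChartAt_apply (f m) hy

/-- The chart of the slice is the second component of the ambient chart composed with the inclusion.
Its derivative is invertible, so the first factor of the composition has injective derivative. -/
theorem injective_mfderiv_incl (w : S.Carrier) : Function.Injective (mfderiv I' J S.incl w) := by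
  have hinv : (mfderiv I' 𝓘(ℝ, E') (extChartAt I' w) w).IsInvertible :=
    isInvertible_mfderiv_extChartAt (mem_extChartAt_source w)
  have hg : MDifferentiableAt J 𝓘(ℝ, E') (fun x => (S.ambient w x).2) (S.incl w) :=
    ((contDiff_snd.contMDiff).contMDiffAt.comp _ (S.contMDiffAt_chart w)).mdifferentiableAt
      (by simp)
  have heq : mfderiv I' 𝓘(ℝ, E') (extChartAt I' w) w =
      (mfderiv J 𝓘(ℝ, E') (fun x => (S.ambient w x).2) (S.incl w)).comp (mfderiv I' J S.incl w) := by
    rw [← mfderiv_comp w hg ((S.contMDiff_incl w).mdifferentiableAt (by simp))]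
    apply Filter.EventuallyEq.mfderiv_eq
    filter_upwards [S.eventually_mem_source w] with x hx
    exact S.extChartAt_apply w hx
  intro a b hab
  apply hinv.injective
  rw [heq]
  exact congrArg (mfderiv J 𝓘(ℝ, E') (fun x => (S.ambient w x).2) (S.incl w)) hab

theorem mem_boundary_iff (w : S.Carrier) :
    w ∈ I'.boundary S.Carrier ↔ (S.ambient w (S.incl w)).2 ∈ frontier (Set.range I') := by
  rw [ModelWithCorners.boundary, Set.mem_ofPred_eq, ModelWithCorners.IsBoundaryPoint,
    S.extChartAt_apply w (S.mem_ambient_source w)]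

end SliceAtlas
end GeneralPosition
end

/-! ### Charts from the inverse function theorem. -/

noncomputable section

namespace GeneralPosition

/-- A projection onto the kernel of `A`, identified with G by dimension, supplies the missing
components. -/
theorem exists_linear_complement {E F G : Type*} [NormedAddCommGroup E] [NormedSpace ℝ E]
    [FiniteDimensional ℝ E] [NormedAddCommGroup F] [NormedSpace ℝ F] [FiniteDimensional ℝ F]
    [NormedAddCommGroup G] [NormedSpace ℝ G] [FiniteDimensional ℝ G]
    (A : E →L[ℝ] F) (hA : Function.Surjective A)
    (hd : Module.finrank ℝ E = Module.finrank ℝ F + Module.finrank ℝ G) :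
    ∃ B : E →L[ℝ] G, Function.Bijective (A.prod B) := by
  let K := LinearMap.ker (A : E →ₗ[ℝ] F)
  have hK : Module.finrank ℝ K = Module.finrank ℝ G := by
    have h1 := LinearMap.finrank_range_add_finrank_ker (A : E →ₗ[ℝ] F)
    rw [LinearMap.range_eq_top.2 hA, finrank_top] at h1
    change _ + Module.finrank ℝ K = _ at h1
    omega
  obtain ⟨r, hr⟩ := LinearMap.exists_leftInverse_of_injective K.subtype (by simp [K])
  let B : E →ₗ[ℝ] G := (LinearEquiv.ofFinrankEq K G hK).toLinearMap ∘ₗ r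
  refine ⟨LinearMap.toContinuousLinearMap B, ?_⟩
  have hinj : Function.Injective (A.prod (LinearMap.toContinuousLinearMap B)) := by
    rw [injective_iff_map_eq_zero]
    intro x hx
    have hx1 : A x = 0 := congrArg Prod.fst hx
    have hx2 : B x = 0 := congrArg Prod.snd hx
    have hx3 : r x = 0 := by simpa [B] using hx2
    have hx4 := LinearMap.congr_fun hr (⟨x, hx1⟩ : K)
    simp only [LinearMap.comp_apply, Submodule.subtype_apply, LinearMap.id_apply] at hx4
    rw [hx3] at hx4
    exact (congrArg Subtype.val hx4).symm
  refine ⟨hinj, ?_⟩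
  refine (LinearMap.injective_iff_surjective_of_finrank_eq_finrank
    (f := (A.prod (LinearMap.toContinuousLinearMap B) : E →L[ℝ] F × G).toLinearMap) ?_).1 hinj
  rw [hd, Module.finrank_prod]

section

variable {E : Type*} [NormedAddCommGroup E] [NormedSpace ℝ E] [FiniteDimensional ℝ E]
  {H : Type*} [TopologicalSpace H]
  {J : ModelWithCorners ℝ E H} [J.Boundaryless]
  {X : Type*} [TopologicalSpace X] [ChartedSpace H X] [IsManifold J ∞ X]
  {V : Type*} [NormedAddCommGroup V] [NormedSpace ℝ V]

variable (J) in
/-- The extended chart of a manifold without boundary as an open partial homeomorphism. -/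
def openChart (x₀ : X) : OpenPartialHomeomorph X E :=
  (chartAt H x₀).transHomeomorph J.toHomeomorph

theorem openChart_target (x₀ : X) : (openChart J x₀).target = (extChartAt J x₀).target := by
  rw [extChartAt_target, J.range_eq_univ, Set.inter_univ]
  rfl

theorem contMDiffOn_openChart (x₀ : X) :
    ContMDiffOn J 𝓘(ℝ, E) ∞ (openChart J x₀) (openChart J x₀).source :=
  contMDiffOn_extChartAt

theorem contMDiffOn_openChart_symm (x₀ : X) :
    ContMDiffOn 𝓘(ℝ, E) J ∞ (openChart J x₀).symm (openChart J x₀).target := by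
  rw [openChart_target]
  exact contMDiffOn_extChartAt_symm x₀

theorem hasMFDerivAt_prodMk_space {G : Type*} [NormedAddCommGroup G] [NormedSpace ℝ G]
    {f : X → V} {g : X → G} {x : X} {f' : E →L[ℝ] V} {g' : E →L[ℝ] G}
    (hf : HasMFDerivAt J 𝓘(ℝ, V) f x f') (hg : HasMFDerivAt J 𝓘(ℝ, G) g x g') :
    HasMFDerivAt J 𝓘(ℝ, V × G) (fun y => (f y, g y)) x (f'.prod g') :=
  ⟨hf.1.prodMk hg.1, HasFDerivWithinAt.prodMk hf.2 hg.2⟩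

/-- The inverse function theorem: a smooth map with bijective derivative is a chart. -/
theorem exists_chart_of_bijective_mfderiv {Φ : X → V} {U : Set X} (hU : IsOpen U)
    (hΦ : ContMDiffOn J 𝓘(ℝ, V) ∞ Φ U) {x₀ : X} (hx₀ : x₀ ∈ U)
    (hb : Function.Bijective (mfderiv J 𝓘(ℝ, V) Φ x₀)) :
    ∃ e : OpenPartialHomeomorph X V, x₀ ∈ e.source ∧ e.source ⊆ U ∧ (∀ x ∈ e.source, e x = Φ x) ∧
      ContMDiffOn J 𝓘(ℝ, V) ∞ e e.source ∧ ContMDiffOn 𝓘(ℝ, V) J ∞ e.symm e.target := by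
  have : CompleteSpace E := FiniteDimensional.complete ℝ E
  let φ := openChart J x₀
  let f : E → V := Φ ∘ φ.symm
  let O : Set E := φ.target ∩ φ.symm ⁻¹' U
  have hO : IsOpen O := φ.isOpen_inter_preimage_symm hU
  have hxs : x₀ ∈ φ.source := mem_chart_source H x₀
  have hxO : φ x₀ ∈ O := ⟨φ.map_source hxs, by
    change φ.symm (φ x₀) ∈ U
    rwa [φ.left_inv hxs]⟩
  have hf : ContDiffOn ℝ ∞ f O := by
    rw [← contMDiffOn_iff_contDiffOn]
    exact hΦ.comp ((contMDiffOn_openChart_symm x₀).mono Set.inter_subset_left) fun x hx => hx.2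
  have hfat : ∀ v ∈ O, ContDiffAt ℝ ∞ f v := fun v hv => hf.contDiffAt (hO.mem_nhds hv)
  have hder : mfderiv J 𝓘(ℝ, V) Φ x₀ = fderiv ℝ f (φ x₀) := by
    have hm : MDifferentiableAt J 𝓘(ℝ, V) Φ x₀ :=
      (hΦ.contMDiffAt (hU.mem_nhds hx₀)).mdifferentiableAt (by simp)
    rw [hm.mfderiv, J.range_eq_univ, fderivWithin_univ]
    rfl
  rw [hder] at hb
  have hdiff : HasFDerivAt f (fderiv ℝ f (φ x₀)) (φ x₀) :=
    ((hfat _ hxO).differentiableAt (by simp)).hasFDerivAt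
  let L : E ≃L[ℝ] V := (LinearEquiv.ofBijective (fderiv ℝ f (φ x₀)).toLinearMap hb).toContinuousLinearEquiv
  have hL : (L : E →L[ℝ] V) = fderiv ℝ f (φ x₀) := by ext; rfl
  have hdiff' : HasFDerivAt f (L : E →L[ℝ] V) (φ x₀) := by rwa [hL]
  let e₀ := (hfat _ hxO).toOpenPartialHomeomorph f hdiff' (by simp)
  -- Invertibility of the derivative is an open condition. Restricting to it makes the inverse
  -- smooth on the whole target, not only at the image of `x₀`.
  let O' : Set E := O ∩ fderiv ℝ f ⁻¹' Set.range ((↑) : (E ≃L[ℝ] V) → E →L[ℝ] V)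
  have hO' : IsOpen O' :=
    (hf.continuousOn_fderiv_of_isOpen hO (by simp)).isOpen_inter_preimage hO
      ContinuousLinearEquiv.isOpen
  let e₁ : OpenPartialHomeomorph E V := e₀.restrOpen O' hO'
  have he₁ : ∀ v, e₁ v = f v := fun v => rfl
  have hs₁ : e₁.source = e₀.source ∩ O' := rfl
  have hsrc : ∀ x ∈ (φ.trans e₁).source, x ∈ φ.source ∧ φ x ∈ e₁.source := fun x hx => hx
  have hOat : ∀ v ∈ e₁.source, v ∈ O ∧ ∃ L' : E ≃L[ℝ] V, HasFDerivAt f (L' : E →L[ℝ] V) v := by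
    rintro v ⟨-, hv, L', hL'⟩
    exact ⟨hv, L', hL' ▸ ((hfat _ hv).differentiableAt (by simp)).hasFDerivAt⟩
  refine ⟨φ.trans e₁, ⟨hxs, ?_, hxO, L, hL⟩, fun x hx => ?_, fun x hx => ?_, ?_, ?_⟩
  · exact (hfat _ hxO).mem_toOpenPartialHomeomorph_source hdiff' (by simp)
  · have h := (hOat _ (hsrc x hx).2).1.2
    rwa [Set.mem_preimage, φ.left_inv (hsrc x hx).1] at h
  · change Φ (φ.symm (φ x)) = Φ x
    rw [φ.left_inv (hsrc x hx).1]
  · refine ContMDiffOn.comp (t := O) (g := f) ?_ ((contMDiffOn_openChart x₀).mono ?_) ?_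
    · rwa [contMDiffOn_iff_contDiffOn]
    · exact fun x hx => (hsrc x hx).1
    · exact fun x hx => (hOat _ (hsrc x hx).2).1
  · have h1 : ContDiffOn ℝ ∞ e₁.symm e₁.target := by
      intro v hv
      obtain ⟨hO₁, L', hL'⟩ := hOat _ (e₁.map_target hv)
      exact (e₁.contDiffAt_symm hv hL' (hfat _ hO₁)).contDiffWithinAt
    have h2 : ContMDiffOn 𝓘(ℝ, V) 𝓘(ℝ, E) ∞ e₁.symm e₁.target := by
      rwa [contMDiffOn_iff_contDiffOn]
    have h3 : ContMDiffOn 𝓘(ℝ, V) 𝓘(ℝ, E) ∞ e₁.symm (φ.trans e₁).target :=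
      h2.mono fun v hv => hv.1
    exact (contMDiffOn_openChart_symm x₀).comp h3 fun v hv => hv.2

/-- Linear functions of a chart complete `g` to a map with bijective derivative at `x₀`, to which
the inverse function theorem applies. -/
theorem exists_chart_of_surjective_mfderiv {F G : Type*} [NormedAddCommGroup F] [NormedSpace ℝ F]
    [FiniteDimensional ℝ F] [NormedAddCommGroup G] [NormedSpace ℝ G] [FiniteDimensional ℝ G]
    {g : X → F} {U : Set X} (hU : IsOpen U)
    (hg : ContMDiffOn J 𝓘(ℝ, F) ∞ g U) {x₀ : X} (hx₀ : x₀ ∈ U)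
    (hs : Function.Surjective (mfderiv J 𝓘(ℝ, F) g x₀))
    (hd : Module.finrank ℝ E = Module.finrank ℝ F + Module.finrank ℝ G) :
    ∃ e : OpenPartialHomeomorph X (F × G), x₀ ∈ e.source ∧ e.source ⊆ U ∧
      (∀ x ∈ e.source, (e x).1 = g x) ∧
      ContMDiffOn J 𝓘(ℝ, F × G) ∞ e e.source ∧ ContMDiffOn 𝓘(ℝ, F × G) J ∞ e.symm e.target := by
  have hinv : (mfderiv J 𝓘(ℝ, E) (extChartAt J x₀) x₀).IsInvertible :=
    isInvertible_mfderiv_extChartAt (mem_extChartAt_source x₀)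
  obtain ⟨C, hC⟩ := hinv
  let A : E →L[ℝ] F := mfderiv J 𝓘(ℝ, F) g x₀
  let C' : E ≃L[ℝ] E := C
  -- The complement is taken in the coordinates of the chart, whose derivative at `x₀` is `C'`. The
  -- derivative of the completed map is then (A, B ∘ C') = (A ∘ C'⁻¹, B) ∘ C'.
  obtain ⟨B, hB⟩ := exists_linear_complement (G := G) (A.comp (C'.symm : E →L[ℝ] E))
    (hs.comp C'.symm.surjective) hd
  have hgat : ContMDiffAt J 𝓘(ℝ, F) ∞ g x₀ := hg.contMDiffAt (hU.mem_nhds hx₀)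
  have hφat : ContMDiffAt J 𝓘(ℝ, E) ∞ (extChartAt J x₀) x₀ := contMDiffAt_extChartAt
  have hder : HasMFDerivAt J 𝓘(ℝ, F × G) (fun x => (g x, B (extChartAt J x₀ x))) x₀
      (A.prod (B.comp (C' : E →L[ℝ] E))) := by
    refine hasMFDerivAt_prodMk_space (hgat.mdifferentiableAt (by simp)).hasMFDerivAt ?_
    refine HasMFDerivAt.comp x₀ (I' := 𝓘(ℝ, E)) (g := B) B.hasMFDerivAt ?_
    have := (hφat.mdifferentiableAt (by simp)).hasMFDerivAt
    rwa [← hC] at this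
  have hsm : ContMDiffOn J 𝓘(ℝ, F × G) ∞ (fun x => (g x, B (extChartAt J x₀ x)))
      (U ∩ (chartAt H x₀).source) :=
    (hg.mono Set.inter_subset_left).prodMk_space
      (B.contDiff.contMDiff.comp_contMDiffOn (contMDiffOn_extChartAt.mono Set.inter_subset_right))
  have hbij : Function.Bijective
      (mfderiv J 𝓘(ℝ, F × G) (fun x => (g x, B (extChartAt J x₀ x))) x₀) := by
    rw [hder.mfderiv]
    have : (⇑(A.prod (B.comp (C' : E →L[ℝ] E))) : E → F × G) =
        ((A.comp (C'.symm : E →L[ℝ] E)).prod B) ∘ C' := by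
      funext v
      simp
    change Function.Bijective (⇑(A.prod (B.comp (C' : E →L[ℝ] E))) : E → F × G)
    rw [this]
    exact hB.comp C'.bijective
  obtain ⟨e, h1, h2, h3, h4, h5⟩ := exists_chart_of_bijective_mfderiv
    (hU.inter (chartAt H x₀).open_source) hsm ⟨hx₀, mem_chart_source H x₀⟩ hbij
  exact ⟨e, h1, h2.trans Set.inter_subset_left, fun x hx => congrArg Prod.fst (h3 x hx), h4, h5⟩

/-- Composition of a chart with a diffeomorphism of the model. -/
theorem exists_chart_trans {V' : Type*} [NormedAddCommGroup V'] [NormedSpace ℝ V']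
    (e : OpenPartialHomeomorph X V) (h₁ : ContMDiffOn J 𝓘(ℝ, V) ∞ e e.source)
    (h₂ : ContMDiffOn 𝓘(ℝ, V) J ∞ e.symm e.target) (L : V ≃ₜ V') (hL : ContDiff ℝ ∞ L)
    (hL' : ContDiff ℝ ∞ L.symm) {U : Set X} (hU : IsOpen U) :
    ∃ e' : OpenPartialHomeomorph X V', e'.source = e.source ∩ U ∧ (∀ x, e' x = L (e x)) ∧
      ContMDiffOn J 𝓘(ℝ, V') ∞ e' e'.source ∧ ContMDiffOn 𝓘(ℝ, V') J ∞ e'.symm e'.target := by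
  refine ⟨(e.transHomeomorph L).restrOpen U hU, rfl, fun x => rfl, ?_, ?_⟩
  · exact hL.contMDiff.comp_contMDiffOn (h₁.mono Set.inter_subset_left)
  · exact h₂.comp hL'.contMDiff.contMDiffOn fun v hv => hv.1

/-- `EuclideanSpace ℝ (Fin (k + 1))` as the product of the first coordinate and the others. -/
def euclideanCons (k : ℕ) :
    (ℝ × EuclideanSpace ℝ (Fin k)) ≃L[ℝ] EuclideanSpace ℝ (Fin (k + 1)) :=
  (((ContinuousLinearEquiv.refl ℝ ℝ).prodCongr (EuclideanSpace.equiv (Fin k) ℝ)).trans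
    (Fin.consEquivL ℝ fun _ : Fin (k + 1) => ℝ)).trans (EuclideanSpace.equiv (Fin (k + 1)) ℝ).symm

theorem euclideanCons_zero (k : ℕ) (p : ℝ × EuclideanSpace ℝ (Fin k)) :
    euclideanCons k p 0 = p.1 := rfl

/-- This provides boundary charts: the coordinate which defines the half space is the prescribed
function `h`. It is obtained by applying the submersion chart to (g, h) jointly. -/
theorem exists_chart_with_coordinate {F : Type*} [NormedAddCommGroup F] [NormedSpace ℝ F]
    [FiniteDimensional ℝ F] {k : ℕ}
    {g : X → F} {h : X → ℝ} {U : Set X} (hU : IsOpen U)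
    (hg : ContMDiffOn J 𝓘(ℝ, F) ∞ g U) (hh : ContMDiffOn J 𝓘(ℝ, ℝ) ∞ h U) {x₀ : X} (hx₀ : x₀ ∈ U)
    (hs : ∀ (a : F) (b : ℝ), ∃ v : E, (mfderiv J 𝓘(ℝ, F) g x₀ v : F) = a ∧
      (mfderiv J 𝓘(ℝ, ℝ) h x₀ v : ℝ) = b)
    (hd : Module.finrank ℝ E = Module.finrank ℝ F + (k + 1)) :
    ∃ e : OpenPartialHomeomorph X (F × EuclideanSpace ℝ (Fin (k + 1))), x₀ ∈ e.source ∧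
      e.source ⊆ U ∧ (∀ x ∈ e.source, (e x).1 = g x ∧ (e x).2 0 = h x) ∧
      ContMDiffOn J 𝓘(ℝ, F × EuclideanSpace ℝ (Fin (k + 1))) ∞ e e.source ∧
      ContMDiffOn 𝓘(ℝ, F × EuclideanSpace ℝ (Fin (k + 1))) J ∞ e.symm e.target := by
  have hgat := (hg.contMDiffAt (hU.mem_nhds hx₀)).mdifferentiableAt (by simp)
  have hhat := (hh.contMDiffAt (hU.mem_nhds hx₀)).mdifferentiableAt (by simp)
  have hsurj : Function.Surjective (mfderiv J 𝓘(ℝ, F × ℝ) (fun x => (g x, h x)) x₀) := by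
    rw [(hasMFDerivAt_prodMk_space hgat.hasMFDerivAt hhat.hasMFDerivAt).mfderiv]
    rintro ⟨a, b⟩
    obtain ⟨v, hv1, hv2⟩ := hs a b
    exact ⟨v, Prod.ext hv1 hv2⟩
  obtain ⟨e, h1, h2, h3, h4, h5⟩ := exists_chart_of_surjective_mfderiv (J := J)
    (G := EuclideanSpace ℝ (Fin k)) hU (hg.prodMk_space hh) hx₀ hsurj
    (by simp [hd, Module.finrank_prod]; ring)
  let L : ((F × ℝ) × EuclideanSpace ℝ (Fin k)) ≃L[ℝ] F × EuclideanSpace ℝ (Fin (k + 1)) :=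
    (ContinuousLinearEquiv.prodAssoc ℝ F ℝ (EuclideanSpace ℝ (Fin k))).trans
      ((ContinuousLinearEquiv.refl ℝ F).prodCongr (euclideanCons k))
  obtain ⟨e', e1, e2, e3, e4⟩ := exists_chart_trans e h4 h5 L.toHomeomorph L.contDiff
    L.symm.contDiff hU
  refine ⟨e', e1 ▸ ⟨h1, hx₀⟩, e1 ▸ Set.inter_subset_right, fun x hx => ?_, e3, e4⟩
  rw [e1] at hx
  have h3x := h3 x hx.1
  rw [e2]
  exact ⟨congrArg Prod.fst h3x, (euclideanCons_zero k _).trans (congrArg Prod.snd h3x)⟩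

/-- Interior points of a manifold with boundary also need charts with values in the half space. A
translation moves the image of `x₀` off the boundary hyperplane. -/
theorem exists_chart_with_positive_coordinate {F : Type*} [NormedAddCommGroup F] [NormedSpace ℝ F]
    [FiniteDimensional ℝ F] {k : ℕ} {g : X → F} {U : Set X} (hU : IsOpen U)
    (hg : ContMDiffOn J 𝓘(ℝ, F) ∞ g U) {x₀ : X} (hx₀ : x₀ ∈ U)
    (hs : Function.Surjective (mfderiv J 𝓘(ℝ, F) g x₀))
    (hd : Module.finrank ℝ E = Module.finrank ℝ F + (k + 1)) :
    ∃ e : OpenPartialHomeomorph X (F × EuclideanSpace ℝ (Fin (k + 1))), x₀ ∈ e.source ∧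
      e.source ⊆ U ∧ (∀ x ∈ e.source, (e x).1 = g x ∧ 0 < (e x).2 0) ∧
      ContMDiffOn J 𝓘(ℝ, F × EuclideanSpace ℝ (Fin (k + 1))) ∞ e e.source ∧
      ContMDiffOn 𝓘(ℝ, F × EuclideanSpace ℝ (Fin (k + 1))) J ∞ e.symm e.target := by
  obtain ⟨e, h1, h2, h3, h4, h5⟩ := exists_chart_of_surjective_mfderiv (J := J)
    (G := EuclideanSpace ℝ (Fin (k + 1))) hU hg hx₀ hs (by simpa using hd)
  -- Translation by `c` makes the coordinate with index 0 equal to 1 at `x₀`.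
  let c : F × EuclideanSpace ℝ (Fin (k + 1)) :=
    (0, EuclideanSpace.single 0 (1 - (e x₀).2 0))
  let P : Set (F × EuclideanSpace ℝ (Fin (k + 1))) := {p | 0 < (p + c).2 0}
  have hP : IsOpen P := isOpen_lt continuous_const (by fun_prop)
  obtain ⟨e', e1, e2, e3, e4⟩ := exists_chart_trans e h4 h5 (Homeomorph.addRight c)
    (contDiff_id.add contDiff_const) (contDiff_id.add contDiff_const)
    (e.isOpen_inter_preimage hP)
  refine ⟨e', ?_, ?_, fun x hx => ?_, e3, e4⟩
  · rw [e1]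
    exact ⟨h1, h1, by simp [P, c]⟩
  · rw [e1]
    exact fun x hx => h2 hx.1
  · rw [e1] at hx
    rw [e2]
    exact ⟨by simp [c, h3 x hx.1], hx.2.2⟩

end
end GeneralPosition
end

/-! ### Transversality of two maps to N, and its openness. -/

noncomputable section

namespace GeneralPosition

/-- Let `B` be a right inverse of `A`. For `A'` near `A` the composition `A' ∘ B` stays invertible,
which makes `A'` onto. -/
theorem eventually_surjective {E F : Type*} [NormedAddCommGroup E] [NormedSpace ℝ E]
    [NormedAddCommGroup F] [NormedSpace ℝ F] [FiniteDimensional ℝ F]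
    {A : E →L[ℝ] F} (hA : Function.Surjective A) : ∀ᶠ A' : E →L[ℝ] F in 𝓝 A,
    Function.Surjective A' := by
  have : CompleteSpace F := FiniteDimensional.complete ℝ F
  obtain ⟨r, hr⟩ := LinearMap.exists_rightInverse_of_surjective (A : E →ₗ[ℝ] F)
    (LinearMap.range_eq_top.2 hA)
  let B : F →L[ℝ] E := LinearMap.toContinuousLinearMap r
  have hAB : A.comp B = (ContinuousLinearEquiv.refl ℝ F : F →L[ℝ] F) := by
    ext v
    exact LinearMap.congr_fun hr v
  have hc : ContinuousAt (fun A' : E →L[ℝ] F => A'.comp B) A := by fun_prop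
  have hmem := hc.preimage_mem_nhds (t := Set.range ((↑) : (F ≃L[ℝ] F) → F →L[ℝ] F))
    (ContinuousLinearEquiv.isOpen.mem_nhds ⟨_, hAB.symm⟩)
  filter_upwards [hmem] with A' ⟨e, he⟩ y
  refine ⟨B (e.symm y), ?_⟩
  have := DFunLike.congr_fun he (e.symm y)
  simpa using this.symm

section

variable {E : Type*} [NormedAddCommGroup E] [NormedSpace ℝ E]
  {H : Type*} [TopologicalSpace H]
  (J : ModelWithCorners ℝ E H)
  {X : Type*} [TopologicalSpace X] [ChartedSpace H X]
  (n : ℕ) {N : Type*} [TopologicalSpace N] [ChartedSpace (EuclideanSpace ℝ (Fin n)) N]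

/-- The derivative of a map to `N` as a linear map of the model spaces. -/
def modelDeriv (G : X → N) (x : X) : E →L[ℝ] EuclideanSpace ℝ (Fin n) :=
  mfderiv J (𝓡 n) G x

/-- The difference of the derivatives of two maps to `N`. -/
def diffDeriv (G₁ G₂ : X → N) (x : X) : E →L[ℝ] EuclideanSpace ℝ (Fin n) :=
  modelDeriv J n G₂ x - modelDeriv J n G₁ x

/-- Two maps to `N` are transverse at `x`: if they coincide at `x`, then the difference of their
derivatives is surjective. -/
def TransverseAt (G₁ G₂ : X → N) (x : X) : Prop :=
  G₁ x = G₂ x → Function.Surjective (diffDeriv J n G₁ G₂ x)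

/-- The difference of two maps to `N` in a chart of `N`. -/
def chartDiff (y₀ : N) (G₁ G₂ : X → N) (x : X) : EuclideanSpace ℝ (Fin n) :=
  extChartAt (𝓡 n) y₀ (G₂ x) - extChartAt (𝓡 n) y₀ (G₁ x)

variable {J} {n}

theorem chartDiff_eq_zero_iff {y₀ : N} {G₁ G₂ : X → N} {x : X}
    (h₁ : G₁ x ∈ (chartAt (EuclideanSpace ℝ (Fin n)) y₀).source)
    (h₂ : G₂ x ∈ (chartAt (EuclideanSpace ℝ (Fin n)) y₀).source) :
    chartDiff n y₀ G₁ G₂ x = 0 ↔ G₁ x = G₂ x := by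
  rw [chartDiff, sub_eq_zero, eq_comm]
  refine (extChartAt (𝓡 n) y₀).injOn.eq_iff ?_ ?_ <;> rwa [extChartAt_source]

variable [IsManifold (𝓡 n) ∞ N]

/-- At a coincidence both terms involve the derivative of the chart at the same point of N, and it
factors out. -/
theorem hasMFDerivAt_chartDiff {y₀ : N} {G₁ G₂ : X → N} {x : X} (h : G₁ x = G₂ x)
    (h₁ : G₁ x ∈ (chartAt (EuclideanSpace ℝ (Fin n)) y₀).source)
    (hG₁ : MDifferentiableAt J (𝓡 n) G₁ x) (hG₂ : MDifferentiableAt J (𝓡 n) G₂ x) :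
    HasMFDerivAt J 𝓘(ℝ, EuclideanSpace ℝ (Fin n)) (chartDiff n y₀ G₁ G₂) x
      ((mfderiv (𝓡 n) 𝓘(ℝ, EuclideanSpace ℝ (Fin n)) (extChartAt (𝓡 n) y₀) (G₁ x) :
        EuclideanSpace ℝ (Fin n) →L[ℝ] EuclideanSpace ℝ (Fin n)).comp (diffDeriv J n G₁ G₂ x)) := by
  have h₂ : G₂ x ∈ (chartAt (EuclideanSpace ℝ (Fin n)) y₀).source := h ▸ h₁
  have hψ : ∀ {y}, y ∈ (chartAt (EuclideanSpace ℝ (Fin n)) y₀).source →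
      MDifferentiableAt (𝓡 n) 𝓘(ℝ, EuclideanSpace ℝ (Fin n)) (extChartAt (𝓡 n) y₀) y :=
    fun hy => mdifferentiableAt_extChartAt hy
  have e := ((hψ h₂).hasMFDerivAt.comp x hG₂.hasMFDerivAt).sub
    ((hψ h₁).hasMFDerivAt.comp x hG₁.hasMFDerivAt)
  let M : N → EuclideanSpace ℝ (Fin n) →L[ℝ] EuclideanSpace ℝ (Fin n) := fun y =>
    mfderiv (𝓡 n) 𝓘(ℝ, EuclideanSpace ℝ (Fin n)) (extChartAt (𝓡 n) y₀) y
  have key : (M (G₁ x)).comp (diffDeriv J n G₁ G₂ x) =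
      (M (G₂ x)).comp (modelDeriv J n G₂ x) - (M (G₁ x)).comp (modelDeriv J n G₁ x) := by
    rw [diffDeriv, ContinuousLinearMap.comp_sub, h]
  exact e.congr_mfderiv key.symm

/-- The derivative of the chart is invertible. Transversality thereby becomes a submersion property
of a function with values in ℝⁿ, where the inverse function theorem and affine perturbations are
available. -/
theorem surjective_mfderiv_chartDiff_iff {y₀ : N} {G₁ G₂ : X → N} {x : X} (h : G₁ x = G₂ x)
    (h₁ : G₁ x ∈ (chartAt (EuclideanSpace ℝ (Fin n)) y₀).source)
    (hG₁ : MDifferentiableAt J (𝓡 n) G₁ x) (hG₂ : MDifferentiableAt J (𝓡 n) G₂ x) :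
    Function.Surjective (mfderiv J 𝓘(ℝ, EuclideanSpace ℝ (Fin n)) (chartDiff n y₀ G₁ G₂) x) ↔
      Function.Surjective (diffDeriv J n G₁ G₂ x) := by
  rw [(hasMFDerivAt_chartDiff h h₁ hG₁ hG₂).mfderiv]
  have hinv : (mfderiv (𝓡 n) 𝓘(ℝ, EuclideanSpace ℝ (Fin n)) (extChartAt (𝓡 n) y₀)
      (G₁ x)).IsInvertible :=
    isInvertible_mfderiv_extChartAt (by rwa [extChartAt_source])
  constructor
  · intro hs y
    obtain ⟨v, hv⟩ := hs ((mfderiv (𝓡 n) 𝓘(ℝ, EuclideanSpace ℝ (Fin n)) (extChartAt (𝓡 n) y₀)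
      (G₁ x)) y)
    exact ⟨v, hinv.injective hv⟩
  · intro hs z
    obtain ⟨y, rfl⟩ := hinv.surjective z
    obtain ⟨v, rfl⟩ := hs y
    exact ⟨v, rfl⟩

theorem isOpen_chartDomain {T : Set X} (hT : IsOpen T) (y₀ : N) {G₁ G₂ : X → N}
    (h₁ : ContinuousOn G₁ T) (h₂ : ContinuousOn G₂ T) :
    IsOpen (T ∩ G₁ ⁻¹' (chartAt (EuclideanSpace ℝ (Fin n)) y₀).source ∩
      (T ∩ G₂ ⁻¹' (chartAt (EuclideanSpace ℝ (Fin n)) y₀).source)) :=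
  (h₁.isOpen_inter_preimage hT (chartAt _ y₀).open_source).inter
    (h₂.isOpen_inter_preimage hT (chartAt _ y₀).open_source)

theorem contMDiffOn_chartDiff {T : Set X} (y₀ : N) {G₁ G₂ : X → N}
    (h₁ : ContMDiffOn J (𝓡 n) ∞ G₁ T) (h₂ : ContMDiffOn J (𝓡 n) ∞ G₂ T) :
    ContMDiffOn J 𝓘(ℝ, EuclideanSpace ℝ (Fin n)) ∞ (chartDiff n y₀ G₁ G₂)
      (T ∩ G₁ ⁻¹' (chartAt (EuclideanSpace ℝ (Fin n)) y₀).source ∩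
      (T ∩ G₂ ⁻¹' (chartAt (EuclideanSpace ℝ (Fin n)) y₀).source)) := by
  have hψ : ContMDiffOn (𝓡 n) 𝓘(ℝ, EuclideanSpace ℝ (Fin n)) ∞ (extChartAt (𝓡 n) y₀)
      (chartAt (EuclideanSpace ℝ (Fin n)) y₀).source := contMDiffOn_extChartAt
  exact (hψ.comp (h₂.mono fun x hx => hx.2.1) fun x hx => hx.2.2).sub
    (hψ.comp (h₁.mono fun x hx => hx.1.1) fun x hx => hx.1.2)

variable [FiniteDimensional ℝ E] [J.Boundaryless] [IsManifold J ∞ X] [T2Space N]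

/-- Where the maps differ, they differ nearby since N is Hausdorff. At a coincidence, the partial
derivative in X of the difference in a chart of N is onto; it depends continuously on the parameter
and the point, and surjectivity is open. -/
theorem eventually_transverseAt {Θ : Type*} [NormedAddCommGroup Θ] [NormedSpace ℝ Θ]
    {G₁ G₂ : Θ × X → N} {θ₀ : Θ} {x₀ : X}
    (h₁ : ContMDiffAt (𝓘(ℝ, Θ).prod J) (𝓡 n) 1 G₁ (θ₀, x₀))
    (h₂ : ContMDiffAt (𝓘(ℝ, Θ).prod J) (𝓡 n) 1 G₂ (θ₀, x₀))
    (hR : TransverseAt J n (fun x => G₁ (θ₀, x)) (fun x => G₂ (θ₀, x)) x₀) :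
    ∀ᶠ p : Θ × X in 𝓝 (θ₀, x₀),
      TransverseAt J n (fun x => G₁ (p.1, x)) (fun x => G₂ (p.1, x)) p.2 := by
  by_cases hc : G₁ (θ₀, x₀) = G₂ (θ₀, x₀)
  swap
  · filter_upwards [(h₁.continuousAt.ne_iff_eventually_ne h₂.continuousAt).1 hc] with p hp h
    exact absurd h hp
  have hslice : ∀ {G : Θ × X → N} {p : Θ × X}, ContMDiffAt (𝓘(ℝ, Θ).prod J) (𝓡 n) 1 G p →
      MDifferentiableAt J (𝓡 n) (fun x => G (p.1, x)) p.2 := fun {G p} h =>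
    (ContMDiffAt.comp p.2 (g := G) (f := fun x => (p.1, x)) h
      (contMDiffAt_const.prodMk contMDiffAt_id)).mdifferentiableAt (by simp)
  let y₀ : N := G₁ (θ₀, x₀)
  let φ := openChart J x₀
  let f : Θ × E → EuclideanSpace ℝ (Fin n) := fun p => chartDiff n y₀ G₁ G₂ (p.1, φ.symm p.2)
  have hxs : x₀ ∈ φ.source := mem_chart_source H x₀
  have hy₁ : G₁ (θ₀, x₀) ∈ (chartAt (EuclideanSpace ℝ (Fin n)) y₀).source := mem_chart_source _ _
  have hy₂ : G₂ (θ₀, x₀) ∈ (chartAt (EuclideanSpace ℝ (Fin n)) y₀).source := hc ▸ hy₁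
  have hψ : ∀ {y}, y ∈ (chartAt (EuclideanSpace ℝ (Fin n)) y₀).source →
      ContMDiffAt (𝓡 n) 𝓘(ℝ, EuclideanSpace ℝ (Fin n)) 1 (extChartAt (𝓡 n) y₀) y :=
    fun hy => contMDiffAt_extChartAt' hy
  have hg : ContMDiffAt (𝓘(ℝ, Θ).prod J) 𝓘(ℝ, EuclideanSpace ℝ (Fin n)) 1
      (chartDiff n y₀ G₁ G₂) (θ₀, x₀) :=
    ((hψ hy₂).comp (θ₀, x₀) h₂).sub ((hψ hy₁).comp (θ₀, x₀) h₁)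
  have hsymm : ContMDiffAt 𝓘(ℝ, E) J 1 φ.symm (φ x₀) :=
    ((contMDiffOn_openChart_symm x₀).contMDiffAt
      (φ.open_target.mem_nhds (φ.map_source hxs))).of_le (by simp)
  have hf : ContDiffAt ℝ 1 f (θ₀, φ x₀) := by
    rw [← contMDiffAt_iff_contDiffAt]
    refine ContMDiffAt.comp (I' := 𝓘(ℝ, Θ).prod J) (θ₀, φ x₀) (g := chartDiff n y₀ G₁ G₂)
      (f := fun p : Θ × E => (p.1, φ.symm p.2)) ?_ ?_
    · simpa only [φ.left_inv hxs] using hg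
    · refine contDiffAt_fst.contMDiffAt.prodMk ?_
      exact ContMDiffAt.comp (I' := 𝓘(ℝ, E)) (θ₀, φ x₀) (g := φ.symm)
        (f := fun p : Θ × E => p.2) hsymm contDiffAt_snd.contMDiffAt
  let A : Θ × X → E →L[ℝ] EuclideanSpace ℝ (Fin n) := fun p =>
    (fderiv ℝ f (p.1, φ p.2)).comp (ContinuousLinearMap.inr ℝ Θ E)
  have hφc : ContinuousAt (fun p : Θ × X => (p.1, φ p.2)) (θ₀, x₀) :=
    continuousAt_fst.prodMk ((φ.continuousAt hxs).comp continuousAt_snd)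
  have hAc : ContinuousAt A (θ₀, x₀) := by
    have h3 : ContinuousAt (fderiv ℝ f) (θ₀, φ x₀) :=
      (hf.fderiv_right (m := 0) (by norm_num)).continuousAt
    exact (ContinuousAt.comp (f := fun p : Θ × X => (p.1, φ p.2)) h3 hφc).clm_comp
      continuousAt_const
  have hfd : ∀ᶠ p : Θ × X in 𝓝 (θ₀, x₀), DifferentiableAt ℝ f (p.1, φ p.2) :=
    hφc.eventually ((hf.eventually (by simp)).mono fun p hp => hp.differentiableAt (by simp))
  have hφs : ∀ᶠ p : Θ × X in 𝓝 (θ₀, x₀), p.2 ∈ φ.source :=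
    continuousAt_snd.eventually (φ.open_source.mem_nhds hxs)
  have hsurj : ∀ p : Θ × X, DifferentiableAt ℝ f (p.1, φ p.2) → p.2 ∈ φ.source →
      (Function.Surjective (mfderiv J 𝓘(ℝ, EuclideanSpace ℝ (Fin n))
        (chartDiff n y₀ (fun x => G₁ (p.1, x)) (fun x => G₂ (p.1, x))) p.2) ↔
        Function.Surjective (A p)) := by
    rintro ⟨θ, x⟩ hd hx
    have hφd : MDifferentiableAt J 𝓘(ℝ, E) (extChartAt J x₀) x := mdifferentiableAt_extChartAt hx
    have hi : (mfderiv J 𝓘(ℝ, E) (extChartAt J x₀) x).IsInvertible :=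
      isInvertible_mfderiv_extChartAt (by rwa [extChartAt_source])
    have h3 : HasFDerivAt (fun v : E => f (θ, v)) (A (θ, x)) (φ x) :=
      HasFDerivAt.comp (g := f) (f := fun v : E => (θ, v)) (φ x) hd.hasFDerivAt
        (hasFDerivAt_prodMk_right θ (φ x))
    have h4 := (HasMFDerivAt.comp (I' := 𝓘(ℝ, E)) x (g := fun v : E => f (θ, v))
      (f := extChartAt J x₀) h3.hasMFDerivAt hφd.hasMFDerivAt).congr_of_eventuallyEq
      (f₁ := chartDiff n y₀ (fun x => G₁ (θ, x)) (fun x => G₂ (θ, x))) (by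
        filter_upwards [φ.open_source.mem_nhds hx] with z hz
        change _ = chartDiff n y₀ G₁ G₂ (θ, φ.symm (φ z))
        rw [φ.left_inv hz]
        rfl)
    rw [h4.mfderiv]
    constructor
    · intro hs y
      obtain ⟨v, hv⟩ := hs y
      exact ⟨_, hv⟩
    · intro hs y
      obtain ⟨v, rfl⟩ := hs y
      obtain ⟨w, rfl⟩ := hi.surjective v
      exact ⟨w, rfl⟩
  have hA₀ : Function.Surjective (A (θ₀, x₀)) := by
    exact (hsurj (θ₀, x₀) hfd.self_of_nhds hxs).1 ((surjective_mfderiv_chartDiff_iff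
      (G₁ := fun x => G₁ (θ₀, x)) hc hy₁ (hslice h₁) (hslice h₂)).2 (hR hc))
  filter_upwards [hAc.eventually (eventually_surjective hA₀), hfd, hφs,
    (contMDiffAt_iff_contMDiffAt_nhds (by simp)).1 h₁,
    (contMDiffAt_iff_contMDiffAt_nhds (by simp)).1 h₂,
    h₁.continuousAt.eventually ((chartAt (EuclideanSpace ℝ (Fin n)) y₀).open_source.mem_nhds hy₁)]
    with p hp1 hp2 hp3 hp4 hp5 hp6 hp7
  exact (surjective_mfderiv_chartDiff_iff (G₁ := fun x => G₁ (p.1, x)) hp7 hp6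
    (hslice hp4) (hslice hp5)).1 ((hsurj p hp2 hp3).2 hp1)

end
end GeneralPosition
end

/-! ### Local perturbations by small affine maps, cut off in charts. -/

noncomputable section

namespace GeneralPosition

/-- The constant and the linear part of an affine map `E → ℝⁿ`. -/
abbrev AffinePair (E : Type*) [NormedAddCommGroup E] [NormedSpace ℝ E] (n : ℕ) :=
  EuclideanSpace ℝ (Fin n) × (E →L[ℝ] EuclideanSpace ℝ (Fin n))

section

variable {E : Type*} [NormedAddCommGroup E] [NormedSpace ℝ E] [FiniteDimensional ℝ E]
  {H : Type*} [TopologicalSpace H] {J : ModelWithCorners ℝ E H} [J.Boundaryless]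
  {Y : Type*} [TopologicalSpace Y] [ChartedSpace H Y] [IsManifold J ∞ Y]
  [T2Space Y] [SigmaCompactSpace Y]
  {n : ℕ} {N : Type*} [TopologicalSpace N] [ChartedSpace (EuclideanSpace ℝ (Fin n)) N]
  [IsManifold (𝓡 n) ∞ N]

/-- In charts, a map can be perturbed by all small affine maps, locally and relative to the
complement of a compact set. -/
theorem exists_affine_family {F : Y → N} {T O C : Set Y} (hT : IsOpen T)
    (hF : ContMDiffOn J (𝓡 n) ∞ F T) (hO : IsOpen O) (hOT : O ⊆ T) (hC : IsCompact C)
    (hCO : C ⊆ O) (c₀ : Y) (y₀ : N) (hCc : C ⊆ (chartAt H c₀).source)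
    (hCy : ∀ y ∈ C, F y ∈ (chartAt (EuclideanSpace ℝ (Fin n)) y₀).source) :
    ∃ (Φ : AffinePair E n × Y → N)
      (K U : Set Y) (r : ℝ), IsCompact K ∧ K ⊆ O ∧ IsOpen U ∧ C ⊆ U ∧ U ⊆ T ∧ 0 < r ∧
      (∀ y, Φ (0, y) = F y) ∧ (∀ θ, ∀ y ∉ K, Φ (θ, y) = F y) ∧
      (∀ θ ∈ Metric.ball 0 r, ∀ y ∈ T, ContMDiffAt
        (𝓘(ℝ, AffinePair E n).prod J) (𝓡 n) ∞
        Φ (θ, y)) ∧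
      ∀ θ ∈ Metric.ball 0 r, ∀ y ∈ U, y ∈ (chartAt H c₀).source ∧
        F y ∈ (chartAt (EuclideanSpace ℝ (Fin n)) y₀).source ∧
        Φ (θ, y) ∈ (chartAt (EuclideanSpace ℝ (Fin n)) y₀).source ∧
        extChartAt (𝓡 n) y₀ (Φ (θ, y)) =
          extChartAt (𝓡 n) y₀ (F y) + (θ.1 + θ.2 (extChartAt J c₀ y)) := by
  have : LocallyCompactSpace H := J.locallyCompactSpace
  have : LocallyCompactSpace Y := ChartedSpace.locallyCompactSpace H Y
  let ψ := openChart (𝓡 n) y₀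
  let V : Set Y := O ∩ (chartAt H c₀).source ∩ F ⁻¹' ψ.source
  have hV : IsOpen V :=
    (hF.continuousOn.mono (Set.inter_subset_left.trans hOT)).isOpen_inter_preimage
      (hO.inter (chartAt H c₀).open_source) ψ.open_source
  have hCV : C ⊆ V := fun y hy => ⟨⟨hCO hy, hCc hy⟩, hCy y hy⟩
  obtain ⟨K, hK, hCK, hKV⟩ := exists_compact_between hC hV hCV
  obtain ⟨β, hβ1, hβ0, -⟩ := exists_contMDiffMap_one_nhds_of_subset_interior (n := ⊤) J
    hC.isClosed hCK
  obtain ⟨U, hU, hCU, hUβ⟩ := mem_nhdsSet_iff_exists.1 hβ1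
  -- The bump function β is 1 near C and vanishes off K, so near C the full affine map is added in
  -- the chart of N.
  let δ : AffinePair E n × Y →
    EuclideanSpace ℝ (Fin n) := fun p =>
      ψ (F p.2) + β p.2 • (p.1.1 + p.1.2 (extChartAt J c₀ p.2))
  have hFψ : ContMDiffOn J 𝓘(ℝ, EuclideanSpace ℝ (Fin n)) ∞ (fun y => ψ (F y)) V :=
    (contMDiffOn_openChart y₀).comp
      (hF.mono fun y hy => hOT hy.1.1) fun y hy => hy.2
  have hδ : ∀ p : AffinePair E n × Y,
      p.2 ∈ V → ContMDiffAt
      (𝓘(ℝ, AffinePair E n).prod J)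
      𝓘(ℝ, EuclideanSpace ℝ (Fin n)) ∞ δ p := by
    rintro ⟨θ, y⟩ hy
    have h1 : ContMDiffAt J 𝓘(ℝ, EuclideanSpace ℝ (Fin n)) ∞ (fun y => ψ (F y)) y :=
      hFψ.contMDiffAt (hV.mem_nhds hy)
    have h2 : ContMDiffAt J 𝓘(ℝ, E) ∞ (extChartAt J c₀) y := contMDiffAt_extChartAt' hy.1.2
    have h3 : ContMDiffAt J 𝓘(ℝ) ∞ β y := β.contMDiff.contMDiffAt
    have h4 : ContMDiffAt (𝓘(ℝ, AffinePair E n).prod J) 𝓘(ℝ, AffinePair E n) ∞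
        (fun p : AffinePair E n × Y => p.1) (θ, y) := contMDiffAt_fst
    have h5 : ContMDiffAt (𝓘(ℝ, AffinePair E n).prod J) 𝓘(ℝ, EuclideanSpace ℝ (Fin n)) ∞
        (fun p : AffinePair E n × Y => p.1.1) (θ, y) :=
      contDiff_fst.contDiffAt.comp_contMDiffAt h4
    have h6 : ContMDiffAt (𝓘(ℝ, AffinePair E n).prod J)
        𝓘(ℝ, E →L[ℝ] EuclideanSpace ℝ (Fin n)) ∞
        (fun p : AffinePair E n × Y => p.1.2) (θ, y) :=
      contDiff_snd.contDiffAt.comp_contMDiffAt h4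
    have h7 : ContMDiffAt (𝓘(ℝ, AffinePair E n).prod J) 𝓘(ℝ, E) ∞
        (fun p : AffinePair E n × Y => extChartAt J c₀ p.2) (θ, y) :=
      h2.comp (θ, y) contMDiffAt_snd
    exact (h1.comp (θ, y) contMDiffAt_snd).add
      ((h3.comp (θ, y) contMDiffAt_snd).smul (h5.add (h6.clm_apply h7)))
  have htgt : IsOpen ψ.target := ψ.open_target
  -- The radius `r` keeps the perturbed values inside the chart of N; compactness of K makes it
  -- uniform.
  have hsmall : ∀ᶠ θ in 𝓝 (0 : AffinePair E n),
      ∀ y ∈ K, δ (θ, y) ∈ ψ.target := by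
    refine hK.eventually_forall_of_forall_eventually fun y hy => ?_
    have hy0 : δ (0, y) ∈ ψ.target := by
      simp only [δ]
      simpa using ψ.map_source (hKV hy).2
    exact (hδ (0, y) (hKV hy)).continuousAt.eventually (htgt.mem_nhds hy0)
  obtain ⟨r, hr, hrδ⟩ := Metric.eventually_nhds_iff_ball.1 hsmall
  classical
  -- The two formulas agree on V \ K, where β vanishes. Since K is a compact subset of V, the map is
  -- smooth across the frontier of V.
  let Φ : AffinePair E n × Y → N := fun p =>
    if p.2 ∈ V then ψ.symm (δ p) else F p.2
  have hβ0' : ∀ y ∉ K, β y = 0 := hβ0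
  have hΦK : ∀ θ, ∀ y ∉ K, Φ (θ, y) = F y := by
    intro θ y hy
    by_cases hyV : y ∈ V
    · simp only [Φ, if_pos hyV, δ, hβ0' y hy, zero_smul, add_zero]
      exact ψ.left_inv hyV.2
    · simp only [Φ, if_neg hyV]
  have hδt : ∀ θ ∈ Metric.ball 0 r, ∀ y ∈ V, δ (θ, y) ∈ ψ.target := by
    intro θ hθ y hy
    by_cases hyK : y ∈ K
    · exact hrδ θ hθ y hyK
    · simp only [δ, hβ0' y hyK, zero_smul, add_zero]
      exact ψ.map_source hy.2
  refine ⟨Φ, K, U ∩ V, r, hK, fun y hy => (hKV hy).1.1, hU.inter hV,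
    fun y hy => ⟨hCU hy, hCV hy⟩, fun y hy => hOT hy.2.1.1, hr, fun y => ?_, hΦK,
    fun θ hθ y hy => ?_, fun θ hθ y hy => ?_⟩
  · by_cases hyV : y ∈ V
    · simp only [Φ, if_pos hyV, δ]
      simpa using ψ.left_inv hyV.2
    · simp only [Φ, if_neg hyV]
  · by_cases hyV : y ∈ V
    · have hs : ContMDiffAt 𝓘(ℝ, EuclideanSpace ℝ (Fin n)) (𝓡 n) ∞ ψ.symm (δ (θ, y)) :=
        (contMDiffOn_openChart_symm y₀).contMDiffAt (htgt.mem_nhds (hδt θ hθ y hyV))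
      refine (hs.comp (θ, y) (hδ (θ, y) hyV)).congr_of_eventuallyEq ?_
      filter_upwards [continuousAt_snd.eventually (hV.mem_nhds hyV)] with p hp
      exact if_pos hp
    · have hyK : y ∈ Kᶜ := fun h => hyV (hKV h)
      refine ((hF.contMDiffAt (hT.mem_nhds hy)).comp (θ, y) contMDiffAt_snd).congr_of_eventuallyEq ?_
      filter_upwards [continuousAt_snd.eventually (hK.isClosed.isOpen_compl.mem_nhds hyK)] with p hp
      exact hΦK p.1 p.2 hp
  · have hΦy : Φ (θ, y) = ψ.symm (δ (θ, y)) := by simp only [Φ, if_pos hy.2]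
    have hβy : β y = 1 := hUβ hy.1
    refine ⟨hy.2.1.2, hy.2.2, ?_, ?_⟩
    · rw [hΦy]
      exact ψ.map_target (hδt θ hθ y hy.2)
    · change ψ (Φ (θ, y)) = ψ (F y) + _
      rw [hΦy, ψ.right_inv (hδt θ hθ y hy.2)]
      simp only [δ, hβy, one_smul]

end
end GeneralPosition
end

/-! ### Making two families of maps transverse over one pair of charts. -/

noncomputable section

namespace GeneralPosition

section

variable {E : Type*} [NormedAddCommGroup E] [NormedSpace ℝ E]
  {H : Type*} [TopologicalSpace H] (J : ModelWithCorners ℝ E H)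
  {Y : Type*} [TopologicalSpace Y] [ChartedSpace H Y]
  (n : ℕ) {N : Type*} [TopologicalSpace N] [ChartedSpace (EuclideanSpace ℝ (Fin n)) N]

/-- `F'` is the end of a deformation of `F` which is smooth over `T` and fixed outside a compact
subset of `O`. -/
def IsDeformation (T O : Set Y) (F F' : Y → N) : Prop :=
  ∃ h : Y × ℝ → N, (∀ y, h (y, 0) = F y ∧ h (y, 1) = F' y) ∧
    (∃ K, IsCompact K ∧ K ⊆ O ∧ ∀ y ∉ K, ∀ s, h (y, s) = F y) ∧
    ∀ y ∈ T, ∀ s ∈ Set.Icc (0 : ℝ) 1, ContMDiffAt (J.prod 𝓘(ℝ)) (𝓡 n) ∞ h (y, s)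

variable {J n}

theorem IsDeformation.contMDiffOn {T O : Set Y} {F F' : Y → N} (h : IsDeformation J n T O F F') :
    ContMDiffOn J (𝓡 n) ∞ F' T := by
  obtain ⟨h, h1, -, h3⟩ := h
  intro y hy
  have h4 : ContMDiffAt J (𝓡 n) ∞ (fun y => h (y, 1)) y :=
    ContMDiffAt.comp y (g := h) (f := fun y => (y, (1 : ℝ))) (h3 y hy 1 (by simp))
      (contMDiffAt_id.prodMk contMDiffAt_const)
  have h5 : (fun y => h (y, 1)) = F' := funext fun y => (h1 y).2
  rw [h5] at h4
  exact h4.contMDiffWithinAt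

/-- Moving along the segment from 0 to θ stays in the ball of admissible parameters. -/
theorem isDeformation_of_family {Θ : Type*} [NormedAddCommGroup Θ] [NormedSpace ℝ Θ]
    {Φ : Θ × Y → N} {F : Y → N} {T O K : Set Y} {r : ℝ} (hK : IsCompact K) (hKO : K ⊆ O)
    (h0 : ∀ y, Φ (0, y) = F y) (hfix : ∀ θ, ∀ y ∉ K, Φ (θ, y) = F y)
    (hs : ∀ θ ∈ Metric.ball 0 r, ∀ y ∈ T, ContMDiffAt (𝓘(ℝ, Θ).prod J) (𝓡 n) ∞ Φ (θ, y))
    {θ : Θ} (hθ : θ ∈ Metric.ball 0 r) :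
    IsDeformation J n T O F (fun y => Φ (θ, y)) := by
  refine ⟨fun p => Φ (p.2 • θ, p.1), fun y => ⟨by simp [h0], by simp⟩,
    ⟨K, hK, hKO, fun y hy s => hfix _ y hy⟩, fun y hy s hs' => ?_⟩
  have hmem : s • θ ∈ Metric.ball (0 : Θ) r := by
    rw [mem_ball_zero_iff] at hθ ⊢
    rw [norm_smul, Real.norm_of_nonneg hs'.1]
    exact lt_of_le_of_lt (mul_le_of_le_one_left (norm_nonneg _) hs'.2) hθ
  have h1 : ContMDiffAt (J.prod 𝓘(ℝ)) 𝓘(ℝ, Θ) ∞ (fun p : Y × ℝ => p.2 • θ) (y, s) :=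
    ContDiff.comp_contMDiffAt (g := fun s : ℝ => s • θ) (by fun_prop) contMDiffAt_snd
  exact ContMDiffAt.comp (y, s) (g := Φ) (f := fun p : Y × ℝ => (p.2 • θ, p.1))
    (hs _ hmem y hy) (h1.prodMk contMDiffAt_fst)

end

section

variable {E₁ : Type*} [NormedAddCommGroup E₁] [NormedSpace ℝ E₁] [FiniteDimensional ℝ E₁]
  {H₁ : Type*} [TopologicalSpace H₁] {I₁ : ModelWithCorners ℝ E₁ H₁} [I₁.Boundaryless]
  {E₂ : Type*} [NormedAddCommGroup E₂] [NormedSpace ℝ E₂] [FiniteDimensional ℝ E₂]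
  {H₂ : Type*} [TopologicalSpace H₂] {I₂ : ModelWithCorners ℝ E₂ H₂} [I₂.Boundaryless]
  {P₁ : Type*} [TopologicalSpace P₁] [ChartedSpace H₁ P₁] [IsManifold I₁ ∞ P₁]
  [T2Space P₁] [CompactSpace P₁]
  {P₂ : Type*} [TopologicalSpace P₂] [ChartedSpace H₂ P₂] [IsManifold I₂ ∞ P₂]
  [T2Space P₂] [CompactSpace P₂]
  {T : Type*} [NormedAddCommGroup T] [NormedSpace ℝ T] [FiniteDimensional ℝ T]
  {n : ℕ} {N : Type*} [TopologicalSpace N] [ChartedSpace (EuclideanSpace ℝ (Fin n)) N]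
  [IsManifold (𝓡 n) ∞ N] [T2Space N]

/-- A family of maps `P₁ → N` as a family of maps `P₁ × P₂ → N`. -/
def onFst (F : P₁ × T → N) (z : (P₁ × P₂) × T) : N := F (z.1.1, z.2)

/-- A family of maps `P₂ → N` as a family of maps `P₁ × P₂ → N`. -/
def onSnd (F : P₂ × T → N) (z : (P₁ × P₂) × T) : N := F (z.1.2, z.2)

variable (I₁ I₂ n) in
/-- Transversality of two families of maps at a point of `P₁ × P₂ × T`. -/
def FamilyTransverseAt (F₁ : P₁ × T → N) (F₂ : P₂ × T → N) (z : (P₁ × P₂) × T) : Prop :=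
  TransverseAt ((I₁.prod I₂).prod 𝓘(ℝ, T)) n (onFst F₁) (onSnd F₂) z

theorem contMDiff_fstParam : ContMDiff ((I₁.prod I₂).prod 𝓘(ℝ, T)) (I₁.prod 𝓘(ℝ, T)) ∞
    fun z : (P₁ × P₂) × T => (z.1.1, z.2) :=
  (contMDiff_fst.comp contMDiff_fst).prodMk contMDiff_snd

theorem contMDiff_sndParam : ContMDiff ((I₁.prod I₂).prod 𝓘(ℝ, T)) (I₂.prod 𝓘(ℝ, T)) ∞
    fun z : (P₁ × P₂) × T => (z.1.2, z.2) :=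
  (contMDiff_snd.comp contMDiff_fst).prodMk contMDiff_snd

variable (T) in
/-- The point `(a, t)` of `E₁ × T` as a point of `E₁ × E₂ × T`. -/
def inlParam : E₁ × T →L[ℝ] (E₁ × E₂) × T :=
  ((ContinuousLinearMap.inl ℝ E₁ E₂).comp (ContinuousLinearMap.fst ℝ E₁ T)).prod
    (ContinuousLinearMap.snd ℝ E₁ T)

variable (T) in
/-- The point `b` of `E₂` as a point of `E₁ × E₂ × T`. -/
def inrParam : E₂ × T →L[ℝ] (E₁ × E₂) × T :=
  (ContinuousLinearMap.inl ℝ (E₁ × E₂) T).comp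
    ((ContinuousLinearMap.inr ℝ E₁ E₂).comp (ContinuousLinearMap.fst ℝ E₂ T))

/-- The perturbation of the first map in a perturbation of the difference of two maps. -/
def fstPart (θ : AffinePair ((E₁ × E₂) × T) n) : AffinePair (E₁ × T) n :=
  (-θ.1, -θ.2.comp (inlParam T))

/-- The perturbation of the second map in a perturbation of the difference of two maps. -/
def sndPart (θ : AffinePair ((E₁ × E₂) × T) n) : AffinePair (E₂ × T) n :=
  (0, θ.2.comp (inrParam T))

theorem contDiff_fstPart : ContDiff ℝ ∞ (fstPart (E₁ := E₁) (E₂ := E₂) (T := T) (n := n)) := by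
  unfold fstPart
  exact contDiff_fst.neg.prodMk (contDiff_snd.clm_comp contDiff_const).neg

theorem contDiff_sndPart : ContDiff ℝ ∞ (sndPart (E₁ := E₁) (E₂ := E₂) (T := T) (n := n)) := by
  unfold sndPart
  exact contDiff_const.prodMk (contDiff_snd.clm_comp contDiff_const)

theorem fstPart_zero : fstPart (0 : AffinePair ((E₁ × E₂) × T) n) = 0 := by
  simp [fstPart]

theorem sndPart_zero : sndPart (0 : AffinePair ((E₁ × E₂) × T) n) = 0 := by
  simp [sndPart]

theorem extChartAt_param (c : P₁ × T) (y : P₁ × T) :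
    extChartAt (I₁.prod 𝓘(ℝ, T)) c y = (extChartAt I₁ c.1 y.1, y.2) :=
  rfl

/-- The first map does not see x₂ and the second one does not see x₁, yet together they realize
every affine perturbation of their difference. An affine map of (a, b, t) splits into an affine
function of (a, t), carried with the opposite sign by the first map, and a linear function of b,
carried by the second. -/
theorem perturbation_eq (θ : AffinePair ((E₁ × E₂) × T) n) (a : E₁) (b : E₂) (t : T) :
    ((sndPart θ).1 + (sndPart θ).2 (b, t)) - ((fstPart θ).1 + (fstPart θ).2 (a, t)) =
      θ.1 + θ.2 ((a, b), t) := by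
  have h : ((a, b), t) = (inlParam T (a, t) + inrParam T (b, t) : (E₁ × E₂) × T) := by
    simp [inlParam, inrParam]
  rw [h, map_add]
  simp [sndPart, fstPart]
  abel

variable (n) in
/-- A compact set is mapped to the domain of a chart of `N` by both families. -/
def MapsToChart (F₁ : P₁ × T → N) (F₂ : P₂ × T → N) (C : Set ((P₁ × P₂) × T)) (y₀ : N) : Prop :=
  ∀ z ∈ C, onFst F₁ z ∈ (chartAt (EuclideanSpace ℝ (Fin n)) y₀).source ∧
    onSnd F₂ z ∈ (chartAt (EuclideanSpace ℝ (Fin n)) y₀).source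

/-- The inductive step of general position. Over C the difference of the maps is a function with
values in ℝⁿ, which a generic affine perturbation makes transverse to 0. The perturbation can be so
small that transversality over A survives and the sets `D i`, which are treated later, are still
mapped to their charts. -/
theorem exists_deformation_of_mapsToChart {T₀ O : Set T} (hT₀ : IsOpen T₀) (hO : IsOpen O)
    (hOT : O ⊆ T₀) {F₁ : P₁ × T → N} {F₂ : P₂ × T → N}
    (hF₁ : ContMDiffOn (I₁.prod 𝓘(ℝ, T)) (𝓡 n) ∞ F₁ (Set.univ ×ˢ T₀))
    (hF₂ : ContMDiffOn (I₂.prod 𝓘(ℝ, T)) (𝓡 n) ∞ F₂ (Set.univ ×ˢ T₀))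
    {A : Set ((P₁ × P₂) × T)} (hA : IsCompact A) (hAT : A ⊆ Set.univ ×ˢ T₀)
    (hAR : ∀ z ∈ A, FamilyTransverseAt I₁ I₂ n F₁ F₂ z)
    {ι : Type*} (s : Finset ι) (D : ι → Set ((P₁ × P₂) × T)) (y : ι → N)
    (hD : ∀ i ∈ s, IsCompact (D i)) (hDT : ∀ i ∈ s, D i ⊆ Set.univ ×ˢ T₀)
    (hDy : ∀ i ∈ s, MapsToChart n F₁ F₂ (D i) (y i))
    {C : Set ((P₁ × P₂) × T)} (hC : IsCompact C) (hCO : C ⊆ Set.univ ×ˢ O) (a : P₁ × P₂)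
    (hCa : ∀ z ∈ C, z.1.1 ∈ (chartAt H₁ a.1).source ∧ z.1.2 ∈ (chartAt H₂ a.2).source) (y₀ : N)
    (hCy : MapsToChart n F₁ F₂ C y₀) :
    ∃ (F₁' : P₁ × T → N) (F₂' : P₂ × T → N),
      IsDeformation (I₁.prod 𝓘(ℝ, T)) n (Set.univ ×ˢ T₀) (Set.univ ×ˢ O) F₁ F₁' ∧
      IsDeformation (I₂.prod 𝓘(ℝ, T)) n (Set.univ ×ˢ T₀) (Set.univ ×ˢ O) F₂ F₂' ∧
      (∀ z ∈ A ∪ C, FamilyTransverseAt I₁ I₂ n F₁' F₂' z) ∧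
      ∀ i ∈ s, MapsToChart n F₁' F₂' (D i) (y i) := by
  have hp₁ : Continuous fun z : (P₁ × P₂) × T => (z.1.1, z.2) := by fun_prop
  have hp₂ : Continuous fun z : (P₁ × P₂) × T => (z.1.2, z.2) := by fun_prop
  have hopen₁ : IsOpen ((Set.univ : Set P₁) ×ˢ T₀) := isOpen_univ.prod hT₀
  have hopen₂ : IsOpen ((Set.univ : Set P₂) ×ˢ T₀) := isOpen_univ.prod hT₀
  obtain ⟨Φ₁, K₁, U₁, r₁, hK₁, hKO₁, hU₁, hCU₁, hUT₁, hr₁, h0₁, hfix₁, hs₁, hloc₁⟩ :=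
    exists_affine_family hopen₁ hF₁ (isOpen_univ.prod hO) (Set.prod_mono_right hOT)
      (hC.image hp₁) (by rintro _ ⟨z, hz, rfl⟩; exact ⟨trivial, (hCO hz).2⟩) (a.1, (0 : T)) y₀
      (by rintro _ ⟨z, hz, rfl⟩; exact ⟨(hCa z hz).1, trivial⟩)
      (by rintro _ ⟨z, hz, rfl⟩; exact (hCy z hz).1)
  obtain ⟨Φ₂, K₂, U₂, r₂, hK₂, hKO₂, hU₂, hCU₂, hUT₂, hr₂, h0₂, hfix₂, hs₂, hloc₂⟩ :=
    exists_affine_family hopen₂ hF₂ (isOpen_univ.prod hO) (Set.prod_mono_right hOT)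
      (hC.image hp₂) (by rintro _ ⟨z, hz, rfl⟩; exact ⟨trivial, (hCO hz).2⟩) (a.2, (0 : T)) y₀
      (by rintro _ ⟨z, hz, rfl⟩; exact ⟨(hCa z hz).2, trivial⟩)
      (by rintro _ ⟨z, hz, rfl⟩; exact (hCy z hz).2)
  let E := (E₁ × E₂) × T
  let G₁ : AffinePair E n × ((P₁ × P₂) × T) → N := fun p => Φ₁ (fstPart p.1, (p.2.1.1, p.2.2))
  let G₂ : AffinePair E n × ((P₁ × P₂) × T) → N := fun p => Φ₂ (sndPart p.1, (p.2.1.2, p.2.2))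
  have hb₁ : ∀ᶠ θ : AffinePair E n in 𝓝 0, fstPart θ ∈ Metric.ball 0 r₁ :=
    contDiff_fstPart.continuous.continuousAt.eventually
      (by rw [fstPart_zero]; exact Metric.ball_mem_nhds _ hr₁)
  have hb₂ : ∀ᶠ θ : AffinePair E n in 𝓝 0, sndPart θ ∈ Metric.ball 0 r₂ :=
    contDiff_sndPart.continuous.continuousAt.eventually
      (by rw [sndPart_zero]; exact Metric.ball_mem_nhds _ hr₂)
  have hG₁ : ∀ z : (P₁ × P₂) × T, z.2 ∈ T₀ → ∀ θ, fstPart θ ∈ Metric.ball 0 r₁ →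
      ContMDiffAt (𝓘(ℝ, AffinePair E n).prod ((I₁.prod I₂).prod 𝓘(ℝ, T))) (𝓡 n) ∞
        G₁ (θ, z) := by
    intro z hz θ hθ
    refine ContMDiffAt.comp (θ, z) (g := Φ₁)
      (f := fun p : AffinePair E n × ((P₁ × P₂) × T) => (fstPart p.1, (p.2.1.1, p.2.2)))
      (hs₁ _ hθ _ ⟨trivial, hz⟩) ?_
    exact (contDiff_fstPart.comp_contMDiffAt contMDiffAt_fst).prodMk
      (contMDiff_fstParam.contMDiffAt.comp (θ, z) contMDiffAt_snd)
  have hG₂ : ∀ z : (P₁ × P₂) × T, z.2 ∈ T₀ → ∀ θ, sndPart θ ∈ Metric.ball 0 r₂ →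
      ContMDiffAt (𝓘(ℝ, AffinePair E n).prod ((I₁.prod I₂).prod 𝓘(ℝ, T))) (𝓡 n) ∞
        G₂ (θ, z) := by
    intro z hz θ hθ
    refine ContMDiffAt.comp (θ, z) (g := Φ₂)
      (f := fun p : AffinePair E n × ((P₁ × P₂) × T) => (sndPart p.1, (p.2.1.2, p.2.2)))
      (hs₂ _ hθ _ ⟨trivial, hz⟩) ?_
    exact (contDiff_sndPart.comp_contMDiffAt contMDiffAt_fst).prodMk
      (contMDiff_sndParam.contMDiffAt.comp (θ, z) contMDiffAt_snd)
  have hG₁0 : ∀ z, G₁ (0, z) = onFst F₁ z := fun z => by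
    simp only [G₁, fstPart_zero, h0₁]; rfl
  have hG₂0 : ∀ z, G₂ (0, z) = onSnd F₂ z := fun z => by
    simp only [G₂, sndPart_zero, h0₂]; rfl
  have h0b₁ : fstPart (0 : AffinePair E n) ∈ Metric.ball 0 r₁ := by
    rw [fstPart_zero]; exact Metric.mem_ball_self hr₁
  have h0b₂ : sndPart (0 : AffinePair E n) ∈ Metric.ball 0 r₂ := by
    rw [sndPart_zero]; exact Metric.mem_ball_self hr₂
  -- Transversality at all points of the compact set A is an open condition on θ.
  have hopenA : ∀ᶠ θ : AffinePair E n in 𝓝 0, ∀ z ∈ A,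
      TransverseAt ((I₁.prod I₂).prod 𝓘(ℝ, T)) n (fun x => G₁ (θ, x)) (fun x => G₂ (θ, x)) z := by
    refine hA.eventually_forall_of_forall_eventually fun z hz => ?_
    refine eventually_transverseAt ((hG₁ z (hAT hz).2 0 h0b₁).of_le (by simp))
      ((hG₂ z (hAT hz).2 0 h0b₂).of_le (by simp)) ?_
    simp only [hG₁0, hG₂0]
    exact hAR z hz
  have hopenD : ∀ᶠ θ : AffinePair E n in 𝓝 0, ∀ i ∈ s, ∀ z ∈ D i,
      G₁ (θ, z) ∈ (chartAt (EuclideanSpace ℝ (Fin n)) (y i)).source ∧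
      G₂ (θ, z) ∈ (chartAt (EuclideanSpace ℝ (Fin n)) (y i)).source := by
    rw [Filter.eventually_all_finset]
    intro i hi
    refine (hD i hi).eventually_forall_of_forall_eventually fun z hz => ?_
    refine Filter.Eventually.and ?_ ?_
    · refine (hG₁ z (hDT i hi hz).2 0 h0b₁).continuousAt.eventually
        ((chartAt _ (y i)).open_source.mem_nhds ?_)
      rw [hG₁0]
      exact (hDy i hi z hz).1
    · refine (hG₂ z (hDT i hi hz).2 0 h0b₂).continuousAt.eventually
        ((chartAt _ (y i)).open_source.mem_nhds ?_)
      rw [hG₂0]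
      exact (hDy i hi z hz).2
  let φ := openChart ((I₁.prod I₂).prod 𝓘(ℝ, T)) (a, (0 : T))
  let U : Set ((P₁ × P₂) × T) := {z | (z.1.1, z.2) ∈ U₁ ∧ (z.1.2, z.2) ∈ U₂}
  have hU : IsOpen U := (hU₁.preimage hp₁).inter (hU₂.preimage hp₂)
  let g : E → EuclideanSpace ℝ (Fin n) := fun v => chartDiff n y₀ (onFst F₁) (onSnd F₂) (φ.symm v)
  have hφO : IsOpen (φ.target ∩ φ.symm ⁻¹' U) := φ.isOpen_inter_preimage_symm hU
  have hg : ContDiffOn ℝ ∞ g (φ.target ∩ φ.symm ⁻¹' U) := by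
    rw [← contMDiffOn_iff_contDiffOn]
    have h1 : ContMDiffOn ((I₁.prod I₂).prod 𝓘(ℝ, T)) (𝓡 n) ∞ (onFst F₁)
        (Set.univ ×ˢ T₀ : Set ((P₁ × P₂) × T)) :=
      hF₁.comp contMDiff_fstParam.contMDiffOn fun z hz => ⟨trivial, hz.2⟩
    have h2 : ContMDiffOn ((I₁.prod I₂).prod 𝓘(ℝ, T)) (𝓡 n) ∞ (onSnd F₂)
        (Set.univ ×ˢ T₀ : Set ((P₁ × P₂) × T)) :=
      hF₂.comp contMDiff_sndParam.contMDiffOn fun z hz => ⟨trivial, hz.2⟩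
    refine (contMDiffOn_chartDiff y₀ h1 h2).comp
      ((contMDiffOn_openChart_symm _).mono Set.inter_subset_left) fun v hv => ?_
    have hv1 := hloc₁ 0 (Metric.mem_ball_self hr₁) _ hv.2.1
    have hv2 := hloc₂ 0 (Metric.mem_ball_self hr₂) _ hv.2.2
    exact ⟨⟨⟨trivial, (hUT₁ hv.2.1).2⟩, hv1.2.1⟩, ⟨⟨trivial, (hUT₂ hv.2.2).2⟩, hv2.2.1⟩⟩
  obtain ⟨θ, ⟨⟨hθ₁, hθ₂⟩, hθA, hθD⟩, hθ⟩ := exists_affine_perturbation hφO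
    (contDiffOn_infty.1 hg 2)
    (O := {θ | (fstPart θ ∈ Metric.ball 0 r₁ ∧ sndPart θ ∈ Metric.ball 0 r₂) ∧ _ ∧ _})
    ((hb₁.and hb₂).and (hopenA.and hopenD))
  refine ⟨fun q => Φ₁ (fstPart θ, q), fun q => Φ₂ (sndPart θ, q),
    isDeformation_of_family hK₁ hKO₁ h0₁ hfix₁ hs₁ hθ₁,
    isDeformation_of_family hK₂ hKO₂ h0₂ hfix₂ hs₂ hθ₂, ?_, hθD⟩
  rintro z (hz | hz)
  · exact hθA z hz
  intro hcoin
  have hzU : z ∈ U := ⟨hCU₁ ⟨z, hz, rfl⟩, hCU₂ ⟨z, hz, rfl⟩⟩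
  have hUφ : ∀ w ∈ U, w ∈ φ.source := fun w hw =>
    ⟨⟨(hloc₁ 0 (Metric.mem_ball_self hr₁) _ hw.1).1.1,
      (hloc₂ 0 (Metric.mem_ball_self hr₂) _ hw.2).1.1⟩, trivial⟩
  -- Over U both cutoff functions are 1, so the perturbed difference is exactly g plus the affine
  -- map θ.
  have hformula : ∀ w ∈ U, chartDiff n y₀ (fun x => G₁ (θ, x)) (fun x => G₂ (θ, x)) w =
      g (φ w) + (θ.1 + θ.2 (φ w)) := by
    intro w hw
    have hw1 := (hloc₁ _ hθ₁ _ hw.1).2.2.2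
    have hw2 := (hloc₂ _ hθ₂ _ hw.2).2.2.2
    have h3 := perturbation_eq θ (extChartAt I₁ a.1 w.1.1) (extChartAt I₂ a.2 w.1.2) w.2
    have h4 : φ w = ((extChartAt I₁ a.1 w.1.1, extChartAt I₂ a.2 w.1.2), w.2) := rfl
    simp only [g, φ.left_inv (hUφ w hw)]
    rw [h4, ← h3]
    simp only [chartDiff, G₁, G₂, hw1, hw2, extChartAt_param, onFst, onSnd]
    abel
  have hw1 := (hloc₁ _ hθ₁ _ hzU.1).2.2.1
  have hw2 := (hloc₂ _ hθ₂ _ hzU.2).2.2.1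
  have hv : φ z ∈ φ.target ∩ φ.symm ⁻¹' U := by
    refine ⟨φ.map_source (hUφ z hzU), ?_⟩
    change φ.symm (φ z) ∈ U
    rwa [φ.left_inv (hUφ z hzU)]
  have hsurj := hθ (φ z) hv (by
    rw [← hformula z hzU]
    exact (chartDiff_eq_zero_iff (G₁ := fun x => G₁ (θ, x)) hw1 hw2).2 hcoin)
  have hgd : DifferentiableAt ℝ g (φ z) :=
    (hg.contDiffAt (hφO.mem_nhds hv)).differentiableAt (by simp)
  have hφd : MDifferentiableAt ((I₁.prod I₂).prod 𝓘(ℝ, T)) 𝓘(ℝ, E)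
      (extChartAt ((I₁.prod I₂).prod 𝓘(ℝ, T)) (a, (0 : T))) z :=
    mdifferentiableAt_extChartAt (hUφ z hzU)
  have hφi : (mfderiv ((I₁.prod I₂).prod 𝓘(ℝ, T)) 𝓘(ℝ, E)
      (extChartAt ((I₁.prod I₂).prod 𝓘(ℝ, T)) (a, (0 : T))) z).IsInvertible :=
    isInvertible_mfderiv_extChartAt (by rw [extChartAt_source]; exact hUφ z hzU)
  have h3 : HasFDerivAt (fun v => g v + (θ.1 + θ.2 v)) (fderiv ℝ g (φ z) + θ.2) (φ z) :=
    hgd.hasFDerivAt.add (θ.2.hasFDerivAt.const_add θ.1)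
  have h4 := (HasMFDerivAt.comp (I' := 𝓘(ℝ, E)) z (g := fun v => g v + (θ.1 + θ.2 v))
    (f := extChartAt ((I₁.prod I₂).prod 𝓘(ℝ, T)) (a, (0 : T))) h3.hasMFDerivAt
    hφd.hasMFDerivAt).congr_of_eventuallyEq
    (f₁ := chartDiff n y₀ (fun x => G₁ (θ, x)) (fun x => G₂ (θ, x))) (by
      filter_upwards [hU.mem_nhds hzU] with w hw
      exact hformula w hw)
  have hslice₁ : MDifferentiableAt ((I₁.prod I₂).prod 𝓘(ℝ, T)) (𝓡 n) (fun x => G₁ (θ, x)) z :=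
    (ContMDiffAt.comp z (g := G₁) (f := fun x => (θ, x)) (hG₁ z (hOT (hCO hz).2) θ hθ₁)
      (contMDiffAt_const.prodMk contMDiffAt_id)).mdifferentiableAt (by simp)
  have hslice₂ : MDifferentiableAt ((I₁.prod I₂).prod 𝓘(ℝ, T)) (𝓡 n) (fun x => G₂ (θ, x)) z :=
    (ContMDiffAt.comp z (g := G₂) (f := fun x => (θ, x)) (hG₂ z (hOT (hCO hz).2) θ hθ₂)
      (contMDiffAt_const.prodMk contMDiffAt_id)).mdifferentiableAt (by simp)
  refine (surjective_mfderiv_chartDiff_iff (G₁ := fun x => G₁ (θ, x))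
    (G₂ := fun x => G₂ (θ, x)) hcoin hw1 hslice₁ hslice₂).1 ?_
  rw [h4.mfderiv]
  intro y
  obtain ⟨v, rfl⟩ := hsurj y
  obtain ⟨w, rfl⟩ := hφi.surjective v
  exact ⟨w, rfl⟩

end
end GeneralPosition
end

/-! ### General position over a compact set, by a finite chain of deformations. -/

noncomputable section

namespace GeneralPosition

section

variable {E₁ : Type*} [NormedAddCommGroup E₁] [NormedSpace ℝ E₁] [FiniteDimensional ℝ E₁]
  {H₁ : Type*} [TopologicalSpace H₁] {I₁ : ModelWithCorners ℝ E₁ H₁} [I₁.Boundaryless]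
  {E₂ : Type*} [NormedAddCommGroup E₂] [NormedSpace ℝ E₂] [FiniteDimensional ℝ E₂]
  {H₂ : Type*} [TopologicalSpace H₂] {I₂ : ModelWithCorners ℝ E₂ H₂} [I₂.Boundaryless]
  {P₁ : Type*} [TopologicalSpace P₁] [ChartedSpace H₁ P₁] [IsManifold I₁ ∞ P₁]
  [T2Space P₁] [CompactSpace P₁]
  {P₂ : Type*} [TopologicalSpace P₂] [ChartedSpace H₂ P₂] [IsManifold I₂ ∞ P₂]
  [T2Space P₂] [CompactSpace P₂]
  {T : Type*} [NormedAddCommGroup T] [NormedSpace ℝ T] [FiniteDimensional ℝ T]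
  {n : ℕ} {N : Type*} [TopologicalSpace N] [ChartedSpace (EuclideanSpace ℝ (Fin n)) N]
  [IsManifold (𝓡 n) ∞ N] [T2Space N]

variable (I₁ I₂ n) in
/-- Both families of maps are deformed over `T₀`, relative to the complement of a compact subset
of `O`. -/
def DeformsTo (T₀ O : Set T) (F F' : (P₁ × T → N) × (P₂ × T → N)) : Prop :=
  IsDeformation (I₁.prod 𝓘(ℝ, T)) n (Set.univ ×ˢ T₀) (Set.univ ×ˢ O) F.1 F'.1 ∧
    IsDeformation (I₂.prod 𝓘(ℝ, T)) n (Set.univ ×ˢ T₀) (Set.univ ×ˢ O) F.2 F'.2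

/-- Induction over a finite cover: a set on which transversality has been achieved joins A, and is
preserved by all later steps. -/
theorem exists_deformation_of_finset {T₀ O : Set T} (hT₀ : IsOpen T₀) (hO : IsOpen O)
    (hOT : O ⊆ T₀) {ι : Type*} (s : Finset ι) (D : ι → Set ((P₁ × P₂) × T)) (y : ι → N)
    (a : ι → P₁ × P₂) (hD : ∀ i ∈ s, IsCompact (D i)) (hDO : ∀ i ∈ s, D i ⊆ Set.univ ×ˢ O)
    (hDa : ∀ i ∈ s, ∀ z ∈ D i,
      z.1.1 ∈ (chartAt H₁ (a i).1).source ∧ z.1.2 ∈ (chartAt H₂ (a i).2).source)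
    {F : (P₁ × T → N) × (P₂ × T → N)}
    (hF₁ : ContMDiffOn (I₁.prod 𝓘(ℝ, T)) (𝓡 n) ∞ F.1 (Set.univ ×ˢ T₀))
    (hF₂ : ContMDiffOn (I₂.prod 𝓘(ℝ, T)) (𝓡 n) ∞ F.2 (Set.univ ×ˢ T₀))
    {A : Set ((P₁ × P₂) × T)} (hA : IsCompact A) (hAT : A ⊆ Set.univ ×ˢ T₀)
    (hAR : ∀ z ∈ A, FamilyTransverseAt I₁ I₂ n F.1 F.2 z)
    (hDy : ∀ i ∈ s, MapsToChart n F.1 F.2 (D i) (y i)) :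
    ∃ F' : (P₁ × T → N) × (P₂ × T → N),
      Relation.ReflTransGen (DeformsTo I₁ I₂ n T₀ O) F F' ∧
      ContMDiffOn (I₁.prod 𝓘(ℝ, T)) (𝓡 n) ∞ F'.1 (Set.univ ×ˢ T₀) ∧
      ContMDiffOn (I₂.prod 𝓘(ℝ, T)) (𝓡 n) ∞ F'.2 (Set.univ ×ˢ T₀) ∧
      ∀ z ∈ A ∪ ⋃ i ∈ s, D i, FamilyTransverseAt I₁ I₂ n F'.1 F'.2 z := by
  classical
  induction s using Finset.induction_on generalizing F A with
  | empty => exact ⟨F, .refl, hF₁, hF₂, by simpa using hAR⟩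
  | insert i s hi ih =>
    obtain ⟨F₁', F₂', h1, h2, h3, h4⟩ := exists_deformation_of_mapsToChart hT₀ hO hOT hF₁ hF₂ hA hAT
      hAR s D y (fun j hj => hD j (Finset.mem_insert_of_mem hj))
      (fun j hj => (hDO j (Finset.mem_insert_of_mem hj)).trans (Set.prod_mono_right hOT))
      (fun j hj => hDy j (Finset.mem_insert_of_mem hj)) (hD i (Finset.mem_insert_self i s))
      (hDO i (Finset.mem_insert_self i s)) (a i) (hDa i (Finset.mem_insert_self i s)) (y i)
      (hDy i (Finset.mem_insert_self i s))
    obtain ⟨F', h5, h6, h7, h8⟩ := ih (fun j hj => hD j (Finset.mem_insert_of_mem hj))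
      (fun j hj => hDO j (Finset.mem_insert_of_mem hj))
      (fun j hj => hDa j (Finset.mem_insert_of_mem hj)) (F := (F₁', F₂')) h1.contMDiffOn
      h2.contMDiffOn (hA.union (hD i (Finset.mem_insert_self i s)))
      (Set.union_subset hAT
        ((hDO i (Finset.mem_insert_self i s)).trans (Set.prod_mono_right hOT))) h3 h4
    refine ⟨F', .head ⟨h1, h2⟩ h5, h6, h7, fun z hz => h8 z ?_⟩
    rwa [Finset.set_biUnion_insert, ← Set.union_assoc] at hz

/-- Two families of maps can be made transverse over a compact set by a finite chain of
deformations, keeping them transverse where they already are. -/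
theorem exists_transverse_deformation {T₀ O : Set T} (hT₀ : IsOpen T₀) (hO : IsOpen O)
    (hOT : O ⊆ T₀) {F : (P₁ × T → N) × (P₂ × T → N)}
    (hF₁ : ContMDiffOn (I₁.prod 𝓘(ℝ, T)) (𝓡 n) ∞ F.1 (Set.univ ×ˢ T₀))
    (hF₂ : ContMDiffOn (I₂.prod 𝓘(ℝ, T)) (𝓡 n) ∞ F.2 (Set.univ ×ˢ T₀))
    {A : Set ((P₁ × P₂) × T)} (hA : IsCompact A) (hAT : A ⊆ Set.univ ×ˢ T₀)
    (hAR : ∀ z ∈ A, FamilyTransverseAt I₁ I₂ n F.1 F.2 z)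
    {C : Set ((P₁ × P₂) × T)} (hC : IsCompact C) (hCO : C ⊆ Set.univ ×ˢ O) :
    ∃ F' : (P₁ × T → N) × (P₂ × T → N),
      Relation.ReflTransGen (DeformsTo I₁ I₂ n T₀ O) F F' ∧
      ContMDiffOn (I₁.prod 𝓘(ℝ, T)) (𝓡 n) ∞ F'.1 (Set.univ ×ˢ T₀) ∧
      ContMDiffOn (I₂.prod 𝓘(ℝ, T)) (𝓡 n) ∞ F'.2 (Set.univ ×ˢ T₀) ∧
      ∀ z ∈ A ∪ C, FamilyTransverseAt I₁ I₂ n F'.1 F'.2 z := by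
  classical
  have : LocallyCompactSpace H₁ := I₁.locallyCompactSpace
  have : LocallyCompactSpace H₂ := I₂.locallyCompactSpace
  have : LocallyCompactSpace P₁ := ChartedSpace.locallyCompactSpace H₁ P₁
  have : LocallyCompactSpace P₂ := ChartedSpace.locallyCompactSpace H₂ P₂
  have : ProperSpace T := FiniteDimensional.proper_real T
  have hc₁ : ∀ z : (P₁ × P₂) × T, z.2 ∈ O → ContinuousAt (onFst F.1) z := fun z hz =>
    ContinuousAt.comp (f := fun z : (P₁ × P₂) × T => (z.1.1, z.2)) (g := F.1)
      (hF₁.continuousOn.continuousAt ((isOpen_univ.prod hT₀).mem_nhds ⟨trivial, hOT hz⟩))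
      (by fun_prop)
  have hc₂ : ∀ z : (P₁ × P₂) × T, z.2 ∈ O → ContinuousAt (onSnd F.2) z := fun z hz =>
    ContinuousAt.comp (f := fun z : (P₁ × P₂) × T => (z.1.2, z.2)) (g := F.2)
      (hF₂.continuousOn.continuousAt ((isOpen_univ.prod hT₀).mem_nhds ⟨trivial, hOT hz⟩))
      (by fun_prop)
  -- Points of C have two kinds of compact neighbourhoods. Either the maps nowhere coincide there,
  -- and transversality is vacuous, or both maps send the neighbourhood to a common chart of N.
  have hloc : ∀ z : (P₁ × P₂) × T, ∃ D ∈ 𝓝 z, z ∈ C → IsCompact D ∧ D ⊆ Set.univ ×ˢ O ∧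
      ((∀ w ∈ D, onFst F.1 w ≠ onSnd F.2 w) ∨
        ((∀ w ∈ D, w.1.1 ∈ (chartAt H₁ z.1.1).source ∧ w.1.2 ∈ (chartAt H₂ z.1.2).source) ∧
          MapsToChart n F.1 F.2 D (onFst F.1 z))) := by
    intro z
    by_cases hz : z ∈ C
    swap
    · exact ⟨Set.univ, Filter.univ_mem, fun h => absurd h hz⟩
    have hzO : Set.univ ×ˢ O ∈ 𝓝 z := (isOpen_univ.prod hO).mem_nhds (hCO hz)
    by_cases hcoin : onFst F.1 z = onSnd F.2 z
    · have hsrc : (chartAt (EuclideanSpace ℝ (Fin n)) (onFst F.1 z)).source ∈ 𝓝 (onSnd F.2 z) := by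
        rw [← hcoin]
        exact chart_source_mem_nhds _ _
      have h1 := (hc₁ z (hCO hz).2).preimage_mem_nhds
        (chart_source_mem_nhds (EuclideanSpace ℝ (Fin n)) (onFst F.1 z))
      have h2 := (hc₂ z (hCO hz).2).preimage_mem_nhds
        hsrc
      have h3 : {w : (P₁ × P₂) × T | w.1.1 ∈ (chartAt H₁ z.1.1).source} ∈ 𝓝 z :=
        (show ContinuousAt (fun w : (P₁ × P₂) × T => w.1.1) z by fun_prop).preimage_mem_nhds
          (chart_source_mem_nhds H₁ _)
      have h4 : {w : (P₁ × P₂) × T | w.1.2 ∈ (chartAt H₂ z.1.2).source} ∈ 𝓝 z :=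
        (show ContinuousAt (fun w : (P₁ × P₂) × T => w.1.2) z by fun_prop).preimage_mem_nhds
          (chart_source_mem_nhds H₂ _)
      obtain ⟨D, hD, hDs, hDc⟩ := local_compact_nhds
        (Filter.inter_mem hzO (Filter.inter_mem (Filter.inter_mem h1 h2) (Filter.inter_mem h3 h4)))
      exact ⟨D, hD, fun _ => ⟨hDc, fun w hw => (hDs hw).1, .inr
        ⟨fun w hw => (hDs hw).2.2, fun w hw => (hDs hw).2.1⟩⟩⟩
    · obtain ⟨D, hD, hDs, hDc⟩ := local_compact_nhds (Filter.inter_mem hzO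
        (((hc₁ z (hCO hz).2).ne_iff_eventually_ne (hc₂ z (hCO hz).2)).1 hcoin))
      exact ⟨D, hD, fun _ => ⟨hDc, fun w hw => (hDs hw).1, .inl fun w hw => (hDs hw).2⟩⟩
  choose D hD hDC using hloc
  obtain ⟨t, htC, htD⟩ := hC.elim_nhds_subcover D fun z _ => hD z
  -- Neighbourhoods of the first kind are added to A at once, so that later perturbations do not
  -- spoil them; only the second kind enters the induction.
  let Q : (P₁ × P₂) × T → Prop := fun z => ∀ w ∈ D z, onFst F.1 w ≠ onSnd F.2 w
  let A' := A ∪ ⋃ z ∈ t.filter Q, D z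
  obtain ⟨F', h1, h2, h3, h4⟩ := exists_deformation_of_finset (I₁ := I₁) (I₂ := I₂) hT₀ hO hOT
    (t.filter fun z => ¬ Q z) D (fun z => onFst F.1 z) (fun z => z.1)
    (fun z hz => (hDC z (htC z (Finset.mem_filter.1 hz).1)).1)
    (fun z hz => (hDC z (htC z (Finset.mem_filter.1 hz).1)).2.1)
    (fun z hz => ((hDC z (htC z (Finset.mem_filter.1 hz).1)).2.2.resolve_left
      (Finset.mem_filter.1 hz).2).1)
    hF₁ hF₂ (A := A')
    (hA.union ((t.filter Q).isCompact_biUnion fun z hz =>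
      (hDC z (htC z (Finset.mem_filter.1 hz).1)).1))
    (Set.union_subset hAT (Set.iUnion₂_subset fun z hz =>
      (hDC z (htC z (Finset.mem_filter.1 hz).1)).2.1.trans (Set.prod_mono_right hOT)))
    (by
      rintro z (hz | hz)
      · exact hAR z hz
      · obtain ⟨w, hw, hz⟩ := Set.mem_iUnion₂.1 hz
        exact fun h => absurd h ((Finset.mem_filter.1 hw).2 z hz))
    (fun z hz => ((hDC z (htC z (Finset.mem_filter.1 hz).1)).2.2.resolve_left
      (Finset.mem_filter.1 hz).2).2)
  refine ⟨F', h1, h2, h3, fun z hz => h4 z ?_⟩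
  rcases hz with hz | hz
  · exact .inl (.inl hz)
  · obtain ⟨w, hw, hzw⟩ := Set.mem_iUnion₂.1 (htD hz)
    by_cases hq : Q w
    · exact .inl (.inr (Set.mem_iUnion₂.2 ⟨w, Finset.mem_filter.2 ⟨hw, hq⟩, hzw⟩))
    · exact .inr (Set.mem_iUnion₂.2 ⟨w, Finset.mem_filter.2 ⟨hw, hq⟩, hzw⟩)

end
end GeneralPosition
end

noncomputable section

namespace LinkMaps
open GeneralPosition

/-! ### Reparametrization and concatenation of homotopies -/

/-- A smooth function from the line to the interval as a map to `I`. -/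
def toInterval (ρ : ℝ → ℝ) (hρ : ∀ s, ρ s ∈ Set.Icc (0 : ℝ) 1) (s : ℝ) : I := ⟨ρ s, hρ s⟩

theorem contMDiff_toInterval {ρ : ℝ → ℝ} (hρ : ∀ s, ρ s ∈ Set.Icc (0 : ℝ) 1)
    (h : ContDiff ℝ ∞ ρ) : ContMDiff 𝓘(ℝ) (𝓡∂ 1) ∞ (toInterval ρ hρ) :=
  contMDiff_iff_comp_subtypeVal_Icc.2
    ⟨Continuous.subtype_mk h.continuous hρ, contMDiff_iff_contDiff.2 h⟩

theorem contMDiff_coe_interval : ContMDiff (𝓡∂ 1) 𝓘(ℝ) ∞ (fun s : I => (s : ℝ)) :=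
  contMDiff_subtypeVal_Icc

/-- The smooth step which goes from `0` at `c / 3` to `1` at `(c + 1) / 3`. -/
def step (c : ℝ) : ℝ → I :=
  toInterval (fun s => Real.smoothTransition (3 * s - c))
    fun _ => ⟨Real.smoothTransition.nonneg _, Real.smoothTransition.le_one _⟩

theorem contMDiff_step (c : ℝ) : ContMDiff 𝓘(ℝ) (𝓡∂ 1) ∞ (step c) :=
  contMDiff_toInterval _ (Real.smoothTransition.contDiff.comp (by fun_prop))

theorem step_eq_zero {c s : ℝ} (h : 3 * s ≤ c) : step c s = 0 :=
  Subtype.ext (Real.smoothTransition.zero_of_nonpos (by linarith))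

theorem step_eq_one {c s : ℝ} (h : c + 1 ≤ 3 * s) : step c s = 1 :=
  Subtype.ext (Real.smoothTransition.one_of_one_le (by linarith))

theorem contMDiff_interval_symm : ContMDiff (𝓡∂ 1) (𝓡∂ 1) ∞ (unitInterval.symm : I → I) :=
  contMDiff_iff_comp_subtypeVal_Icc.2 ⟨unitInterval.continuous_symm, by
    have h : ContDiff ℝ ∞ fun s : ℝ => 1 - s := by fun_prop
    exact h.contMDiff.comp contMDiff_coe_interval⟩

section

variable {E : Type*} [NormedAddCommGroup E] [NormedSpace ℝ E]
  {H : Type*} [TopologicalSpace H] {J : ModelWithCorners ℝ E H}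
  {Y : Type*} [TopologicalSpace Y] [ChartedSpace H Y]
  {n : ℕ} {N : Type*} [TopologicalSpace N] [ChartedSpace (EuclideanSpace ℝ (Fin n)) N]

theorem contMDiff_reverse : ContMDiff (J.prod (𝓡∂ 1)) (J.prod (𝓡∂ 1)) ∞
    fun z : Y × I => (z.1, unitInterval.symm z.2) :=
  contMDiff_fst.prodMk (contMDiff_interval_symm.comp contMDiff_snd)

/-- The concatenation of two homotopies, smoothed by reparametrization. -/
def concat (K K' : Y × I → N) (z : Y × I) : N :=
  if (z.2 : ℝ) ≤ 1 / 2 then K (z.1, step 0 z.2) else K' (z.1, step 2 z.2)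

theorem concat_zero (K K' : Y × I → N) (y : Y) : concat K K' (y, 0) = K (y, 0) := by
  simp [concat, step_eq_zero]

theorem concat_one (K K' : Y × I → N) (y : Y) : concat K K' (y, 1) = K' (y, 1) := by
  have h : ¬ ((1 : I) : ℝ) ≤ 1 / 2 := by norm_num
  simp only [concat, if_neg h]
  rw [step_eq_one (by norm_num)]

theorem contMDiff_concat {K K' : Y × I → N} (hK : ContMDiff (J.prod (𝓡∂ 1)) (𝓡 n) ∞ K)
    (hK' : ContMDiff (J.prod (𝓡∂ 1)) (𝓡 n) ∞ K') (h : ∀ y, K (y, 1) = K' (y, 0)) :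
    ContMDiff (J.prod (𝓡∂ 1)) (𝓡 n) ∞ (concat K K') := by
  have hr : ∀ c, ContMDiff (J.prod (𝓡∂ 1)) (J.prod (𝓡∂ 1)) ∞
      fun z : Y × I => (z.1, step c z.2) := fun c =>
    contMDiff_fst.prodMk ((contMDiff_step c).comp (contMDiff_coe_interval.comp contMDiff_snd))
  have hc : Continuous fun z : Y × I => (z.2 : ℝ) := by fun_prop
  intro z
  by_cases hz : (z.2 : ℝ) < 2 / 3
  -- On the middle third `step 0` is already 1 and `step 2` is still 0, so both formulas give the
  -- common map `K (y, 1) = K' (y, 0)`. This makes the concatenation smooth at 1/2.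
  · refine ((hK.comp (hr 0)) z).congr_of_eventuallyEq ?_
    filter_upwards [(isOpen_Iio.preimage hc).mem_nhds hz] with w hw
    have hw' : (w.2 : ℝ) < 2 / 3 := hw
    simp only [concat, Function.comp]
    split_ifs with hw2
    · rfl
    · rw [step_eq_one (c := 0) (by linarith), step_eq_zero (c := 2) (by linarith), h]
  · refine ((hK'.comp (hr 2)) z).congr_of_eventuallyEq ?_
    filter_upwards [(isOpen_Ioi.preimage hc).mem_nhds (show (1 : ℝ) / 2 < z.2 by linarith)]
      with w hw
    have hw' : (1 : ℝ) / 2 < w.2 := hw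
    simp only [concat, Function.comp]
    rw [if_neg (by linarith)]

end

/-! ### Homotopy of lifts is an equivalence relation -/

section

variable {p₁ p₂ n : ℕ}
  {P₁ : Type*} [TopologicalSpace P₁] [ChartedSpace (EuclideanSpace ℝ (Fin p₁)) P₁]
  {P₂ : Type*} [TopologicalSpace P₂] [ChartedSpace (EuclideanSpace ℝ (Fin p₂)) P₂]
  {N : Type*} [TopologicalSpace N] [ChartedSpace (EuclideanSpace ℝ (Fin n)) N]
  {f₁ : SmoothMap p₁ n P₁ N} {f₂ : SmoothMap p₂ n P₂ N}

theorem Lift.Homotopic.refl (α : Lift f₁ f₂) : α.Homotopic α :=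
  ⟨⟨fun z => α.F₁ z.1, α.F₁.contMDiff.comp contMDiff_fst⟩,
    ⟨fun z => α.F₂ z.1, α.F₂.contMDiff.comp contMDiff_fst⟩,
    fun _ _ => ⟨rfl, rfl⟩, fun _ _ => ⟨rfl, rfl⟩, fun x _ => α.start₁ x, fun x _ => α.start₂ x,
    fun _ => α.isLinkMap⟩

theorem Lift.Homotopic.symm {α β : Lift f₁ f₂} (h : α.Homotopic β) : β.Homotopic α := by
  obtain ⟨H₁, H₂, h1, h2, h3, h4, h5⟩ := h
  refine ⟨⟨_, H₁.contMDiff.comp contMDiff_reverse⟩, ⟨_, H₂.contMDiff.comp contMDiff_reverse⟩, fun x t => ⟨?_, ?_⟩,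
    fun x t => ⟨?_, ?_⟩, fun x s => h3 x _, fun x s => h4 x _, fun s => h5 (unitInterval.symm s)⟩
  · simpa using (h1 x t).2
  · simpa using (h1 x t).1
  · simpa using (h2 x t).2
  · simpa using (h2 x t).1

theorem Lift.Homotopic.trans {α β γ : Lift f₁ f₂} (h : α.Homotopic β) (h' : β.Homotopic γ) :
    α.Homotopic γ := by
  obtain ⟨H₁, H₂, h1, h2, h3, h4, h5⟩ := h
  obtain ⟨H₁', H₂', h1', h2', h3', h4', h5'⟩ := h'
  refine ⟨⟨concat H₁ H₁', contMDiff_concat H₁.contMDiff H₁'.contMDiff fun z => ?_⟩,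
    ⟨concat H₂ H₂', contMDiff_concat H₂.contMDiff H₂'.contMDiff fun z => ?_⟩,
    fun x t => ⟨?_, ?_⟩, fun x t => ⟨?_, ?_⟩, fun x s => ?_, fun x s => ?_, fun s => ?_⟩
  · exact (h1 z.1 z.2).2.trans (h1' z.1 z.2).1.symm
  · exact (h2 z.1 z.2).2.trans (h2' z.1 z.2).1.symm
  · exact (concat_zero _ _ _).trans (h1 x t).1
  · exact (concat_one _ _ _).trans (h1' x t).2
  · exact (concat_zero _ _ _).trans (h2 x t).1
  · exact (concat_one _ _ _).trans (h2' x t).2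
  · change concat H₁ H₁' ((x, 0), s) = _
    simp only [concat, h3, h3', ite_self]
  · change concat H₂ H₂' ((x, 0), s) = _
    simp only [concat, h4, h4', ite_self]
  · by_cases hs : (s : ℝ) ≤ 1 / 2
    · have := h5 (step 0 s)
      simpa only [ContMDiffMap.coeFn_mk, concat, if_pos hs] using this
    · have := h5' (step 2 s)
      simpa only [ContMDiffMap.coeFn_mk, concat, if_neg hs] using this

end

/-! ### Deformations of lifts -/

section

variable {p n : ℕ}
  {P : Type*} [TopologicalSpace P] [ChartedSpace (EuclideanSpace ℝ (Fin p)) P] [T2Space P]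
  {N : Type*} [TopologicalSpace N] [ChartedSpace (EuclideanSpace ℝ (Fin n)) N]

/-- The extension of a path of maps to the line which is constant outside the interval. -/
def extendPath (F : P × I → N) (z : P × ℝ) : N := F (z.1, Set.projIcc 0 1 zero_le_one z.2)

theorem extendPath_coe (F : P × I → N) (x : P) (t : I) : extendPath F (x, t) = F (x, t) := by
  simp [extendPath]

theorem contMDiffOn_extendPath {F : P × I → N} (hF : ContMDiff ((𝓡 p).prod (𝓡∂ 1)) (𝓡 n) ∞ F) :
    ContMDiffOn ((𝓡 p).prod 𝓘(ℝ)) (𝓡 n) ∞ (extendPath F) (Set.univ ×ˢ Set.Ioo (0 : ℝ) 1) := by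
  refine hF.comp_contMDiffOn (contMDiff_fst.contMDiffOn.prodMk ?_)
  have h : ContMDiffOn 𝓘(ℝ) (𝓡∂ 1) ∞ (Set.projIcc (0 : ℝ) 1 zero_le_one) (Set.Icc 0 1) :=
    contMDiffOn_projIcc
  exact h.comp contMDiff_snd.contMDiffOn fun z hz => Set.Ioo_subset_Icc_self hz.2

theorem contMDiff_prod_coe : ContMDiff ((𝓡 p).prod (𝓡∂ 1)) ((𝓡 p).prod 𝓘(ℝ)) ∞
    fun z : P × I => (z.1, (z.2 : ℝ)) :=
  contMDiff_fst.prodMk (contMDiff_coe_interval.comp contMDiff_snd)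

/-- The deformation over the line is supported in a compact set lying over the open interval. It is
therefore constant near the times 0 and 1, where the extended path need not be smooth, and restricts
to a smooth homotopy of paths with fixed ends. -/
theorem exists_homotopy_of_isDeformation {F : SmoothPath p n P N} {F' : P × ℝ → N} {O : Set ℝ}
    (hO : O ⊆ Set.Ioo 0 1)
    (h : IsDeformation ((𝓡 p).prod 𝓘(ℝ)) n (Set.univ ×ˢ Set.Ioo (0 : ℝ) 1) (Set.univ ×ˢ O)
      (extendPath F) F') :
    ∃ (G : SmoothPath p n P N) (K : SmoothSquare p n P N), extendPath G = F' ∧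
      (∀ x t, K ((x, t), 0) = F (x, t) ∧ K ((x, t), 1) = G (x, t)) ∧
      (∀ x s, K ((x, 0), s) = F (x, 0) ∧ K ((x, 1), s) = F (x, 1)) ∧
      (∀ x, G (x, 0) = F (x, 0) ∧ G (x, 1) = F (x, 1)) := by
  obtain ⟨h, h01, ⟨K, hK, hKO, hfix⟩, hs⟩ := h
  have hsq : ContMDiff (((𝓡 p).prod (𝓡∂ 1)).prod (𝓡∂ 1)) (𝓡 n) ∞
      fun z : (P × I) × I => h ((z.1.1, (z.1.2 : ℝ)), (z.2 : ℝ)) := by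
    intro z
    by_cases hz : (z.1.1, (z.1.2 : ℝ)) ∈ K
    · have h1 : ContMDiffAt (((𝓡 p).prod 𝓘(ℝ)).prod 𝓘(ℝ)) (𝓡 n) ∞ h
          ((z.1.1, (z.1.2 : ℝ)), (z.2 : ℝ)) := hs _ ⟨trivial, hO (hKO hz).2⟩ _ z.2.2
      exact ContMDiffAt.comp z (g := h)
        (f := fun z : (P × I) × I => ((z.1.1, (z.1.2 : ℝ)), (z.2 : ℝ))) h1
        (((contMDiff_prod_coe (p := p) (P := P)).comp contMDiff_fst).prodMk
          (contMDiff_coe_interval.comp contMDiff_snd)).contMDiffAt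
    · have h1 : ContMDiff (((𝓡 p).prod (𝓡∂ 1)).prod (𝓡∂ 1)) (𝓡 n) ∞
          fun z : (P × I) × I => F z.1 := F.contMDiff.comp contMDiff_fst
      refine (h1 z).congr_of_eventuallyEq ?_
      have hc : Continuous fun z : (P × I) × I => (z.1.1, (z.1.2 : ℝ)) := by fun_prop
      filter_upwards [(hK.isClosed.isOpen_compl.preimage hc).mem_nhds hz] with w hw
      rw [hfix _ hw, extendPath_coe]
  have hend : ∀ (x : P) (s t : ℝ), t ∉ Set.Ioo (0 : ℝ) 1 → h ((x, t), s) = extendPath F (x, t) :=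
    fun x s t ht => hfix _ (fun hmem => ht (hO (hKO hmem).2)) s
  have h0 : ∀ (x : P) (s : ℝ), h ((x, 0), s) = F (x, 0) := fun x s => by
    rw [hend x s 0 (by simp)]
    exact extendPath_coe F x 0
  have h1 : ∀ (x : P) (s : ℝ), h ((x, 1), s) = F (x, 1) := fun x s => by
    rw [hend x s 1 (by simp)]
    exact extendPath_coe F x 1
  refine ⟨⟨fun z => h ((z.1, (z.2 : ℝ)), ((1 : I) : ℝ)), ?_⟩, ⟨_, hsq⟩, ?_, fun x t => ⟨?_, rfl⟩,
    fun x s => ⟨h0 x s, h1 x s⟩, fun x => ⟨h0 x _, h1 x _⟩⟩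
  · exact hsq.comp (g := fun z : (P × I) × I => h ((z.1.1, (z.1.2 : ℝ)), (z.2 : ℝ)))
      (f := fun z : P × I => (z, (1 : I))) (contMDiff_id.prodMk contMDiff_const)
  · funext ⟨x, t⟩
    -- Outside (0,1) nothing moves, and the original family is constant on each side, so the
    -- deformed family is again the constant extension of its restriction.
    change h ((x, ((Set.projIcc (0 : ℝ) 1 zero_le_one t : I) : ℝ)), 1) = F' (x, t)
    by_cases ht : t ∈ Set.Ioo (0 : ℝ) 1
    · rw [Set.projIcc_of_mem _ (Set.Ioo_subset_Icc_self ht)]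
      exact (h01 (x, t)).2
    · rw [← (h01 (x, t)).2, hend x 1 t ht]
      rw [hend, extendPath_coe, extendPath]
      rintro ⟨h3, h4⟩
      rw [Set.coe_projIcc] at h3 h4
      refine ht ⟨?_, ?_⟩
      · by_contra! h5
        rw [min_eq_right (by linarith), max_eq_left h5] at h3
        exact lt_irrefl _ h3
      · by_contra! h5
        rw [min_eq_left h5, max_eq_right (by norm_num)] at h4
        exact lt_irrefl _ h4
  · change h ((x, (t : ℝ)), 0) = F (x, t)
    rw [(h01 _).1, extendPath_coe]

end

section

variable {p₁ p₂ n : ℕ}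
  {P₁ : Type*} [TopologicalSpace P₁] [ChartedSpace (EuclideanSpace ℝ (Fin p₁)) P₁] [T2Space P₁]
  {P₂ : Type*} [TopologicalSpace P₂] [ChartedSpace (EuclideanSpace ℝ (Fin p₂)) P₂] [T2Space P₂]
  {N : Type*} [TopologicalSpace N] [ChartedSpace (EuclideanSpace ℝ (Fin n)) N]
  {f₁ : SmoothMap p₁ n P₁ N} {f₂ : SmoothMap p₂ n P₂ N}

/-- Both components of a lift as families of maps parametrized by the line. -/
def Lift.extend (α : Lift f₁ f₂) : (P₁ × ℝ → N) × (P₂ × ℝ → N) :=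
  (extendPath α.F₁, extendPath α.F₂)

theorem Lift.exists_homotopic_of_deformsTo {α : Lift f₁ f₂} {O : Set ℝ} (hO : O ⊆ Set.Ioo 0 1)
    {F' : (P₁ × ℝ → N) × (P₂ × ℝ → N)}
    (h : DeformsTo (𝓡 p₁) (𝓡 p₂) n (Set.Ioo 0 1) O α.extend F') :
    ∃ β : Lift f₁ f₂, α.Homotopic β ∧ β.extend = F' := by
  obtain ⟨G₁, K₁, h1, h2, h3, h4⟩ := exists_homotopy_of_isDeformation hO h.1
  obtain ⟨G₂, K₂, k1, k2, k3, k4⟩ := exists_homotopy_of_isDeformation hO h.2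
  refine ⟨⟨G₁, G₂, fun x => (h4 x).1.trans (α.start₁ x), fun x => (k4 x).1.trans (α.start₂ x), ?_⟩,
    ⟨K₁, K₂, h2, k2, fun x s => (h3 x s).1.trans (α.start₁ x),
      fun x s => (k3 x s).1.trans (α.start₂ x), fun s => ?_⟩, Prod.ext h1 k1⟩
  · simpa only [h4, k4] using α.isLinkMap
  · simpa only [h3, k3] using α.isLinkMap

theorem Lift.exists_homotopic_of_reflTransGen {α : Lift f₁ f₂} {O : Set ℝ} (hO : O ⊆ Set.Ioo 0 1)
    {F' : (P₁ × ℝ → N) × (P₂ × ℝ → N)}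
    (h : Relation.ReflTransGen (DeformsTo (𝓡 p₁) (𝓡 p₂) n (Set.Ioo 0 1) O) α.extend F') :
    ∃ β : Lift f₁ f₂, α.Homotopic β ∧ β.extend = F' := by
  induction h with
  | refl => exact ⟨α, .refl α, rfl⟩
  | tail _ h ih =>
    obtain ⟨β, h1, rfl⟩ := ih
    obtain ⟨γ, h2, h3⟩ := Lift.exists_homotopic_of_deformsTo hO h
    exact ⟨γ, h1.trans h2, h3⟩

end
end LinkMaps
end

/-! ### Coincidence sets of transverse maps as submanifolds. -/

noncomputable section

namespace GeneralPosition

section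

variable {E : Type*} [NormedAddCommGroup E] [NormedSpace ℝ E] [FiniteDimensional ℝ E]
  {H : Type*} [TopologicalSpace H] {J : ModelWithCorners ℝ E H} [J.Boundaryless]
  {X : Type*} [TopologicalSpace X] [ChartedSpace H X] [IsManifold J ∞ X]
  {n : ℕ} {N : Type*} [TopologicalSpace N] [ChartedSpace (EuclideanSpace ℝ (Fin n)) N]
  [IsManifold (𝓡 n) ∞ N]

/-- The points of `T` at which two maps coincide. -/
def coincidenceSet (T : Set X) (G₁ G₂ : X → N) : Set X := {x | x ∈ T ∧ G₁ x = G₂ x}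

/-- In a chart of N, the difference of the maps is a submersion at `x₀` with the coincidences as
zero set; completing it to a chart of X gives a slice chart. -/
theorem exists_sliceChart {T : Set X} (hT : IsOpen T) {G₁ G₂ : X → N}
    (h₁ : ContMDiffOn J (𝓡 n) ∞ G₁ T) (h₂ : ContMDiffOn J (𝓡 n) ∞ G₂ T) {k : ℕ} {x₀ : X}
    (hx₀ : x₀ ∈ coincidenceSet T G₁ G₂) (hR : TransverseAt J n G₁ G₂ x₀)
    (hd : Module.finrank ℝ E = n + k) :
    ∃ e : OpenPartialHomeomorph X (EuclideanSpace ℝ (Fin n) × EuclideanSpace ℝ (Fin k)),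
      x₀ ∈ e.source ∧
      ContMDiffOn J 𝓘(ℝ, EuclideanSpace ℝ (Fin n) × EuclideanSpace ℝ (Fin k)) ∞ e e.source ∧
      ContMDiffOn 𝓘(ℝ, EuclideanSpace ℝ (Fin n) × EuclideanSpace ℝ (Fin k)) J ∞ e.symm e.target ∧
      ∀ x ∈ e.source, x ∈ coincidenceSet T G₁ G₂ ↔ (e x).1 = 0 := by
  have hy₁ : G₁ x₀ ∈ (chartAt (EuclideanSpace ℝ (Fin n)) (G₁ x₀)).source := mem_chart_source _ _
  have hy₂ : G₂ x₀ ∈ (chartAt (EuclideanSpace ℝ (Fin n)) (G₁ x₀)).source := hx₀.2 ▸ hy₁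
  obtain ⟨e, he, heU, hg, hs, hs'⟩ := exists_chart_of_surjective_mfderiv (J := J)
    (G := EuclideanSpace ℝ (Fin k)) (isOpen_chartDomain hT (G₁ x₀) h₁.continuousOn h₂.continuousOn)
    (contMDiffOn_chartDiff (G₁ x₀) h₁ h₂) (x₀ := x₀) ⟨⟨hx₀.1, hy₁⟩, ⟨hx₀.1, hy₂⟩⟩
    ((surjective_mfderiv_chartDiff_iff hx₀.2 hy₁
      ((h₁.contMDiffAt (hT.mem_nhds hx₀.1)).mdifferentiableAt (by simp))
      ((h₂.contMDiffAt (hT.mem_nhds hx₀.1)).mdifferentiableAt (by simp))).2 (hR hx₀.2))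
    (by simpa using hd)
  refine ⟨e, he, hs, hs', fun x hx => ?_⟩
  obtain ⟨⟨hxT, h3⟩, ⟨-, h4⟩⟩ := heU hx
  rw [hg x hx, chartDiff_eq_zero_iff h3 h4]
  exact ⟨fun h => h.2, fun h => ⟨hxT, h⟩⟩

/-- Transversality makes the coincidence set of two maps a submanifold. -/
theorem nonempty_sliceAtlas_coincidenceSet {T : Set X} (hT : IsOpen T) {G₁ G₂ : X → N}
    (h₁ : ContMDiffOn J (𝓡 n) ∞ G₁ T) (h₂ : ContMDiffOn J (𝓡 n) ∞ G₂ T) {k : ℕ}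
    (hR : ∀ x ∈ T, TransverseAt J n G₁ G₂ x)
    (hd : (coincidenceSet T G₁ G₂).Nonempty → Module.finrank ℝ E = n + k) :
    Nonempty (SliceAtlas J (𝓡 k) (EuclideanSpace ℝ (Fin n)) (coincidenceSet T G₁ G₂)) := by
  have h : ∀ w : coincidenceSet T G₁ G₂, _ := fun w =>
    exists_sliceChart hT h₁ h₂ w.2 (hR _ w.2.1) (hd ⟨w, w.2⟩)
  choose e he hs hs' hmem using h
  exact ⟨⟨e, he, hs, hs', fun w x hx => (hmem w x hx).trans (by simp)⟩⟩

/-- The points of `T` at which two maps coincide, and at which the function `h` has values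
in the interval. -/
def coincidenceSlab (T : Set X) (G₁ G₂ : X → N) (h : X → ℝ) : Set X :=
  {x | x ∈ coincidenceSet T G₁ G₂ ∧ h x ∈ Set.Icc (0 : ℝ) 1}

/-- Two maps to `N` are transverse at `x` along the level set of `h`. -/
def LevelTransverseAt (J : ModelWithCorners ℝ E H) (n : ℕ) {N : Type*} [TopologicalSpace N]
    [ChartedSpace (EuclideanSpace ℝ (Fin n)) N] (G₁ G₂ : X → N) (h : X → ℝ) (x : X) : Prop :=
  ∀ (a : EuclideanSpace ℝ (Fin n)) (b : ℝ), ∃ v : E, diffDeriv J n G₁ G₂ x v = a ∧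
    (mfderiv J 𝓘(ℝ) h x v : ℝ) = b

/-- Level transversality says that the difference of the maps and `h` together form a submersion.
Both can then be coordinates of one chart, with `h` as the coordinate defining the half space. -/
theorem exists_halfSliceChart_of_level {T : Set X} (hT : IsOpen T) {G₁ G₂ : X → N}
    (h₁ : ContMDiffOn J (𝓡 n) ∞ G₁ T) (h₂ : ContMDiffOn J (𝓡 n) ∞ G₂ T) {k : ℕ} {x₀ : X}
    (hx₀ : x₀ ∈ coincidenceSet T G₁ G₂) {h : X → ℝ} (hh : ContMDiff J 𝓘(ℝ) ∞ h)
    (hR : LevelTransverseAt J n G₁ G₂ h x₀) {V : Set X} (hV : IsOpen V) (hxV : x₀ ∈ V)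
    (hd : Module.finrank ℝ E = n + (k + 1)) :
    ∃ e : OpenPartialHomeomorph X (EuclideanSpace ℝ (Fin n) × EuclideanSpace ℝ (Fin (k + 1))),
      x₀ ∈ e.source ∧ e.source ⊆ V ∧
      ContMDiffOn J 𝓘(ℝ, EuclideanSpace ℝ (Fin n) × EuclideanSpace ℝ (Fin (k + 1))) ∞ e e.source ∧
      ContMDiffOn 𝓘(ℝ, EuclideanSpace ℝ (Fin n) × EuclideanSpace ℝ (Fin (k + 1))) J ∞
        e.symm e.target ∧
      ∀ x ∈ e.source, (x ∈ coincidenceSet T G₁ G₂ ↔ (e x).1 = 0) ∧ (e x).2 0 = h x := by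
  have hy₁ : G₁ x₀ ∈ (chartAt (EuclideanSpace ℝ (Fin n)) (G₁ x₀)).source := mem_chart_source _ _
  have hy₂ : G₂ x₀ ∈ (chartAt (EuclideanSpace ℝ (Fin n)) (G₁ x₀)).source := hx₀.2 ▸ hy₁
  have hd₁ := (h₁.contMDiffAt (hT.mem_nhds hx₀.1)).mdifferentiableAt (n := ∞) (by simp)
  have hd₂ := (h₂.contMDiffAt (hT.mem_nhds hx₀.1)).mdifferentiableAt (n := ∞) (by simp)
  have hinv : (mfderiv (𝓡 n) 𝓘(ℝ, EuclideanSpace ℝ (Fin n)) (extChartAt (𝓡 n) (G₁ x₀))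
      (G₁ x₀)).IsInvertible :=
    isInvertible_mfderiv_extChartAt (by rwa [extChartAt_source])
  obtain ⟨e, he, heU, hg, hs, hs'⟩ := exists_chart_with_coordinate (J := J) (h := h) (k := k)
    ((isOpen_chartDomain hT (G₁ x₀) h₁.continuousOn h₂.continuousOn).inter hV)
    ((contMDiffOn_chartDiff (G₁ x₀) h₁ h₂).mono Set.inter_subset_left) hh.contMDiffOn (x₀ := x₀)
    ⟨⟨⟨hx₀.1, hy₁⟩, ⟨hx₀.1, hy₂⟩⟩, hxV⟩ (by
      intro a b
      obtain ⟨a', rfl⟩ := hinv.surjective a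
      obtain ⟨v, hv, hv'⟩ := hR a' b
      refine ⟨v, ?_, hv'⟩
      rw [(hasMFDerivAt_chartDiff hx₀.2 hy₁ hd₁ hd₂).mfderiv, ← hv]
      rfl)
    (by simpa using hd)
  refine ⟨e, he, fun x hx => (heU hx).2, hs, hs', fun x hx => ⟨?_, (hg x hx).2⟩⟩
  obtain ⟨⟨⟨hxT, h3⟩, ⟨-, h4⟩⟩, -⟩ := heU hx
  rw [(hg x hx).1, chartDiff_eq_zero_iff h3 h4]
  exact ⟨fun h => h.2, fun h => ⟨hxT, h⟩⟩

theorem exists_halfSliceChart_of_interior {T : Set X} (hT : IsOpen T) {G₁ G₂ : X → N}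
    (h₁ : ContMDiffOn J (𝓡 n) ∞ G₁ T) (h₂ : ContMDiffOn J (𝓡 n) ∞ G₂ T) {k : ℕ} {x₀ : X}
    (hx₀ : x₀ ∈ coincidenceSet T G₁ G₂) (hR : TransverseAt J n G₁ G₂ x₀)
    {V : Set X} (hV : IsOpen V) (hxV : x₀ ∈ V)
    (hd : Module.finrank ℝ E = n + (k + 1)) :
    ∃ e : OpenPartialHomeomorph X (EuclideanSpace ℝ (Fin n) × EuclideanSpace ℝ (Fin (k + 1))),
      x₀ ∈ e.source ∧ e.source ⊆ V ∧
      ContMDiffOn J 𝓘(ℝ, EuclideanSpace ℝ (Fin n) × EuclideanSpace ℝ (Fin (k + 1))) ∞ e e.source ∧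
      ContMDiffOn 𝓘(ℝ, EuclideanSpace ℝ (Fin n) × EuclideanSpace ℝ (Fin (k + 1))) J ∞
        e.symm e.target ∧
      ∀ x ∈ e.source, (x ∈ coincidenceSet T G₁ G₂ ↔ (e x).1 = 0) ∧ 0 < (e x).2 0 := by
  have hy₁ : G₁ x₀ ∈ (chartAt (EuclideanSpace ℝ (Fin n)) (G₁ x₀)).source := mem_chart_source _ _
  have hy₂ : G₂ x₀ ∈ (chartAt (EuclideanSpace ℝ (Fin n)) (G₁ x₀)).source := hx₀.2 ▸ hy₁
  obtain ⟨e, he, heU, hg, hs, hs'⟩ := exists_chart_with_positive_coordinate (J := J) (k := k)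
    ((isOpen_chartDomain hT (G₁ x₀) h₁.continuousOn h₂.continuousOn).inter hV)
    ((contMDiffOn_chartDiff (G₁ x₀) h₁ h₂).mono Set.inter_subset_left) (x₀ := x₀)
    ⟨⟨⟨hx₀.1, hy₁⟩, ⟨hx₀.1, hy₂⟩⟩, hxV⟩
    ((surjective_mfderiv_chartDiff_iff hx₀.2 hy₁
      ((h₁.contMDiffAt (hT.mem_nhds hx₀.1)).mdifferentiableAt (by simp))
      ((h₂.contMDiffAt (hT.mem_nhds hx₀.1)).mdifferentiableAt (by simp))).2 (hR hx₀.2))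
    (by simpa using hd)
  refine ⟨e, he, fun x hx => (heU hx).2, hs, hs', fun x hx => ⟨?_, (hg x hx).2⟩⟩
  obtain ⟨⟨⟨hxT, h3⟩, ⟨-, h4⟩⟩, -⟩ := heU hx
  rw [(hg x hx).1, chartDiff_eq_zero_iff h3 h4]
  exact ⟨fun h => h.2, fun h => ⟨hxT, h⟩⟩

/-- At the upper end h = 1 the coordinate which is nonnegative on the slab is 1 - h. -/
theorem LevelTransverseAt.one_sub {G₁ G₂ : X → N} {h : X → ℝ} {x : X}
    (hh : MDifferentiableAt J 𝓘(ℝ) h x) (hR : LevelTransverseAt J n G₁ G₂ h x) :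
    LevelTransverseAt J n G₁ G₂ (fun x => 1 - h x) x := by
  intro a b
  obtain ⟨v, hv, hv'⟩ := hR a (-b)
  refine ⟨v, hv, ?_⟩
  have h1 : HasMFDerivAt J 𝓘(ℝ) (fun x => 1 - h x) x (-(mfderiv J 𝓘(ℝ) h x : E →L[ℝ] ℝ)) := by
    have h2 : HasMFDerivAt J 𝓘(ℝ) (fun _ : X => (1 : ℝ)) x (0 : E →L[ℝ] ℝ) :=
      hasMFDerivAt_const _ _
    exact (h2.sub hh.hasMFDerivAt).congr_mfderiv (zero_sub _)
  rw [h1.mfderiv]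
  exact neg_eq_iff_eq_neg.2 hv'

/-- Transversality makes the part of the coincidence set where the values of `h` belong to the
interval a submanifold with boundary. -/
theorem exists_sliceAtlas_coincidenceSlab {T : Set X} (hT : IsOpen T) {G₁ G₂ : X → N}
    (h₁ : ContMDiffOn J (𝓡 n) ∞ G₁ T) (h₂ : ContMDiffOn J (𝓡 n) ∞ G₂ T) {k : ℕ}
    {h : X → ℝ} (hh : ContMDiff J 𝓘(ℝ) ∞ h)
    (hR : ∀ x ∈ coincidenceSlab T G₁ G₂ h, TransverseAt J n G₁ G₂ x)
    (hR' : ∀ x ∈ coincidenceSlab T G₁ G₂ h, h x = 0 ∨ h x = 1 → LevelTransverseAt J n G₁ G₂ h x)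
    (hd : Module.finrank ℝ E = n + (k + 1)) :
    ∃ S : SliceAtlas J (𝓡∂ (k + 1)) (EuclideanSpace ℝ (Fin n)) (coincidenceSlab T G₁ G₂ h),
      ∀ w, w ∈ (𝓡∂ (k + 1)).boundary S.Carrier ↔ h (S.incl w) = 0 ∨ h (S.incl w) = 1 := by
  have key : ∀ w : coincidenceSlab T G₁ G₂ h,
      ∃ e : OpenPartialHomeomorph X (EuclideanSpace ℝ (Fin n) × EuclideanSpace ℝ (Fin (k + 1))),
      (w : X) ∈ e.source ∧
      ContMDiffOn J 𝓘(ℝ, EuclideanSpace ℝ (Fin n) × EuclideanSpace ℝ (Fin (k + 1))) ∞ e e.source ∧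
      ContMDiffOn 𝓘(ℝ, EuclideanSpace ℝ (Fin n) × EuclideanSpace ℝ (Fin (k + 1))) J ∞
        e.symm e.target ∧
      (∀ x ∈ e.source, x ∈ coincidenceSlab T G₁ G₂ h ↔ (e x).1 = 0 ∧ 0 ≤ (e x).2 0) ∧
      (0 = (e w).2 0 ↔ h w = 0 ∨ h w = 1) := by
    rintro ⟨x₀, hx₀⟩
    -- Near a point of the lower end the chart is confined to h < 1, so that only the inequality 0 ≤
    -- h remains, which is the half space condition. The upper end is symmetric, and in the interior
    -- neither inequality matters.
    by_cases h0 : h x₀ = 0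
    · obtain ⟨e, he, heV, hs, hs', hmem⟩ := exists_halfSliceChart_of_level hT h₁ h₂ hx₀.1 hh
        (hR' x₀ hx₀ (.inl h0)) (isOpen_Iio.preimage hh.continuous)
        (show h x₀ < 1 by rw [h0]; exact one_pos) hd
      refine ⟨e, he, hs, hs', fun x hx => ?_, ?_⟩
      · rw [coincidenceSlab, Set.mem_ofPred_eq, (hmem x hx).1, (hmem x hx).2]
        exact and_congr_right fun _ => ⟨fun h => h.1, fun h => ⟨h, (heV hx).le⟩⟩
      · rw [(hmem x₀ he).2]
        simp [h0]
    by_cases h1 : h x₀ = 1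
    · have hh' : ContMDiff J 𝓘(ℝ) ∞ fun x => 1 - h x := contMDiff_const.sub hh
      obtain ⟨e, he, heV, hs, hs', hmem⟩ := exists_halfSliceChart_of_level hT h₁ h₂ hx₀.1 hh'
        ((hR' x₀ hx₀ (.inr h1)).one_sub (hh.mdifferentiable (by simp) x₀))
        (isOpen_Ioi.preimage hh.continuous) (show 0 < h x₀ by rw [h1]; exact one_pos) hd
      refine ⟨e, he, hs, hs', fun x hx => ?_, ?_⟩
      · rw [coincidenceSlab, Set.mem_ofPred_eq, (hmem x hx).1, (hmem x hx).2, sub_nonneg]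
        exact and_congr_right fun _ => ⟨fun h => h.2, fun h => ⟨(heV hx).le, h⟩⟩
      · rw [(hmem x₀ he).2]
        simp [h1]
    · have hlt : h x₀ ∈ Set.Ioo (0 : ℝ) 1 :=
        ⟨lt_of_le_of_ne hx₀.2.1 (Ne.symm h0), lt_of_le_of_ne hx₀.2.2 h1⟩
      obtain ⟨e, he, heV, hs, hs', hmem⟩ := exists_halfSliceChart_of_interior hT h₁ h₂ hx₀.1
        (hR x₀ hx₀) (isOpen_Ioo.preimage hh.continuous) hlt hd
      refine ⟨e, he, hs, hs', fun x hx => ?_, ?_⟩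
      · rw [coincidenceSlab, Set.mem_ofPred_eq, (hmem x hx).1]
        exact and_congr_right fun _ =>
          ⟨fun _ => (hmem x hx).2.le, fun _ => Set.Ioo_subset_Icc_self (heV hx)⟩
      · simp only [h0, h1, or_self, iff_false]
        exact (hmem x₀ he).2.ne
  choose e he hs hs' hmem hb using key
  refine ⟨⟨e, he, hs, hs', fun w x hx => (hmem w x hx).trans ?_⟩, fun w => ?_⟩
  · rw [range_modelWithCornersEuclideanHalfSpace]
    rfl
  · rw [SliceAtlas.mem_boundary_iff, frontier_range_modelWithCornersEuclideanHalfSpace]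
    exact hb w

end
end GeneralPosition
end

/-! ### Continuous families of linear maps between tangent spaces, and their gluing. -/

noncomputable section

namespace GeneralPosition
open Bundle

section

variable {E : Type*} [NormedAddCommGroup E] [NormedSpace ℝ E]
  {H : Type*} [TopologicalSpace H] (J : ModelWithCorners ℝ E H)
  {M : Type*} [TopologicalSpace M] [ChartedSpace H M]

/-- A tangent vector, given by its components in the model space. -/
abbrev tangentPoint (x : M) (v : E) : TangentBundle J M := ⟨x, v⟩

variable [IsManifold J 1 M]

/-- The coordinates of tangent vectors at `x` in the standard trivialization around `x₀`. -/
def tangentCoordinates (x₀ x : M) : E →L[ℝ] E :=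
  (trivializationAt E (TangentSpace J) x₀).continuousLinearMapAt ℝ x

variable {J}

theorem continuousAt_tangentPoint_iff {Z : Type*} [TopologicalSpace Z] {c : Z → M} {a : Z → E}
    {z₀ : Z} : ContinuousAt (fun z => tangentPoint J (c z) (a z)) z₀ ↔
      ContinuousAt c z₀ ∧ ContinuousAt (fun z =>
        (trivializationAt E (TangentSpace J) (c z₀) (tangentPoint J (c z) (a z))).2) z₀ :=
  FiberBundle.continuousAt_totalSpace E _

theorem trivialization_tangentPoint (x₀ x : M)
    (hx : x ∈ (trivializationAt E (TangentSpace J) x₀).baseSet) (v : E) :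
    (trivializationAt E (TangentSpace J) x₀ (tangentPoint J x v)).2 =
      tangentCoordinates J x₀ x v := by
  have h : ∀ v : TangentSpace J x, (trivializationAt E (TangentSpace J) x₀).continuousLinearMapAt
      ℝ x v = (trivializationAt E (TangentSpace J) x₀ ⟨x, v⟩).2 := fun v => by
    rw [Trivialization.continuousLinearMapAt_apply, Trivialization.coe_linearMapAt_of_mem _ hx]
  exact (h v).symm

/-- Linear combinations of continuous families of tangent vectors are continuous. -/
theorem continuousAt_tangentPoint_smul_add {Z : Type*} [TopologicalSpace Z] {c : Z → M}
    {a b : Z → E} {ρ : Z → ℝ} {z₀ : Z}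
    (ha : ContinuousAt (fun z => tangentPoint J (c z) (a z)) z₀)
    (hb : ContinuousAt (fun z => tangentPoint J (c z) (b z)) z₀) (hρ : ContinuousAt ρ z₀) :
    ContinuousAt (fun z => tangentPoint J (c z) (ρ z • a z + b z)) z₀ := by
  rw [continuousAt_tangentPoint_iff] at ha hb ⊢
  refine ⟨ha.1, ((hρ.smul ha.2).add hb.2).congr ?_⟩
  filter_upwards [ha.1.preimage_mem_nhds
    ((trivializationAt E (TangentSpace J) (c z₀)).open_baseSet.mem_nhds
      (mem_baseSet_trivializationAt E (TangentSpace J) (c z₀)))] with z hz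
  rw [Pi.add_apply, Pi.smul_apply', trivialization_tangentPoint _ _ hz,
    trivialization_tangentPoint _ _ hz, trivialization_tangentPoint _ _ hz, map_add, map_smul]

theorem continuousAt_tangentPoint_zero {Z : Type*} [TopologicalSpace Z] {c : Z → M} {z₀ : Z}
    (hc : ContinuousAt c z₀) : ContinuousAt (fun z => tangentPoint J (c z) 0) z₀ := by
  rw [continuousAt_tangentPoint_iff]
  refine ⟨hc, (continuousAt_const (y := (0 : E))).congr ?_⟩
  filter_upwards [hc.preimage_mem_nhds
    ((trivializationAt E (TangentSpace J) (c z₀)).open_baseSet.mem_nhds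
      (mem_baseSet_trivializationAt E (TangentSpace J) (c z₀)))] with z hz
  rw [trivialization_tangentPoint _ _ hz]
  exact (map_zero _).symm

end

section

variable {E : Type*} [NormedAddCommGroup E] [NormedSpace ℝ E]
  {H : Type*} [TopologicalSpace H] (J : ModelWithCorners ℝ E H)
  {M : Type*} [TopologicalSpace M] [ChartedSpace H M] [IsManifold J 1 M]
  {n : ℕ} {N : Type*} [TopologicalSpace N] [ChartedSpace (EuclideanSpace ℝ (Fin n)) N]
  [IsManifold (𝓡 n) 1 N]
  {T : Type*} [NormedAddCommGroup T] [NormedSpace ℝ T]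
  {W : Type*} [TopologicalSpace W] (m : W → M) (y : W → N)

variable (n) in
/-- The total space of the pullback of the tangent bundle of `N`. -/
abbrev PulledTangent := {q : W × TangentBundle (𝓡 n) N // q.2.proj = y q.1}

/-- The map of tangent vectors defined by a family of linear maps of the model spaces. -/
def familyMap (s : W → EuclideanSpace ℝ (Fin n) →L[ℝ] E × T) (q : PulledTangent n y) :
    TangentBundle J M × T :=
  (tangentPoint J (m q.1.1) (s q.1.1 q.1.2.snd).1, (s q.1.1 q.1.2.snd).2)

/-- A partition of unity combines the local families; convexity of the conditions `C w` keeps the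
combination admissible. Continuity is that of the induced map on total spaces, since the linear maps
of the model spaces alone depend on choices of charts. -/
theorem exists_continuous_family [CompactSpace W] [T2Space W] (hm : Continuous m)
    (C : W → Set (EuclideanSpace ℝ (Fin n) →L[ℝ] E × T)) (hC : ∀ w, Convex ℝ (C w))
    (hloc : ∀ w₀, ∃ (U : Set W) (s : W → EuclideanSpace ℝ (Fin n) →L[ℝ] E × T), IsOpen U ∧
      w₀ ∈ U ∧ (∀ w ∈ U, s w ∈ C w) ∧
      ∀ q : PulledTangent n y, q.1.1 ∈ U → ContinuousAt (familyMap J m y s) q) :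
    ∃ s : W → EuclideanSpace ℝ (Fin n) →L[ℝ] E × T, (∀ w, s w ∈ C w) ∧
      Continuous (familyMap J m y s) := by
  choose U s hU hwU hsC hsc using hloc
  obtain ⟨t, ht⟩ := isCompact_univ.elim_finite_subcover U hU fun w _ => Set.mem_iUnion.2 ⟨w, hwU w⟩
  obtain ⟨f, hf⟩ := PartitionOfUnity.exists_isSubordinate isClosed_univ (fun i : t => U i)
    (fun i => hU i) (ht.trans (by
      intro w hw
      obtain ⟨i, hi, hw⟩ := Set.mem_iUnion₂.1 hw
      exact Set.mem_iUnion.2 ⟨⟨i, hi⟩, hw⟩))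
  have hπ : Continuous fun q : PulledTangent n y => q.1.1 := by fun_prop
  -- On `U i` this is the continuity of the local family; off the support of `f i` the term vanishes
  -- near the point.
  have hterm : ∀ (i : t) (q : PulledTangent n y),
      ContinuousAt (familyMap J m y fun w => f i w • s i w) q := by
    intro i q
    have h0 : ContinuousAt (fun q : PulledTangent n y => tangentPoint J (m q.1.1) 0) q :=
      continuousAt_tangentPoint_zero (hm.comp hπ).continuousAt
    by_cases hq : q.1.1 ∈ U i
    · have h1 := hsc i q hq
      have h2 : ContinuousAt (fun q : PulledTangent n y => f i q.1.1) q :=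
        ((f i).continuous.comp hπ).continuousAt
      have h3 := (continuousAt_tangentPoint_smul_add h1.fst h0 h2).prodMk (h2.smul h1.snd)
      refine h3.congr (.of_forall fun q => ?_)
      exact Prod.ext (congrArg (tangentPoint J (m q.1.1)) (add_zero _)) rfl
    · have h2 : q.1.1 ∉ tsupport (f i) := fun h => hq (hf i h)
      refine (h0.prodMk (continuousAt_const (y := (0 : T)))).congr ?_
      filter_upwards [((isClosed_tsupport (f i)).isOpen_compl.preimage hπ).mem_nhds h2] with q' hq'
      have h4 : f i q'.1.1 = 0 := image_eq_zero_of_notMem_tsupport hq'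
      simp only [familyMap, h4, zero_smul]
      rfl
  refine ⟨fun w => ∑ i : t, f i w • s i w, fun w => ?_, ?_⟩
  · change ∑ i : t, f i w • s i w ∈ C w
    rw [← finsum_eq_sum_of_fintype]
    refine (hC w).finsum_mem (fun i => f.nonneg i w) (f.sum_eq_one (Set.mem_univ w))
      fun i hi => hsC i w (hf i (subset_tsupport _ hi))
  · have hsum : ∀ (A : Finset t) (q : PulledTangent n y),
        ContinuousAt (familyMap J m y fun w => ∑ i ∈ A, f i w • s i w) q := by
      classical
      intro A q
      induction A using Finset.induction_on with
      | empty =>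
        exact (continuousAt_tangentPoint_zero (hm.comp hπ).continuousAt).prodMk continuousAt_const
      | insert i A hi ih =>
        have h3 := (continuousAt_tangentPoint_smul_add (hterm i q).fst ih.fst
          (continuousAt_const (y := (1 : ℝ)))).prodMk ((hterm i q).snd.add ih.snd)
        refine h3.congr (.of_forall fun q => ?_)
        simp only [familyMap, Finset.sum_insert hi, one_smul]
        rfl
    exact continuous_iff_continuousAt.2 fun q => hsum Finset.univ q

end
end GeneralPosition
end

/-! ### Local right inverses of the difference of derivatives. -/

noncomputable section

namespace GeneralPosition
open Bundle

section

variable {E : Type*} [NormedAddCommGroup E] [NormedSpace ℝ E]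
  {H : Type*} [TopologicalSpace H] (J : ModelWithCorners ℝ E H)
  {M : Type*} [TopologicalSpace M] [ChartedSpace H M] [IsManifold J 1 M]

/-- The tangent vector at `x` with given coordinates in the standard trivialization around `x₀`. -/
def tangentOfCoordinates (x₀ x : M) : E →L[ℝ] E :=
  (trivializationAt E (TangentSpace J) x₀).symmL ℝ x

variable {J}

theorem continuousAt_tangentOfCoordinates {Z : Type*} [TopologicalSpace Z] {c : Z → M} {b : Z → E}
    {z₀ : Z} {x₀ : M} (hc : ContinuousAt c z₀) (hb : ContinuousAt b z₀)
    (hx : c z₀ ∈ (chartAt H x₀).source) :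
    ContinuousAt (fun z => tangentPoint J (c z) (tangentOfCoordinates J x₀ (c z) (b z))) z₀ := by
  let e := trivializationAt E (TangentSpace J : M → Type _) x₀
  have hbase : e.baseSet = (chartAt H x₀).source := TangentBundle.trivializationAt_baseSet x₀
  have h1 : ContinuousAt (fun z => e.toOpenPartialHomeomorph.symm (c z, b z)) z₀ := by
    refine ContinuousAt.comp (f := fun z => (c z, b z))
      (g := e.toOpenPartialHomeomorph.symm) ?_ (hc.prodMk hb)
    refine e.toOpenPartialHomeomorph.symm.continuousAt ?_
    change (c z₀, b z₀) ∈ e.target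
    rw [e.target_eq, hbase]
    exact ⟨hx, trivial⟩
  refine h1.congr ?_
  filter_upwards [hc.preimage_mem_nhds ((chartAt H x₀).open_source.mem_nhds hx)] with z hz
  have hz : c z ∈ e.baseSet := hbase ▸ hz
  rw [← e.mk_symm hz]
  exact congrArg (TotalSpace.mk (c z)) (e.symmL_apply (R := ℝ) hz (b z)).symm

theorem hasMFDerivAt_extChartAt_tangentCoordinates {x₀ x : M} (hx : x ∈ (chartAt H x₀).source) :
    HasMFDerivAt J 𝓘(ℝ, E) (extChartAt J x₀) x
      (tangentCoordinates J x₀ x : E →L[ℝ] E) := by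
  have h : MDifferentiableAt J 𝓘(ℝ, E) (extChartAt J x₀) x := mdifferentiableAt_extChartAt hx
  exact h.hasMFDerivAt.congr_mfderiv
    (TangentBundle.continuousLinearMapAt_trivializationAt hx).symm

theorem hasMFDerivAt_extChartAt_symm_tangentOfCoordinates [J.Boundaryless] {x₀ x : M}
    (hx : x ∈ (chartAt H x₀).source) :
    HasMFDerivAt 𝓘(ℝ, E) J (extChartAt J x₀).symm (extChartAt J x₀ x)
      (tangentOfCoordinates J x₀ x : E →L[ℝ] E) := by
  have h : MDifferentiableWithinAt 𝓘(ℝ, E) J (extChartAt J x₀).symm (Set.range J)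
      (extChartAt J x₀ x) := mdifferentiableWithinAt_extChartAt_symm
    ((extChartAt J x₀).map_source (by rwa [extChartAt_source]))
  have h2 : (trivializationAt E (TangentSpace J) x₀).symmL ℝ x =
      mfderivWithin 𝓘(ℝ, E) J (extChartAt J x₀).symm (Set.range J) (extChartAt J x₀ x) :=
    TangentBundle.symmL_trivializationAt hx
  rw [J.range_eq_univ] at h h2
  have h3 := (mdifferentiableWithinAt_univ.1 h).hasMFDerivAt
  rw [mfderivWithin_univ] at h2
  exact h3.congr_mfderiv h2.symm

theorem tangentOfCoordinates_tangentCoordinates {x₀ x : M} (hx : x ∈ (chartAt H x₀).source)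
    (v : E) : tangentOfCoordinates J x₀ x (tangentCoordinates J x₀ x v) = v :=
  (trivializationAt E (TangentSpace J) x₀).symmL_continuousLinearMapAt (R := ℝ)
    (by rwa [TangentBundle.trivializationAt_baseSet]) v

theorem tangentCoordinates_tangentOfCoordinates {x₀ x : M} (hx : x ∈ (chartAt H x₀).source)
    (v : E) : tangentCoordinates J x₀ x (tangentOfCoordinates J x₀ x v) = v :=
  (trivializationAt E (TangentSpace J) x₀).continuousLinearMapAt_symmL (R := ℝ)
    (by rwa [TangentBundle.trivializationAt_baseSet]) v

theorem injective_tangentCoordinates {x₀ x : M} (hx : x ∈ (chartAt H x₀).source) :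
    Function.Injective (tangentCoordinates J x₀ x) :=
  Function.LeftInverse.injective (tangentOfCoordinates_tangentCoordinates hx)

end

section

variable {E : Type*} [NormedAddCommGroup E] [NormedSpace ℝ E] [FiniteDimensional ℝ E]
  {H : Type*} [TopologicalSpace H] {J : ModelWithCorners ℝ E H} [J.Boundaryless]
  {M : Type*} [TopologicalSpace M] [ChartedSpace H M] [IsManifold J ∞ M]
  {n : ℕ} {N : Type*} [TopologicalSpace N] [ChartedSpace (EuclideanSpace ℝ (Fin n)) N]
  [IsManifold (𝓡 n) ∞ N]
  {T : Type*} [NormedAddCommGroup T] [NormedSpace ℝ T] [FiniteDimensional ℝ T]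
  {W : Type*} [TopologicalSpace W]

/-- The difference of the derivatives of two transverse maps has local continuous right
inverses. -/
theorem exists_local_right_inverse {D : Set (M × T)} (hD : IsOpen D) {G₁ G₂ : M × T → N}
    (h₁ : ContMDiffOn (J.prod 𝓘(ℝ, T)) (𝓡 n) ∞ G₁ D)
    (h₂ : ContMDiffOn (J.prod 𝓘(ℝ, T)) (𝓡 n) ∞ G₂ D)
    {i : W → M × T} (hi : Continuous i) (hiD : ∀ w, i w ∈ coincidenceSet D G₁ G₂)
    {y : W → N} (hy : ∀ w, G₁ (i w) = y w) (w₀ : W)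
    (hR : TransverseAt (J.prod 𝓘(ℝ, T)) n G₁ G₂ (i w₀)) :
    ∃ (U : Set W) (s : W → EuclideanSpace ℝ (Fin n) →L[ℝ] E × T), IsOpen U ∧ w₀ ∈ U ∧
      (∀ w ∈ U, ∀ u, diffDeriv (J.prod 𝓘(ℝ, T)) n G₁ G₂ (i w) (s w u) = u) ∧
      ∀ q : PulledTangent n y, q.1.1 ∈ U →
        ContinuousAt (familyMap J (fun w => (i w).1) y s) q := by
  obtain rfl : (fun w => G₁ (i w)) = y := funext hy
  let m₀ := (i w₀).1
  let y₀ := G₁ (i w₀)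
  let φ := openChart J m₀
  let g : E × T → EuclideanSpace ℝ (Fin n) := fun p => chartDiff n y₀ G₁ G₂ (φ.symm p.1, p.2)
  let D' := D ∩ G₁ ⁻¹' (chartAt (EuclideanSpace ℝ (Fin n)) y₀).source ∩
      (D ∩ G₂ ⁻¹' (chartAt (EuclideanSpace ℝ (Fin n)) y₀).source)
  have hD' : IsOpen D' := isOpen_chartDomain hD y₀ h₁.continuousOn h₂.continuousOn
  have hΓ : ContMDiffOn 𝓘(ℝ, E × T) (J.prod 𝓘(ℝ, T)) ∞ (fun p : E × T => (φ.symm p.1, p.2))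
      (φ.target ×ˢ Set.univ) :=
    ((contMDiffOn_openChart_symm m₀).comp contDiff_fst.contMDiff.contMDiffOn
      fun p hp => hp.1).prodMk contDiff_snd.contMDiff.contMDiffOn
  let V : Set (E × T) := (φ.target ×ˢ Set.univ) ∩ (fun p : E × T => (φ.symm p.1, p.2)) ⁻¹' D'
  have hV : IsOpen V :=
    hΓ.continuousOn.isOpen_inter_preimage (φ.open_target.prod isOpen_univ) hD'
  have hg : ContDiffOn ℝ ∞ g V := by
    rw [← contMDiffOn_iff_contDiffOn]
    exact (contMDiffOn_chartDiff y₀ h₁ h₂).comp (hΓ.mono Set.inter_subset_left) fun p hp => hp.2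
  let U₀ : Set W := i ⁻¹' (Prod.fst ⁻¹' (chartAt H m₀).source ∩ D')
  have hiD' : ∀ w, G₁ (i w) ∈ (chartAt (EuclideanSpace ℝ (Fin n)) y₀).source → i w ∈ D' :=
    fun w hw => ⟨⟨(hiD w).1, hw⟩, ⟨(hiD w).1, by
      rw [Set.mem_preimage, ← (hiD w).2]
      exact hw⟩⟩
  let κ : W → E × T := fun w => (φ (i w).1, (i w).2)
  have hκV : ∀ w, i w ∈ Prod.fst ⁻¹' (chartAt H m₀).source ∩ D' → κ w ∈ V := by
    intro w hw
    refine ⟨⟨φ.map_source hw.1, trivial⟩, ?_⟩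
    change (φ.symm (φ (i w).1), (i w).2) ∈ D'
    rw [φ.left_inv hw.1]
    exact hw.2
  have hw₀ : i w₀ ∈ Prod.fst ⁻¹' (chartAt H m₀).source ∩ D' :=
    ⟨mem_chart_source H m₀, hiD' w₀ (mem_chart_source _ _)⟩
  have hκc : ∀ w, i w ∈ Prod.fst ⁻¹' (chartAt H m₀).source ∩ D' → ContinuousAt κ w := fun w hw =>
    ((φ.continuousAt hw.1).comp (f := fun w => (i w).1) (by fun_prop)).prodMk (by fun_prop)
  let A : W → E × T →L[ℝ] EuclideanSpace ℝ (Fin n) := fun w => fderiv ℝ g (κ w)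
  have hAc : ∀ w, i w ∈ Prod.fst ⁻¹' (chartAt H m₀).source ∩ D' → ContinuousAt A w := fun w hw =>
    ContinuousAt.comp (f := κ) (((hg.contDiffAt (hV.mem_nhds (hκV w hw))).fderiv_right
      (m := 0) (by simp)).continuousAt) (hκc w hw)
  -- `R w` converts coordinates in the fixed chart around `m₀` to the model of the tangent space at
  -- `i w`. Thus `A w` below is the difference of derivatives expressed in fixed charts, where
  -- continuity in w makes sense.
  let R : W → E × T →L[ℝ] E × T := fun w =>
    (tangentOfCoordinates J m₀ (i w).1).prodMap (ContinuousLinearMap.id ℝ T)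
  have hA : ∀ w, i w ∈ Prod.fst ⁻¹' (chartAt H m₀).source ∩ D' → ∀ v, A w v =
      tangentCoordinates (𝓡 n) y₀ (G₁ (i w))
        (diffDeriv (J.prod 𝓘(ℝ, T)) n G₁ G₂ (i w) (R w v)) := by
    intro w hw v
    have hd₁ := (h₁.contMDiffAt (hD.mem_nhds (hiD w).1)).mdifferentiableAt (n := ∞) (by simp)
    have hd₂ := (h₂.contMDiffAt (hD.mem_nhds (hiD w).1)).mdifferentiableAt (n := ∞) (by simp)
    have e1 : HasMFDerivAt 𝓘(ℝ, E × T) J (fun p : E × T => φ.symm p.1) (κ w)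
        ((tangentOfCoordinates J m₀ (i w).1).comp (ContinuousLinearMap.fst ℝ E T)) :=
      HasMFDerivAt.comp (g := φ.symm) (f := fun p : E × T => p.1) (κ w)
        (hasMFDerivAt_extChartAt_symm_tangentOfCoordinates hw.1) hasFDerivAt_fst.hasMFDerivAt
    have e2 : HasMFDerivAt 𝓘(ℝ, E × T) (J.prod 𝓘(ℝ, T)) (fun p : E × T => (φ.symm p.1, p.2)) (κ w)
        (R w) := e1.prodMk hasFDerivAt_snd.hasMFDerivAt
    have e3 : (φ.symm (κ w).1, (κ w).2) = i w := Prod.ext (φ.left_inv hw.1) rfl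
    let L : E × T →L[ℝ] EuclideanSpace ℝ (Fin n) :=
      (tangentCoordinates (𝓡 n) y₀ (G₁ (i w))).comp (diffDeriv (J.prod 𝓘(ℝ, T)) n G₁ G₂ (i w))
    have e4 : HasMFDerivAt (J.prod 𝓘(ℝ, T)) 𝓘(ℝ, EuclideanSpace ℝ (Fin n)) (chartDiff n y₀ G₁ G₂)
        (i w) L := by
      have h := hasMFDerivAt_chartDiff (y₀ := y₀) (hiD w).2 hw.2.1.2 hd₁ hd₂
      rw [(hasMFDerivAt_extChartAt_tangentCoordinates hw.2.1.2).mfderiv] at h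
      exact h
    have e4' : HasMFDerivAt (J.prod 𝓘(ℝ, T)) 𝓘(ℝ, EuclideanSpace ℝ (Fin n)) (chartDiff n y₀ G₁ G₂)
        (φ.symm (κ w).1, (κ w).2) L := by
      rw [e3]
      exact e4
    have e5 : HasMFDerivAt 𝓘(ℝ, E × T) 𝓘(ℝ, EuclideanSpace ℝ (Fin n)) g (κ w) (L.comp (R w)) :=
      HasMFDerivAt.comp (I' := J.prod 𝓘(ℝ, T)) (g := chartDiff n y₀ G₁ G₂)
        (f := fun p : E × T => (φ.symm p.1, p.2)) (κ w) e4' e2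
    have e6 : HasFDerivAt g (L.comp (R w)) (κ w) := e5.hasFDerivAt
    exact DFunLike.congr_fun e6.fderiv v
  have hA₀ : Function.Surjective (A w₀) := by
    intro z
    obtain ⟨v, hv⟩ := hR (hiD w₀).2 (tangentOfCoordinates (𝓡 n) y₀ (G₁ (i w₀)) z)
    refine ⟨(tangentCoordinates J m₀ (i w₀).1 v.1, v.2), ?_⟩
    have hRv : R w₀ (tangentCoordinates J m₀ (i w₀).1 v.1, v.2) = v :=
      Prod.ext (tangentOfCoordinates_tangentCoordinates hw₀.1 v.1) rfl
    rw [hA w₀ hw₀, hRv, hv, tangentCoordinates_tangentOfCoordinates hw₀.2.1.2]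
  -- A right inverse B of A at `w₀` is corrected nearby: A ∘ B is the identity at `w₀`, hence
  -- invertible close to it, and B ∘ (A ∘ B)⁻¹ is a right inverse depending continuously on w.
  obtain ⟨B, hB⟩ := LinearMap.exists_rightInverse_of_surjective
    (A w₀ : E × T →ₗ[ℝ] EuclideanSpace ℝ (Fin n)) (LinearMap.range_eq_top.2 hA₀)
  let B' : EuclideanSpace ℝ (Fin n) →L[ℝ] E × T := LinearMap.toContinuousLinearMap B
  let C : W → EuclideanSpace ℝ (Fin n) →L[ℝ] EuclideanSpace ℝ (Fin n) := fun w => (A w).comp B'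
  have hC₀ : (C w₀).IsInvertible := by
    refine ⟨ContinuousLinearEquiv.refl ℝ _, ?_⟩
    ext1 v
    exact (LinearMap.congr_fun hB v).symm
  have hCc : ∀ w, i w ∈ Prod.fst ⁻¹' (chartAt H m₀).source ∩ D' → ContinuousAt C w := fun w hw =>
    (hAc w hw).clm_comp continuousAt_const
  have hU : ∃ U : Set W, IsOpen U ∧ w₀ ∈ U ∧ ∀ w ∈ U,
      i w ∈ Prod.fst ⁻¹' (chartAt H m₀).source ∩ D' ∧ (C w).IsInvertible := by
    have h3 : ∀ᶠ w in 𝓝 w₀, i w ∈ Prod.fst ⁻¹' (chartAt H m₀).source ∩ D' :=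
      hi.continuousAt.preimage_mem_nhds
        ((((chartAt H m₀).open_source.preimage continuous_fst).inter hD').mem_nhds hw₀)
    have h4 : ∀ᶠ w in 𝓝 w₀, (C w).IsInvertible :=
      (hCc w₀ hw₀).preimage_mem_nhds (ContinuousLinearEquiv.isOpen.mem_nhds hC₀)
    obtain ⟨U, hU, hUo, hwU⟩ := eventually_nhds_iff.1 (h3.and h4)
    exact ⟨U, hUo, hwU, hU⟩
  obtain ⟨U, hUo, hwU, hU⟩ := hU
  let Q : W → EuclideanSpace ℝ (Fin n) →L[ℝ] E × T := fun w => B'.comp (C w).inverse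
  have hQc : ∀ w ∈ U, ContinuousAt Q w := fun w hw =>
    continuousAt_const.clm_comp (ContinuousAt.comp (f := C)
      ((hU w hw).2.contDiffAt_map_inverse (n := 0)).continuousAt (hCc w (hU w hw).1))
  refine ⟨U, fun w => (R w).comp ((Q w).comp (tangentCoordinates (𝓡 n) y₀ (G₁ (i w)))), hUo, hwU,
    fun w hw u => ?_, fun q hq => ?_⟩
  · apply injective_tangentCoordinates (J := 𝓡 n) (hU w hw).1.2.1.2
    rw [ContinuousLinearMap.comp_apply, ← hA w (hU w hw).1]
    exact (hU w hw).2.self_apply_inverse _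
  · have hq' := hU q.1.1 hq
    have hc : ContinuousAt (fun q : PulledTangent n fun w => G₁ (i w) => q.1.1) q := by fun_prop
    have h5 : ContinuousAt (fun q : PulledTangent n fun w => G₁ (i w) =>
        tangentCoordinates (𝓡 n) y₀ (G₁ (i q.1.1)) q.1.2.snd) q := by
      have h6 : q.1.2 ∈ (trivializationAt (EuclideanSpace ℝ (Fin n))
          (TangentSpace (𝓡 n) : N → Type) y₀).source := by
        rw [Trivialization.mem_source, TangentBundle.trivializationAt_baseSet, q.2]
        exact hq'.1.2.1.2
      have h7 : ContinuousAt (fun q : PulledTangent n fun w => G₁ (i w) =>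
          (trivializationAt (EuclideanSpace ℝ (Fin n)) (TangentSpace (𝓡 n) : N → Type) y₀
            q.1.2).2) q :=
        (ContinuousAt.comp (f := fun q : PulledTangent n fun w => G₁ (i w) => q.1.2)
          ((trivializationAt (EuclideanSpace ℝ (Fin n)) (TangentSpace (𝓡 n) : N → Type)
            y₀).toOpenPartialHomeomorph.continuousAt h6) (by fun_prop)).snd
      refine h7.congr ?_
      filter_upwards [hc.preimage_mem_nhds (hUo.mem_nhds hq)] with q₁ hq₁
      have h8 : q₁.1.2 = tangentPoint (𝓡 n) (G₁ (i q₁.1.1)) q₁.1.2.snd := by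
        obtain ⟨⟨w, ⟨z, u⟩⟩, hz⟩ := q₁
        obtain rfl : z = G₁ (i w) := hz
        rfl
      rw [h8]
      exact trivialization_tangentPoint _ _ (by
        rw [TangentBundle.trivializationAt_baseSet]
        exact (hU _ hq₁).1.2.1.2) _
    have h9 : ContinuousAt (fun q : PulledTangent n fun w => G₁ (i w) =>
        Q q.1.1 (tangentCoordinates (𝓡 n) y₀ (G₁ (i q.1.1)) q.1.2.snd)) q :=
      (ContinuousAt.comp (f := fun q : PulledTangent n fun w => G₁ (i w) => q.1.1)
        (hQc _ hq) hc).clm_apply h5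
    exact (continuousAt_tangentOfCoordinates (c := fun q : PulledTangent n fun w => G₁ (i w) =>
      (i q.1.1).1) (by fun_prop) h9.fst hq'.1.1).prodMk h9.snd

end
end GeneralPosition
end

/-! ### Stable isomorphisms from families of complements. -/

noncomputable section

namespace GeneralPosition
open Bundle StableCobordism

section

variable {E' : Type*} [NormedAddCommGroup E'] [NormedSpace ℝ E'] [FiniteDimensional ℝ E']
  {H' : Type*} [TopologicalSpace H'] {I' : ModelWithCorners ℝ E' H'}
  {W : Type*} [TopologicalSpace W] [ChartedSpace H' W] [IsManifold I' ∞ W]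
  {E : Type*} [NormedAddCommGroup E] [NormedSpace ℝ E] [FiniteDimensional ℝ E]
  {H : Type*} [TopologicalSpace H] {J : ModelWithCorners ℝ E H}
  {M : Type*} [TopologicalSpace M] [ChartedSpace H M] [IsManifold J ∞ M]
  {n : ℕ} {N : Type*} [TopologicalSpace N] [ChartedSpace (EuclideanSpace ℝ (Fin n)) N]
  [IsManifold (𝓡 n) ∞ N]
  {X : Type*} [TopologicalSpace X]
  {T : Type*} [NormedAddCommGroup T] [NormedSpace ℝ T] [FiniteDimensional ℝ T]
  (S : Type*) [NormedAddCommGroup S] [NormedSpace ℝ S] [FiniteDimensional ℝ S]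
  {Q : Type*} [NormedAddCommGroup Q] [NormedSpace ℝ Q] [FiniteDimensional ℝ Q]

variable (I' J) in
/-- The derivative of a map to `M × T` as a map of the model spaces. -/
def pairModelDeriv (b : W → M) (τ : W → T) (w : W) : E' →L[ℝ] E × T :=
  (mfderiv I' J b w : E' →L[ℝ] E).prod (mfderiv I' 𝓘(ℝ, T) τ w : E' →L[ℝ] T)

/-- The tangent vector of `N` in an element of the source of a stable isomorphism. -/
def normalPart (f : C(W, X)) (e : C(X, N))
    (z : TotalSpace (E' × (EuclideanSpace ℝ (Fin n) × S))
      ((TangentSpace I' : W → Type _) ×ᵇ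
        (Pull f (Pull e (TangentSpace (𝓡 n) : N → Type)) ×ᵇ Trivial W S))) :
    PulledTangent n fun w => e (f w) :=
  ⟨(z.proj, ⟨e (f z.proj), z.snd.2.1⟩), rfl⟩

variable [TopologicalSpace (TotalSpace S (Trivial W S))]

theorem continuous_normalPart (f : C(W, X)) (e : C(X, N)) :
    Continuous (normalPart (E' := E') (H' := H') (I' := I') (n := n) S f e) := by
  have h1 := (FiberBundle.Prod.isInducing_diag E' (TangentSpace I' : W → Type _)
    (EuclideanSpace ℝ (Fin n) × S)
    (Pull f (Pull e (TangentSpace (𝓡 n) : N → Type)) ×ᵇ Trivial W S)).continuous.snd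
  have h2 := (FiberBundle.Prod.isInducing_diag (EuclideanSpace ℝ (Fin n))
    (Pull f (Pull e (TangentSpace (𝓡 n) : N → Type))) S (Trivial W S)).continuous.fst
  have h3 := Pullback.continuous_lift (EuclideanSpace ℝ (Fin n))
    (Pull e (TangentSpace (𝓡 n) : N → Type)) f
  have h4 := Pullback.continuous_lift (EuclideanSpace ℝ (Fin n))
    (TangentSpace (𝓡 n) : N → Type) e
  have h0 := (FiberBundle.continuous_proj E' (TangentSpace I' : W → Type _)).comp
    (FiberBundle.Prod.isInducing_diag E' (TangentSpace I' : W → Type _)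
    (EuclideanSpace ℝ (Fin n) × S)
    (Pull f (Pull e (TangentSpace (𝓡 n) : N → Type)) ×ᵇ Trivial W S)).continuous.fst
  exact (h0.prodMk (h4.comp (h3.comp (h2.comp h1)))).subtype_mk _

/-- A family of complements defines a stable isomorphism. -/
theorem exists_bundleIso [TopologicalSpace (TotalSpace Q (Trivial W Q))]
    (hQ : Topology.IsInducing (TotalSpace.toProd W Q)) (f : C(W, X)) (e : C(X, N)) (pr : C(X, M)) {τ : W → T}
    (hb : ContMDiff I' J ∞ fun w => pr (f w)) (hτ : ContMDiff I' 𝓘(ℝ, T) ∞ τ)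
    {s : W → EuclideanSpace ℝ (Fin n) →L[ℝ] E × T}
    (hs : Continuous (familyMap J (fun w => pr (f w)) (fun w => e (f w)) s))
    (κ : T ≃L[ℝ] Q) [Subsingleton S]
    (hbij : ∀ w, Function.Bijective fun p : E' × EuclideanSpace ℝ (Fin n) =>
      pairModelDeriv I' J (fun w => pr (f w)) τ w p.1 + s w p.2) :
    ∃ φ : BundleIso (E' × (EuclideanSpace ℝ (Fin n) × S))
      ((TangentSpace I' : W → Type _) ×ᵇ
        (Pull f (Pull e (TangentSpace (𝓡 n) : N → Type)) ×ᵇ Trivial W S))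
      (E × Q) (Pull f (Pull pr (TangentSpace J : M → Type _)) ×ᵇ Trivial W Q),
      ∀ (w : W) (p : E' × (EuclideanSpace ℝ (Fin n) × S)),
        (show E × Q from φ.toEquiv w p) =
          ((pairModelDeriv I' J (fun w => pr (f w)) τ w p.1 + s w p.2.1).1,
            κ (pairModelDeriv I' J (fun w => pr (f w)) τ w p.1 + s w p.2.1).2) := by
  let b : W → M := fun w => pr (f w)
  let A : W → E' × (EuclideanSpace ℝ (Fin n) × S) →L[ℝ] E × Q := fun w =>
    ((ContinuousLinearMap.id ℝ E).prodMap (κ : T →L[ℝ] Q)).comp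
      ((pairModelDeriv I' J b τ w).comp (ContinuousLinearMap.fst ℝ _ _) +
        (s w).comp ((ContinuousLinearMap.fst ℝ _ _).comp (ContinuousLinearMap.snd ℝ _ _)))
  have hA : ∀ w, Function.Bijective (A w) := by
    intro w
    constructor
    · rintro ⟨v, u, z⟩ ⟨v', u', z'⟩ h
      have h1 := congrArg Prod.fst h
      have h2 := κ.injective (congrArg Prod.snd h)
      have h3 := (hbij w).1 (a₁ := (v, u)) (a₂ := (v', u')) (Prod.ext h1 h2)
      rw [Prod.mk.injEq] at h3
      rw [h3.1, h3.2, Subsingleton.elim z z']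
    · rintro ⟨a, q⟩
      obtain ⟨p, hp⟩ := (hbij w).2 (a, κ.symm q)
      refine ⟨(p.1, p.2, 0), ?_⟩
      have h1 := congrArg Prod.fst hp
      have h2 := congrArg Prod.snd hp
      exact Prod.ext h1 ((congrArg κ h2).trans (κ.apply_symm_apply q))
  have : CompleteSpace E' := FiniteDimensional.complete ℝ E'
  have : CompleteSpace E := FiniteDimensional.complete ℝ E
  have : CompleteSpace S := FiniteDimensional.complete ℝ S
  have : CompleteSpace Q := FiniteDimensional.complete ℝ Q
  let B : ∀ w, (E' × (EuclideanSpace ℝ (Fin n) × S)) ≃L[ℝ] E × Q := fun w =>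
    ContinuousLinearEquiv.ofBijective (A w) (LinearMap.ker_eq_bot.2 (hA w).1)
      (LinearMap.range_eq_top.2 (hA w).2)
  -- On tangent vectors of W continuity comes from the tangent maps of the base map and of τ, on
  -- tangent vectors of N from the assumption on `s`; the sum is formed in the tangent bundle of M.
  have hcont : Continuous fun z : TotalSpace (E' × (EuclideanSpace ℝ (Fin n) × S))
      ((TangentSpace I' : W → Type _) ×ᵇ
        (Pull f (Pull e (TangentSpace (𝓡 n) : N → Type)) ×ᵇ Trivial W S)) =>
      (⟨z.proj, B z.proj z.snd⟩ :
        TotalSpace (E × Q) (Pull f (Pull pr (TangentSpace J : M → Type _)) ×ᵇ Trivial W Q)) := by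
    have h1 := (FiberBundle.Prod.isInducing_diag E' (TangentSpace I' : W → Type _)
      (EuclideanSpace ℝ (Fin n) × S)
      (Pull f (Pull e (TangentSpace (𝓡 n) : N → Type)) ×ᵇ Trivial W S)).continuous.fst
    have h0 := (FiberBundle.continuous_proj E' (TangentSpace I' : W → Type _)).comp h1
    have h2 := hs.comp (continuous_normalPart (I' := I') (n := n) S f e)
    have h3 : Continuous (tangentMap I' J b) := hb.continuous_tangentMap (by simp)
    have h4 : Continuous (tangentMap I' 𝓘(ℝ, T) τ) := hτ.continuous_tangentMap (by simp)
    have h5 : Continuous fun p : TangentBundle 𝓘(ℝ, T) T => (p.2 : T) :=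
      (contMDiff_snd_tangentBundle_modelSpace T 𝓘(ℝ, T) (n := 0)).continuous
    rw [(FiberBundle.Prod.isInducing_diag E (Pull f (Pull pr (TangentSpace J : M → Type _))) Q
      (Trivial W Q)).continuous_iff]
    refine Continuous.prodMk ?_ ?_
    · rw [(inducing_pullbackTotalSpaceEmbedding E (Pull pr (TangentSpace J : M → Type _))
        f).continuous_iff]
      refine h0.prodMk ?_
      rw [(inducing_pullbackTotalSpaceEmbedding E (TangentSpace J : M → Type _) pr).continuous_iff]
      refine (f.continuous.comp h0).prodMk (continuous_iff_continuousAt.2 fun z => ?_)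
      refine (continuousAt_tangentPoint_smul_add (h3.comp h1).continuousAt h2.fst.continuousAt
        (continuousAt_const (y := (1 : ℝ)))).congr (.of_forall fun z => ?_)
      exact congrArg (tangentPoint J (pr (f z.proj)))
        (congrArg (· + _) (one_smul ℝ (pairModelDeriv I' J b τ z.proj z.snd.1).1))
    · rw [hQ.continuous_iff]
      exact h0.prodMk (κ.continuous.comp ((h5.comp (h4.comp h1)).add h2.snd))
  exact ⟨⟨B, hcont⟩, fun w p => rfl⟩

end
end GeneralPosition
end

/-! ### Tangent spaces of coincidence sets and their complements. -/

noncomputable section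

namespace GeneralPosition
open Bundle

section

variable {E : Type*} [NormedAddCommGroup E] [NormedSpace ℝ E]
  {H : Type*} [TopologicalSpace H] {J : ModelWithCorners ℝ E H}
  {M : Type*} [TopologicalSpace M] [ChartedSpace H M]
  {n : ℕ} {N : Type*} [TopologicalSpace N] [ChartedSpace (EuclideanSpace ℝ (Fin n)) N]
  {T : Type*} [NormedAddCommGroup T] [NormedSpace ℝ T]
  {E' : Type*} [NormedAddCommGroup E'] [NormedSpace ℝ E']
  {H' : Type*} [TopologicalSpace H'] {I' : ModelWithCorners ℝ E' H'}
  {W : Type*} [TopologicalSpace W] [ChartedSpace H' W]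

/-- Applying D to A v + R u = 0 gives u = 0, and then v = 0 as A is injective. The dimensions do the
rest. -/
theorem bijective_add_of_complement {V F : Type*} [NormedAddCommGroup V] [NormedSpace ℝ V]
    [FiniteDimensional ℝ V] [FiniteDimensional ℝ E'] [NormedAddCommGroup F] [NormedSpace ℝ F]
    [FiniteDimensional ℝ F] {A : E' →L[ℝ] V} {D : V →L[ℝ] F} {R : F →L[ℝ] V}
    (hA : Function.Injective A) (hDA : ∀ v, D (A v) = 0) (hR : ∀ u, D (R u) = u)
    (hd : Module.finrank ℝ V = Module.finrank ℝ F + Module.finrank ℝ E') :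
    Function.Bijective fun p : E' × F => A p.1 + R p.2 := by
  let B : E' × F →ₗ[ℝ] V := (A : E' →ₗ[ℝ] V).coprod (R : F →ₗ[ℝ] V)
  have hB : Function.Injective B := by
    rw [injective_iff_map_eq_zero]
    rintro ⟨v, u⟩ h
    have h : A v + R u = 0 := h
    have hu : u = 0 := by
      have h1 := congrArg D h
      rwa [map_add, hDA, hR, map_zero, zero_add] at h1
    subst hu
    rw [map_zero, add_zero] at h
    rw [hA (h.trans (map_zero A).symm)]
    rfl
  exact ⟨hB, (LinearMap.injective_iff_surjective_of_finrank_eq_finrank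
    (by rw [Module.finrank_prod, hd, add_comm])).1 hB⟩

theorem hasMFDerivAt_pair {b : W → M} {τ : W → T} {w : W}
    (hb : MDifferentiableAt I' J b w) (hτ : MDifferentiableAt I' 𝓘(ℝ, T) τ w) :
    HasMFDerivAt I' (J.prod 𝓘(ℝ, T)) (fun w => (b w, τ w)) w (pairModelDeriv I' J b τ w) :=
  hb.hasMFDerivAt.prodMk hτ.hasMFDerivAt

/-- Differentiating the equality of the two maps along a family of coincidences shows that its
tangent vectors lie in the kernel of the difference of derivatives. -/
theorem diffDeriv_pairModelDeriv {G₁ G₂ : M × T → N} {b : W → M} {τ : W → T} {w : W}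
    (hb : MDifferentiableAt I' J b w) (hτ : MDifferentiableAt I' 𝓘(ℝ, T) τ w)
    (h₁ : MDifferentiableAt (J.prod 𝓘(ℝ, T)) (𝓡 n) G₁ (b w, τ w))
    (h₂ : MDifferentiableAt (J.prod 𝓘(ℝ, T)) (𝓡 n) G₂ (b w, τ w))
    (h : ∀ w, G₁ (b w, τ w) = G₂ (b w, τ w)) (v : E') :
    diffDeriv (J.prod 𝓘(ℝ, T)) n G₁ G₂ (b w, τ w) (pairModelDeriv I' J b τ w v) = 0 := by
  have e₁ := (HasMFDerivAt.comp (I' := J.prod 𝓘(ℝ, T)) w (g := G₁) (f := fun w => (b w, τ w))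
    h₁.hasMFDerivAt (hasMFDerivAt_pair hb hτ)).mfderiv
  have e₂ := (HasMFDerivAt.comp (I' := J.prod 𝓘(ℝ, T)) w (g := G₂) (f := fun w => (b w, τ w))
    h₂.hasMFDerivAt (hasMFDerivAt_pair hb hτ)).mfderiv
  have e₃ : G₁ ∘ (fun w => (b w, τ w)) = G₂ ∘ (fun w => (b w, τ w)) := funext h
  have e₄ : modelDeriv I' n (G₁ ∘ (fun w => (b w, τ w))) w =
    (modelDeriv (J.prod 𝓘(ℝ, T)) n G₁ (b w, τ w)).comp (pairModelDeriv I' J b τ w) := e₁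
  have e₅ : modelDeriv I' n (G₂ ∘ (fun w => (b w, τ w))) w =
    (modelDeriv (J.prod 𝓘(ℝ, T)) n G₂ (b w, τ w)).comp (pairModelDeriv I' J b τ w) := e₂
  rw [← e₃, e₄] at e₅
  have e₆ := DFunLike.congr_fun e₅ v
  exact sub_eq_zero.2 e₆.symm

end
end GeneralPosition

/-! ### The reference map to E₁₂, and lifts as families over the line. -/

namespace LinkMaps

section

variable {W : Type*} [TopologicalSpace W] {P₁ P₂ N : Type*} [TopologicalSpace P₁]
  [TopologicalSpace P₂] [TopologicalSpace N]

/-- The path which follows `Γ₁` from time `0` to time `t` and then `Γ₂` back to time `0`. -/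
def linkPath (Γ₁ Γ₂ : W × I → N) (t : W → I) (p : W × Set.Icc (-1 : ℝ) 1) : N :=
  if (p.2 : ℝ) ≤ 0 then Γ₁ (p.1, Set.projIcc 0 1 zero_le_one ((1 + p.2) * t p.1))
  else Γ₂ (p.1, Set.projIcc 0 1 zero_le_one ((1 - p.2) * t p.1))

theorem linkPath_left {Γ₁ Γ₂ : W × I → N} {t : W → I} (w : W) (s : Set.Icc (-1 : ℝ) 1) (τ : I)
    (hs : (s : ℝ) ≤ 0) (hτ : (τ : ℝ) = (1 + s) * t w) :
    linkPath Γ₁ Γ₂ t (w, s) = Γ₁ (w, τ) := by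
  rw [linkPath, if_pos hs, ← hτ, Set.projIcc_val]

theorem linkPath_right {Γ₁ Γ₂ : W × I → N} {t : W → I} (h : ∀ w, Γ₁ (w, t w) = Γ₂ (w, t w)) (w : W)
    (s : Set.Icc (-1 : ℝ) 1) (τ : I) (hs : 0 ≤ (s : ℝ)) (hτ : (τ : ℝ) = (1 - s) * t w) :
    linkPath Γ₁ Γ₂ t (w, s) = Γ₂ (w, τ) := by
  rcases hs.eq_or_lt with h0 | h0
  -- At s = 0 the definition takes the branch of `Γ₁`, which agrees with `Γ₂` at the coincidence.
  · have h1 : τ = t w := Subtype.ext (by rw [hτ, ← h0]; ring)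
    rw [linkPath_left w s τ h0.ge (by rw [hτ, ← h0]; ring), h1, h]
  · rw [linkPath, if_neg h0.not_ge, ← hτ, Set.projIcc_val]

theorem continuous_linkPath {Γ₁ Γ₂ : W × I → N} {t : W → I} (hΓ₁ : Continuous Γ₁)
    (hΓ₂ : Continuous Γ₂) (ht : Continuous t) (h : ∀ w, Γ₁ (w, t w) = Γ₂ (w, t w)) :
    Continuous (linkPath Γ₁ Γ₂ t) := by
  refine Continuous.if_le ?_ ?_ (by fun_prop) continuous_const fun p hp => ?_
  · fun_prop
  · fun_prop
  · rw [hp]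
    simp only [add_zero, sub_zero, one_mul, Set.projIcc_val, h]

/-- The reference map of a linking manifold. -/
def referenceMap {f₁ : P₁ → N} {f₂ : P₂ → N} (x : C(W, P₁ × P₂)) (t : C(W, I))
    (Γ₁ Γ₂ : C(W × I, N)) (h₁ : ∀ w, Γ₁ (w, 0) = f₁ (x w).1) (h₂ : ∀ w, Γ₂ (w, 0) = f₂ (x w).2)
    (h : ∀ w, Γ₁ (w, t w) = Γ₂ (w, t w)) : C(W, HoPullback f₁ f₂) where
  toFun w := ⟨((x w).1, (x w).2, ContinuousMap.curry
    ⟨linkPath Γ₁ Γ₂ t, continuous_linkPath Γ₁.continuous Γ₂.continuous t.continuous h⟩ w), by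
      refine ⟨?_, ?_⟩
      · exact (linkPath_left w _ 0 (by norm_num) (by norm_num)).trans (h₁ w)
      · exact (linkPath_right h w _ 0 (by norm_num) (by norm_num)).trans (h₂ w)⟩
  continuous_toFun := by
    refine Continuous.subtype_mk ?_ _
    exact (x.continuous.fst).prodMk (x.continuous.snd.prodMk (ContinuousMap.curry _).continuous)

end

section

variable {p₁ p₂ n : ℕ}
  {P₁ : Type*} [TopologicalSpace P₁] [ChartedSpace (EuclideanSpace ℝ (Fin p₁)) P₁]
  {P₂ : Type*} [TopologicalSpace P₂] [ChartedSpace (EuclideanSpace ℝ (Fin p₂)) P₂]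
  {N : Type*} [TopologicalSpace N] [ChartedSpace (EuclideanSpace ℝ (Fin n)) N]
  {f₁ : SmoothMap p₁ n P₁ N} {f₂ : SmoothMap p₂ n P₂ N}
open GeneralPosition

/-- The inclusion of the cylinder over the interval in the cylinder over the line. -/
def cylinderIncl (z : (P₁ × P₂) × I) : (P₁ × P₂) × ℝ := (z.1, (z.2 : ℝ))

theorem contMDiff_cylinderIncl : ContMDiff (((𝓡 p₁).prod (𝓡 p₂)).prod (𝓡∂ 1))
    (((𝓡 p₁).prod (𝓡 p₂)).prod 𝓘(ℝ)) ∞ (cylinderIncl (P₁ := P₁) (P₂ := P₂)) :=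
  contMDiff_fst.prodMk (contMDiff_coe_interval.comp contMDiff_snd)

/-- The vector `1` tangent to I is the one which the inclusion in ℝ sends to the unit vector. This
translates between tangent vectors over the interval and over the line. -/
theorem mfderiv_cylinderIncl (z : (P₁ × P₂) × I)
    (a : EuclideanSpace ℝ (Fin p₁) × EuclideanSpace ℝ (Fin p₂)) (r : ℝ) :
    (mfderiv (((𝓡 p₁).prod (𝓡 p₂)).prod (𝓡∂ 1)) (((𝓡 p₁).prod (𝓡 p₂)).prod 𝓘(ℝ))
      cylinderIncl z (a, r • (1 : TangentSpace (𝓡∂ 1) z.2)) :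
      (EuclideanSpace ℝ (Fin p₁) × EuclideanSpace ℝ (Fin p₂)) × ℝ) = (a, r) := by
  have h1 : HasMFDerivAt (((𝓡 p₁).prod (𝓡 p₂)).prod (𝓡∂ 1)) 𝓘(ℝ)
      (fun z : (P₁ × P₂) × I => (z.2 : ℝ)) z _ :=
    HasMFDerivAt.comp (I' := 𝓡∂ 1) z (g := fun s : I => (s : ℝ)) (f := Prod.snd)
      ((contMDiff_coe_interval z.2).mdifferentiableAt (by simp)).hasMFDerivAt
      (hasMFDerivAt_snd z)
  have h0 : HasMFDerivAt (((𝓡 p₁).prod (𝓡 p₂)).prod (𝓡∂ 1)) ((𝓡 p₁).prod (𝓡 p₂))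
      (Prod.fst : (P₁ × P₂) × I → P₁ × P₂) z _ := hasMFDerivAt_fst z
  have h2 := h0.prodMk h1
  have h3 : mfderiv (((𝓡 p₁).prod (𝓡 p₂)).prod (𝓡∂ 1)) (((𝓡 p₁).prod (𝓡 p₂)).prod 𝓘(ℝ))
      cylinderIncl z = _ := h2.mfderiv
  rw [h3]
  refine Prod.ext rfl ?_
  change mfderiv (𝓡∂ 1) 𝓘(ℝ) (fun s : I => (s : ℝ)) z.2 (r • 1) = r
  rw [map_smul]
  exact (congrArg (r • ·) (mfderiv_subtypeVal_Icc_one z.2)).trans (mul_one r)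

variable [T2Space P₁] [T2Space P₂]

variable (α : Lift f₁ f₂)

theorem Lift.pairMap_eq : α.pairMap = fun z =>
    (onFst α.extend.1 (cylinderIncl z), onSnd α.extend.2 (cylinderIncl z)) := by
  funext z
  exact Prod.ext (extendPath_coe _ _ _).symm (extendPath_coe _ _ _).symm

theorem Lift.contMDiffOn_extend_fst : ContMDiffOn (((𝓡 p₁).prod (𝓡 p₂)).prod 𝓘(ℝ)) (𝓡 n) ∞
    (onFst α.extend.1 : (P₁ × P₂) × ℝ → N) (Set.univ ×ˢ Set.Ioo (0 : ℝ) 1) :=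
  (contMDiffOn_extendPath α.F₁.contMDiff).comp (f := fun z : (P₁ × P₂) × ℝ => (z.1.1, z.2))
    ((contMDiff_fst.comp contMDiff_fst).prodMk contMDiff_snd).contMDiffOn
    fun _ hz => ⟨trivial, hz.2⟩

theorem Lift.contMDiffOn_extend_snd : ContMDiffOn (((𝓡 p₁).prod (𝓡 p₂)).prod 𝓘(ℝ)) (𝓡 n) ∞
    (onSnd α.extend.2 : (P₁ × P₂) × ℝ → N) (Set.univ ×ˢ Set.Ioo (0 : ℝ) 1) :=
  (contMDiffOn_extendPath α.F₂.contMDiff).comp (f := fun z : (P₁ × P₂) × ℝ => (z.1.2, z.2))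
    ((contMDiff_snd.comp contMDiff_fst).prodMk contMDiff_snd).contMDiffOn
    fun _ hz => ⟨trivial, hz.2⟩

theorem Lift.mdifferentiableAt_extend_fst {z : (P₁ × P₂) × ℝ} (hz : z.2 ∈ Set.Ioo (0 : ℝ) 1) :
    MDifferentiableAt (((𝓡 p₁).prod (𝓡 p₂)).prod 𝓘(ℝ)) (𝓡 n) (onFst α.extend.1) z :=
  (α.contMDiffOn_extend_fst.contMDiffAt
    ((isOpen_univ.prod isOpen_Ioo).mem_nhds ⟨trivial, hz⟩)).mdifferentiableAt (by simp)

theorem Lift.mdifferentiableAt_extend_snd {z : (P₁ × P₂) × ℝ} (hz : z.2 ∈ Set.Ioo (0 : ℝ) 1) :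
    MDifferentiableAt (((𝓡 p₁).prod (𝓡 p₂)).prod 𝓘(ℝ)) (𝓡 n) (onSnd α.extend.2) z :=
  (α.contMDiffOn_extend_snd.contMDiffAt
    ((isOpen_univ.prod isOpen_Ioo).mem_nhds ⟨trivial, hz⟩)).mdifferentiableAt (by simp)

/-- At interior times the extension over the line is smooth, and the lift is its composition with
the inclusion of the cylinder. The chain rule moves all computations to a manifold without boundary.
-/
theorem Lift.pairDeriv_apply {z : (P₁ × P₂) × I} (hz : (z.2 : ℝ) ∈ Set.Ioo (0 : ℝ) 1)
    (a : EuclideanSpace ℝ (Fin p₁) × EuclideanSpace ℝ (Fin p₂)) (r : ℝ) :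
    α.pairDeriv z (a, r • (1 : TangentSpace (𝓡∂ 1) z.2)) =
      (modelDeriv (((𝓡 p₁).prod (𝓡 p₂)).prod 𝓘(ℝ)) n (onFst α.extend.1) (cylinderIncl z) (a, r),
        modelDeriv (((𝓡 p₁).prod (𝓡 p₂)).prod 𝓘(ℝ)) n (onSnd α.extend.2) (cylinderIncl z)
          (a, r)) := by
  have hc : MDifferentiableAt (((𝓡 p₁).prod (𝓡 p₂)).prod (𝓡∂ 1))
    (((𝓡 p₁).prod (𝓡 p₂)).prod 𝓘(ℝ)) cylinderIncl z :=
    contMDiff_cylinderIncl.mdifferentiable (by simp) z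
  have h1 := HasMFDerivAt.comp (I' := ((𝓡 p₁).prod (𝓡 p₂)).prod 𝓘(ℝ)) z
    (g := onFst α.extend.1) (f := cylinderIncl) (α.mdifferentiableAt_extend_fst hz).hasMFDerivAt
    hc.hasMFDerivAt
  have h2 := HasMFDerivAt.comp (I' := ((𝓡 p₁).prod (𝓡 p₂)).prod 𝓘(ℝ)) z
    (g := onSnd α.extend.2) (f := cylinderIncl) (α.mdifferentiableAt_extend_snd hz).hasMFDerivAt
    hc.hasMFDerivAt
  have h3 := h1.prodMk h2
  have h4 := congrArg (fun v => (modelDeriv (((𝓡 p₁).prod (𝓡 p₂)).prod 𝓘(ℝ)) n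
    (onFst α.extend.1) (cylinderIncl z) v, modelDeriv (((𝓡 p₁).prod (𝓡 p₂)).prod 𝓘(ℝ)) n
      (onSnd α.extend.2) (cylinderIncl z) v)) (mfderiv_cylinderIncl z a r)
  refine Eq.trans ?_ h4
  have h5 : α.pairDeriv z = mfderiv (((𝓡 p₁).prod (𝓡 p₂)).prod (𝓡∂ 1)) ((𝓡 n).prod (𝓡 n))
    (fun z => (onFst α.extend.1 (cylinderIncl z), onSnd α.extend.2 (cylinderIncl z))) z := by
    rw [Lift.pairDeriv, α.pairMap_eq]
  exact (DFunLike.congr_fun (h5.trans h3.mfderiv) (a, r • (1 : TangentSpace (𝓡∂ 1) z.2)))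

theorem exists_eq_smul_one (t : I) (c : TangentSpace (𝓡∂ 1) t) :
    ∃ r : ℝ, c = r • (1 : TangentSpace (𝓡∂ 1) t) := by
  have h1 : (1 : TangentSpace (𝓡∂ 1) t) ≠ 0 := by
    intro h
    have h2 := mfderiv_subtypeVal_Icc_one t
    rw [h, map_zero] at h2
    exact zero_ne_one (α := ℝ) h2
  obtain ⟨r, hr⟩ := (finrank_eq_one_iff_of_nonzero' (1 : TangentSpace (𝓡∂ 1) t) h1).1
    (finrank_euclideanSpace_fin : Module.finrank ℝ (EuclideanSpace ℝ (Fin 1)) = 1) c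
  exact ⟨r, hr.symm⟩

/-- Coincidences of a lift occur at interior times. -/
theorem Lift.mem_Ioo_of_mem_coincidence (hf : IsLinkMap f₁ f₂) {z : (P₁ × P₂) × I}
    (hz : z ∈ α.coincidence) : (z.2 : ℝ) ∈ Set.Ioo (0 : ℝ) 1 := by
  have hz : α.F₁ (z.1.1, z.2) = α.F₂ (z.1.2, z.2) := hz
  refine ⟨lt_of_le_of_ne z.2.2.1 fun h => ?_, lt_of_le_of_ne z.2.2.2 fun h => ?_⟩
  · have h0 : z.2 = 0 := Subtype.ext h.symm
    rw [h0, α.start₁, α.start₂] at hz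
    exact Set.disjoint_left.1 hf ⟨z.1.1, rfl⟩ ⟨z.1.2, hz.symm⟩
  · have h1 : z.2 = 1 := Subtype.ext h
    rw [h1] at hz
    exact Set.disjoint_left.1 α.isLinkMap ⟨z.1.1, rfl⟩ ⟨z.1.2, hz.symm⟩

theorem Lift.onFst_extend_eq_iff (z : (P₁ × P₂) × I) :
    onFst α.extend.1 (cylinderIncl z) = onSnd α.extend.2 (cylinderIncl z) ↔ z ∈ α.coincidence := by
  have h1 := congrFun α.pairMap_eq z
  rw [Lift.coincidence, Set.mem_preimage, h1]
  rfl

/-- Transversality of a lift as transversality of two families of maps. -/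
theorem Lift.transverse_iff (hf : IsLinkMap f₁ f₂) : α.Transverse ↔
    ∀ z : (P₁ × P₂) × ℝ, z.2 ∈ Set.Ioo (0 : ℝ) 1 →
      FamilyTransverseAt (𝓡 p₁) (𝓡 p₂) n α.extend.1 α.extend.2 z := by
  constructor
  · intro h z hz hc u
    let z' : (P₁ × P₂) × I := (z.1, ⟨z.2, Set.Ioo_subset_Icc_self hz⟩)
    have hz' : z' ∈ α.coincidence := (α.onFst_extend_eq_iff z').1 hc
    -- Tested on (0, u), transversality to the diagonal gives 0 = DF₁(c) + d and u = DF₂(c) + d;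
    -- subtracting eliminates d.
    obtain ⟨c, d, hcd⟩ := h z' hz' (0, u)
    obtain ⟨r, hr⟩ := exists_eq_smul_one z'.2 c.2
    have hcr : c = (c.1, r • (1 : TangentSpace (𝓡∂ 1) z'.2)) := Prod.ext rfl hr
    replace hcd := hcd.trans (congrArg (· + (d, d)) ((congrArg (α.pairDeriv z') hcr).trans
      (α.pairDeriv_apply (z := z') hz c.1 r)))
    refine ⟨(c.1, r), ?_⟩
    have h1 := congrArg Prod.fst hcd
    have h2 := congrArg Prod.snd hcd
    change modelDeriv _ n _ z _ - modelDeriv _ n _ z _ = u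
    change 0 = modelDeriv _ n _ z _ + d at h1
    change u = modelDeriv _ n _ z _ + d at h2
    rw [h2]
    have h3 : d = -modelDeriv _ n _ z _ := (neg_eq_of_add_eq_zero_right h1.symm).symm
    rw [h3]
    abel
  · intro h z hz q
    have hz1 := α.mem_Ioo_of_mem_coincidence hf hz
    obtain ⟨v, hv⟩ := h (cylinderIncl z) hz1 ((α.onFst_extend_eq_iff z).2 hz) (q.2 - q.1)
    refine ⟨(v.1, v.2 • (1 : TangentSpace (𝓡∂ 1) z.2)), q.1 - modelDeriv
      (((𝓡 p₁).prod (𝓡 p₂)).prod 𝓘(ℝ)) n (onFst α.extend.1) (cylinderIncl z) v, ?_⟩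
    rw [α.pairDeriv_apply hz1]
    refine Prod.ext ?_ ?_
    · exact (add_sub_cancel _ _).symm
    · change q.2 = modelDeriv _ n _ _ v + _
      change modelDeriv _ n _ _ v - modelDeriv _ n _ _ v = _ at hv
      rw [add_sub_left_comm, hv]
      abel

end
end LinkMaps
end

/-! ### Every lift is homotopic to a transverse one. -/

noncomputable section

namespace GeneralPosition

section

variable {E : Type*} [NormedAddCommGroup E] [NormedSpace ℝ E]
  {H : Type*} [TopologicalSpace H] {J : ModelWithCorners ℝ E H}
  {Y : Type*} [TopologicalSpace Y] [ChartedSpace H Y]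
  {n : ℕ} {N : Type*} [TopologicalSpace N] [ChartedSpace (EuclideanSpace ℝ (Fin n)) N]

theorem IsDeformation.exists_isCompact {T O : Set Y} {F F' : Y → N}
    (h : IsDeformation J n T O F F') : ∃ K, IsCompact K ∧ K ⊆ O ∧ ∀ y ∉ K, F' y = F y := by
  obtain ⟨h, h1, ⟨K, hK, hKO, h2⟩, -⟩ := h
  exact ⟨K, hK, hKO, fun y hy => by rw [← (h1 y).2, h2 y hy]⟩

end

section

variable {E₁ : Type*} [NormedAddCommGroup E₁] [NormedSpace ℝ E₁]
  {H₁ : Type*} [TopologicalSpace H₁] {I₁ : ModelWithCorners ℝ E₁ H₁}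
  {E₂ : Type*} [NormedAddCommGroup E₂] [NormedSpace ℝ E₂]
  {H₂ : Type*} [TopologicalSpace H₂] {I₂ : ModelWithCorners ℝ E₂ H₂}
  {P₁ : Type*} [TopologicalSpace P₁] [ChartedSpace H₁ P₁]
  {P₂ : Type*} [TopologicalSpace P₂] [ChartedSpace H₂ P₂]
  {T : Type*} [NormedAddCommGroup T] [NormedSpace ℝ T]
  {n : ℕ} {N : Type*} [TopologicalSpace N] [ChartedSpace (EuclideanSpace ℝ (Fin n)) N]

theorem exists_isCompact_of_reflTransGen {T₀ O : Set T} {F F' : (P₁ × T → N) × (P₂ × T → N)}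
    (h : Relation.ReflTransGen (DeformsTo I₁ I₂ n T₀ O) F F') :
    (∃ K, IsCompact K ∧ K ⊆ Set.univ ×ˢ O ∧ ∀ y ∉ K, F'.1 y = F.1 y) ∧
      ∃ K, IsCompact K ∧ K ⊆ Set.univ ×ˢ O ∧ ∀ y ∉ K, F'.2 y = F.2 y := by
  induction h with
  | refl => exact ⟨⟨∅, isCompact_empty, Set.empty_subset _, fun _ _ => rfl⟩,
      ⟨∅, isCompact_empty, Set.empty_subset _, fun _ _ => rfl⟩⟩
  | tail _ h ih =>
    obtain ⟨⟨K₁, h1, h2, h3⟩, ⟨K₂, k1, k2, k3⟩⟩ := ih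
    obtain ⟨K₁', h1', h2', h3'⟩ := h.1.exists_isCompact
    obtain ⟨K₂', k1', k2', k3'⟩ := h.2.exists_isCompact
    refine ⟨⟨K₁ ∪ K₁', h1.union h1', Set.union_subset h2 h2', fun y hy => ?_⟩,
      ⟨K₂ ∪ K₂', k1.union k1', Set.union_subset k2 k2', fun y hy => ?_⟩⟩
    · rw [h3' y fun h => hy (.inr h), h3 y fun h => hy (.inl h)]
    · rw [k3' y fun h => hy (.inr h), k3 y fun h => hy (.inl h)]

theorem eqOn_of_reflTransGen {T₀ O : Set T} {F F' : (P₁ × T → N) × (P₂ × T → N)}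
    (h : Relation.ReflTransGen (DeformsTo I₁ I₂ n T₀ O) F F') {t : T} (ht : t ∉ O) :
    (∀ x, F'.1 (x, t) = F.1 (x, t)) ∧ ∀ x, F'.2 (x, t) = F.2 (x, t) := by
  obtain ⟨⟨K₁, -, h2, h3⟩, ⟨K₂, -, k2, k3⟩⟩ := exists_isCompact_of_reflTransGen h
  exact ⟨fun x => h3 _ fun h => ht (h2 h).2, fun x => k3 _ fun h => ht (k2 h).2⟩

end
end GeneralPosition

namespace LinkMaps
open GeneralPosition

section

variable {p₁ p₂ n : ℕ}
  {P₁ : Type*} [TopologicalSpace P₁] [ChartedSpace (EuclideanSpace ℝ (Fin p₁)) P₁] [T2Space P₁]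
  [IsManifold (𝓡 p₁) ∞ P₁] [CompactSpace P₁]
  {P₂ : Type*} [TopologicalSpace P₂] [ChartedSpace (EuclideanSpace ℝ (Fin p₂)) P₂] [T2Space P₂]
  [IsManifold (𝓡 p₂) ∞ P₂] [CompactSpace P₂]
  {N : Type*} [TopologicalSpace N] [ChartedSpace (EuclideanSpace ℝ (Fin n)) N]
  [IsManifold (𝓡 n) ∞ N] [T2Space N]
  {f₁ : SmoothMap p₁ n P₁ N} {f₂ : SmoothMap p₂ n P₂ N}

theorem Lift.isClosed_coincidence (α : Lift f₁ f₂) : IsClosed α.coincidence := by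
  have h₁ : Continuous fun z : (P₁ × P₂) × I => α.F₁ (z.1.1, z.2) :=
    α.F₁.contMDiff.continuous.comp (by fun_prop)
  have h₂ : Continuous fun z : (P₁ × P₂) × I => α.F₂ (z.1.2, z.2) :=
    α.F₂.contMDiff.continuous.comp (by fun_prop)
  exact isClosed_eq h₁ h₂

/-- The continuous function min(t, 1 - t) is positive on a compact set, hence bounded below by a
positive constant. -/
theorem exists_collar {Z : Type*} [TopologicalSpace Z] {K : Set Z} (hK : IsCompact K) {t : Z → ℝ}
    (ht : Continuous t) (h : ∀ z ∈ K, t z ∈ Set.Ioo (0 : ℝ) 1) :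
    ∃ ε ∈ Set.Ioo (0 : ℝ) (1 / 2), ∀ z ∈ K, t z ∈ Set.Icc ε (1 - ε) := by
  obtain ⟨ε, hε, hle⟩ := hK.exists_forall_le' (f := fun z => min (t z) (1 - t z)) (a := 0)
    (by fun_prop) fun z hz => lt_min (h z hz).1 (by linarith [(h z hz).2])
  refine ⟨min ε (1 / 4), ⟨lt_min hε (by norm_num), lt_of_le_of_lt (min_le_right _ _) (by norm_num)⟩,
    fun z hz => ?_⟩
  have h1 := le_min_iff.1 (hle z hz)
  have h2 := min_le_left ε (1 / 4)
  exact ⟨by linarith, by linarith⟩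

/-- Every lift is homotopic to a transverse one. -/
theorem Lift.exists_transverse (hf : IsLinkMap f₁ f₂) (α : Lift f₁ f₂) :
    ∃ β : Lift f₁ f₂, α.Homotopic β ∧ β.Transverse := by
  obtain ⟨ε, hε, hc⟩ := exists_collar α.isClosed_coincidence.isCompact
    (t := fun z => (z.2 : ℝ)) (by fun_prop) fun z hz => α.mem_Ioo_of_mem_coincidence hf hz
  have hne : ∀ z : (P₁ × P₂) × ℝ, z.2 ∈ Set.Icc (0 : ℝ) 1 → z.2 ∉ Set.Icc ε (1 - ε) →
      onFst α.extend.1 z ≠ onSnd α.extend.2 z := by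
    intro z hz hz' heq
    exact hz' (hc (z.1, ⟨z.2, hz⟩) ((α.onFst_extend_eq_iff (z.1, ⟨z.2, hz⟩)).1 heq))
  -- All coincidences have times in [ε, 1 - ε]. The deformation is supported over (ε/2, 1 - ε/2),
  -- and transversality is created over C. The collars A contain no coincidences at the start, so
  -- transversality holds there vacuously and is preserved; they bridge the gap between C and the
  -- times where nothing moves.
  let A : Set ((P₁ × P₂) × ℝ) := Set.univ ×ˢ (Set.Icc (ε / 4) (3 * ε / 4) ∪
    Set.Icc (1 - 3 * ε / 4) (1 - ε / 4))
  let C : Set ((P₁ × P₂) × ℝ) := Set.univ ×ˢ Set.Icc (3 * ε / 4) (1 - 3 * ε / 4)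
  have hε1 := hε.1
  have hε2 := hε.2
  have hA : ∀ z ∈ A, z.2 ∈ Set.Ioo (0 : ℝ) 1 ∧ z.2 ∉ Set.Icc ε (1 - ε) := by
    rintro z ⟨-, hz | hz⟩
    · exact ⟨⟨by linarith [hz.1], by linarith [hz.2]⟩, fun h => by linarith [h.1, hz.2]⟩
    · exact ⟨⟨by linarith [hz.1], by linarith [hz.2]⟩, fun h => by linarith [h.2, hz.1]⟩
  obtain ⟨F', h1, -, -, h4⟩ := exists_transverse_deformation (I₁ := 𝓡 p₁) (I₂ := 𝓡 p₂) (n := n)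
    (T₀ := Set.Ioo (0 : ℝ) 1) (O := Set.Ioo (ε / 2) (1 - ε / 2)) isOpen_Ioo isOpen_Ioo
    (Set.Ioo_subset_Ioo (by linarith) (by linarith)) (F := α.extend)
    (contMDiffOn_extendPath α.F₁.contMDiff) (contMDiffOn_extendPath α.F₂.contMDiff) (A := A)
    (isCompact_univ.prod (isCompact_Icc.union isCompact_Icc)) (fun z hz => ⟨trivial, (hA z hz).1⟩)
    (fun z hz h => absurd h (hne z (Set.Ioo_subset_Icc_self (hA z hz).1) (hA z hz).2)) (C := C)
    (isCompact_univ.prod isCompact_Icc)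
    (fun z hz => ⟨trivial, by linarith [hz.2.1], by linarith [hz.2.2]⟩)
  obtain ⟨β, hβ, rfl⟩ := Lift.exists_homotopic_of_reflTransGen
    (Set.Ioo_subset_Ioo (by linarith) (by linarith)) h1
  refine ⟨β, hβ, (β.transverse_iff hf).2 fun z hz => ?_⟩
  by_cases hz1 : z.2 < ε / 4 ∨ 1 - ε / 4 < z.2
  · have hz2 : z.2 ∉ Set.Ioo (ε / 2) (1 - ε / 2) := by
      rintro ⟨h2, h3⟩
      rcases hz1 with h | h <;> linarith
    have hz3 : z.2 ∉ Set.Icc ε (1 - ε) := by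
      rintro ⟨h2, h3⟩
      rcases hz1 with h | h <;> linarith
    have h5 := eqOn_of_reflTransGen h1 hz2
    intro h
    refine absurd ?_ (hne z (Set.Ioo_subset_Icc_self hz) hz3)
    rw [onFst, onSnd, ← h5.1, ← h5.2]
    exact h
  · push Not at hz1
    refine h4 z ?_
    by_cases h5 : z.2 ≤ 3 * ε / 4
    · exact .inl ⟨trivial, .inl ⟨hz1.1, h5⟩⟩
    by_cases h6 : 1 - 3 * ε / 4 ≤ z.2
    · exact .inl ⟨trivial, .inr ⟨h6, hz1.2⟩⟩
    · exact .inr ⟨trivial, (not_le.1 h5).le, (not_le.1 h6).le⟩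

end
end LinkMaps
end

/-! ### Construction of the linking manifold of a transverse lift. -/

noncomputable section

namespace GeneralPosition
open Bundle

section

variable {E : Type*} [NormedAddCommGroup E] [NormedSpace ℝ E] [FiniteDimensional ℝ E]
  {H : Type*} [TopologicalSpace H] {J : ModelWithCorners ℝ E H} [J.Boundaryless]
  {M : Type*} [TopologicalSpace M] [ChartedSpace H M] [IsManifold J ∞ M]
  {n : ℕ} {N : Type*} [TopologicalSpace N] [ChartedSpace (EuclideanSpace ℝ (Fin n)) N]
  [IsManifold (𝓡 n) ∞ N]
  {T : Type*} [NormedAddCommGroup T] [NormedSpace ℝ T] [FiniteDimensional ℝ T]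
  {W : Type*} [TopologicalSpace W]

theorem convex_setOf_rightInverse {V F : Type*} [NormedAddCommGroup V] [NormedSpace ℝ V]
    [NormedAddCommGroup F] [NormedSpace ℝ F] (D : V →L[ℝ] F) :
    Convex ℝ {R : F →L[ℝ] V | ∀ u, D (R u) = u} := by
  intro R hR R' hR' a b _ _ hab u
  have h1 : D (a • R u + b • R' u) = u := by
    rw [map_add, map_smul, map_smul, hR, hR', ← add_smul, hab, one_smul]
  exact h1

/-- Local right inverses can be averaged, since the right inverses of a fixed linear map form a
convex set. -/
theorem exists_right_inverse [CompactSpace W] [T2Space W] {D : Set (M × T)} (hD : IsOpen D)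
    {G₁ G₂ : M × T → N}
    (h₁ : ContMDiffOn (J.prod 𝓘(ℝ, T)) (𝓡 n) ∞ G₁ D)
    (h₂ : ContMDiffOn (J.prod 𝓘(ℝ, T)) (𝓡 n) ∞ G₂ D)
    {i : W → M × T} (hi : Continuous i) (hiD : ∀ w, i w ∈ coincidenceSet D G₁ G₂)
    {y : W → N} (hy : ∀ w, G₁ (i w) = y w)
    (hR : ∀ w, TransverseAt (J.prod 𝓘(ℝ, T)) n G₁ G₂ (i w)) :
    ∃ s : W → EuclideanSpace ℝ (Fin n) →L[ℝ] E × T,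
      (∀ w u, diffDeriv (J.prod 𝓘(ℝ, T)) n G₁ G₂ (i w) (s w u) = u) ∧
      Continuous (familyMap J (fun w => (i w).1) y s) :=
  exists_continuous_family J (fun w => (i w).1) y (by fun_prop)
    (fun w => {R | ∀ u, diffDeriv (J.prod 𝓘(ℝ, T)) n G₁ G₂ (i w) (R u) = u})
    (fun w => convex_setOf_rightInverse _)
    fun w => exists_local_right_inverse hD h₁ h₂ hi hiD hy w (hR w)

end

theorem SliceAtlas.compactSpace {E : Type*} [NormedAddCommGroup E] [NormedSpace ℝ E] {H : Type*}
    [TopologicalSpace H]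
    {J : ModelWithCorners ℝ E H} {X : Type*} [TopologicalSpace X] [ChartedSpace H X]
    {E' : Type*} [NormedAddCommGroup E'] [NormedSpace ℝ E'] {H' : Type*} [TopologicalSpace H']
    {I' : ModelWithCorners ℝ E' H'} {F : Type*} [NormedAddCommGroup F] [NormedSpace ℝ F]
    {W : Set X} (S : SliceAtlas J I' F W) (hW : IsCompact W) : CompactSpace S.Carrier := by
  rw [← isCompact_univ_iff, S.isEmbedding_incl.isCompact_iff, Set.image_univ, S.range_incl]
  exact hW

theorem finrank_le_of_surjective {V F : Type*} [NormedAddCommGroup V] [NormedSpace ℝ V]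
    [FiniteDimensional ℝ V] [NormedAddCommGroup F] [NormedSpace ℝ F] {D : V →L[ℝ] F}
    (hD : Function.Surjective D) : Module.finrank ℝ F ≤ Module.finrank ℝ V := by
  have h := LinearMap.finrank_range_le (D : V →ₗ[ℝ] F)
  rwa [LinearMap.range_eq_top.2 hD, finrank_top] at h

end GeneralPosition

namespace LinkMaps
open GeneralPosition StableCobordism

section

variable {p₁ p₂ n : ℕ}
  {P₁ : Type u} [TopologicalSpace P₁] [ChartedSpace (EuclideanSpace ℝ (Fin p₁)) P₁] [T2Space P₁]
  [IsManifold (𝓡 p₁) ∞ P₁] [CompactSpace P₁]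
  {P₂ : Type u} [TopologicalSpace P₂] [ChartedSpace (EuclideanSpace ℝ (Fin p₂)) P₂] [T2Space P₂]
  [IsManifold (𝓡 p₂) ∞ P₂] [CompactSpace P₂]
  {N : Type v} [TopologicalSpace N] [ChartedSpace (EuclideanSpace ℝ (Fin n)) N]
  [IsManifold (𝓡 n) ∞ N] [T2Space N]
  {f₁ : SmoothMap p₁ n P₁ N} {f₂ : SmoothMap p₂ n P₂ N}

theorem continuous_cylinderIncl : Continuous (cylinderIncl (P₁ := P₁) (P₂ := P₂)) := by
  unfold cylinderIncl
  fun_prop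

theorem Lift.coincidenceSet_eq (hf : IsLinkMap f₁ f₂) (α : Lift f₁ f₂) :
    coincidenceSet (Set.univ ×ˢ Set.Ioo (0 : ℝ) 1) (onFst α.extend.1 : (P₁ × P₂) × ℝ → N)
      (onSnd α.extend.2) = cylinderIncl '' α.coincidence := by
  ext z
  constructor
  · rintro ⟨⟨-, hz⟩, h⟩
    exact ⟨(z.1, ⟨z.2, Set.Ioo_subset_Icc_self hz⟩),
      (α.onFst_extend_eq_iff (z.1, ⟨z.2, Set.Ioo_subset_Icc_self hz⟩)).1 h, rfl⟩
  · rintro ⟨z, hz, rfl⟩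
    exact ⟨⟨trivial, α.mem_Ioo_of_mem_coincidence hf hz⟩, (α.onFst_extend_eq_iff z).2 hz⟩

theorem finrank_model (p₁ p₂ : ℕ) : Module.finrank ℝ
    ((EuclideanSpace ℝ (Fin p₁) × EuclideanSpace ℝ (Fin p₂)) × ℝ) = p₁ + p₂ + 1 := by
  simp

/-- Every transverse lift has a linking manifold. -/
theorem Lift.Transverse.exists_isPreimage (hf : IsLinkMap f₁ f₂) {α : Lift f₁ f₂}
    (hα : α.Transverse) :
    ∃ (L : LinkingCycle f₁ f₂) (t : L.W → I), L.IsPreimage α t := by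
  have hR := (α.transverse_iff hf).1 hα
  -- The dimension is a truncated difference of natural numbers. It is the true one as soon as a
  -- coincidence exists, for then a space of dimension p₁ + p₂ + 1 is mapped onto ℝⁿ.
  have hd : (coincidenceSet (Set.univ ×ˢ Set.Ioo (0 : ℝ) 1) (onFst α.extend.1 : (P₁ × P₂) × ℝ → N)
      (onSnd α.extend.2)).Nonempty → Module.finrank ℝ
      ((EuclideanSpace ℝ (Fin p₁) × EuclideanSpace ℝ (Fin p₂)) × ℝ) =
        n + (p₁ + p₂ + 1 - n) := by
    rintro ⟨z, hz⟩
    have h1 := finrank_le_of_surjective (hR z hz.1.2 hz.2)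
    rw [finrank_euclideanSpace_fin] at h1
    rw [finrank_model] at h1 ⊢
    omega
  obtain ⟨S⟩ := nonempty_sliceAtlas_coincidenceSet (J := ((𝓡 p₁).prod (𝓡 p₂)).prod 𝓘(ℝ))
    (isOpen_univ.prod isOpen_Ioo) α.contMDiffOn_extend_fst α.contMDiffOn_extend_snd
    (k := p₁ + p₂ + 1 - n) (fun z hz => hR z hz.2) hd
  have hcompact : CompactSpace S.Carrier := S.compactSpace (by
    rw [α.coincidenceSet_eq hf]
    exact α.isClosed_coincidence.isCompact.image continuous_cylinderIncl)
  have hT2 : T2Space S.Carrier := S.isEmbedding_incl.t2Space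
  have hmem : ∀ w, (S.incl w).2 ∈ Set.Ioo (0 : ℝ) 1 := fun w => (S.incl_mem w).1.2
  let t : S.Carrier → I := fun w => ⟨(S.incl w).2, Set.Ioo_subset_Icc_self (hmem w)⟩
  have hti : ∀ w, cylinderIncl ((S.incl w).1, t w) = S.incl w := fun w => rfl
  have htc : Continuous t := (S.continuous_incl.snd).subtype_mk _
  have hΓ : ∀ w, α.F₁ ((S.incl w).1.1, t w) = α.F₂ ((S.incl w).1.2, t w) := fun w =>
    (α.onFst_extend_eq_iff ((S.incl w).1, t w)).1 (S.incl_mem w).2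
  have hi := S.continuous_incl
  let f : C(S.Carrier, HoPullback f₁ f₂) := referenceMap ⟨fun w => (S.incl w).1, by fun_prop⟩
    ⟨t, htc⟩ ⟨fun p => α.F₁ ((S.incl p.1).1.1, p.2), α.F₁.contMDiff.continuous.comp (by fun_prop)⟩
    ⟨fun p => α.F₂ ((S.incl p.1).1.2, p.2), α.F₂.contMDiff.continuous.comp (by fun_prop)⟩
    (fun w => α.start₁ _) (fun w => α.start₂ _) hΓ
  have hy : ∀ w, onFst α.extend.1 (S.incl w) = HoPullback.eval f₁ f₂ (f w) := fun w => by
    refine Eq.trans ?_ (linkPath_left w ⟨0, by norm_num⟩ (t w) le_rfl (by simp)).symm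
    exact extendPath_coe α.F₁ _ (t w)
  -- The splitting s of the normal bundle; the isomorphism below is (v, u) ↦ di(v) + s(u), with i
  -- the inclusion.
  obtain ⟨s, hs, hsc⟩ := exists_right_inverse (isOpen_univ.prod isOpen_Ioo)
    α.contMDiffOn_extend_fst α.contMDiffOn_extend_snd S.continuous_incl S.incl_mem hy
    fun w => hR _ (hmem w)
  have hb : ContMDiff (𝓡 (p₁ + p₂ + 1 - n)) ((𝓡 p₁).prod (𝓡 p₂)) ∞ fun w => (S.incl w).1 :=
    contMDiff_fst.comp S.contMDiff_incl
  have hτ : ContMDiff (𝓡 (p₁ + p₂ + 1 - n)) 𝓘(ℝ) ∞ fun w => (S.incl w).2 :=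
    contMDiff_snd.comp S.contMDiff_incl
  have hbd := hb.mdifferentiable (by simp)
  have hτd := hτ.mdifferentiable (by simp)
  have hpair : ∀ w, mfderiv (𝓡 (p₁ + p₂ + 1 - n)) (((𝓡 p₁).prod (𝓡 p₂)).prod 𝓘(ℝ)) S.incl w =
      pairModelDeriv (𝓡 (p₁ + p₂ + 1 - n)) ((𝓡 p₁).prod (𝓡 p₂)) (fun w => (S.incl w).1)
        (fun w => (S.incl w).2) w := fun w => (hasMFDerivAt_pair (hbd w) (hτd w)).mfderiv
  have hbij : ∀ w, Function.Bijective fun p : EuclideanSpace ℝ (Fin (p₁ + p₂ + 1 - n)) ×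
      EuclideanSpace ℝ (Fin n) =>
      pairModelDeriv (𝓡 (p₁ + p₂ + 1 - n)) ((𝓡 p₁).prod (𝓡 p₂)) (fun w => (S.incl w).1)
        (fun w => (S.incl w).2) w p.1 + s w p.2 := by
    intro w
    refine bijective_add_of_complement ?_ (fun v => diffDeriv_pairModelDeriv (hbd w) (hτd w)
      (α.mdifferentiableAt_extend_fst (hmem w)) (α.mdifferentiableAt_extend_snd (hmem w))
      (fun w => (S.incl_mem w).2) v) (hs w) ?_
    · have h := S.injective_mfderiv_incl w
      rw [hpair] at h
      exact h
    · rw [finrank_euclideanSpace_fin, finrank_euclideanSpace_fin]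
      exact hd ⟨_, S.incl_mem w⟩
  obtain ⟨φ, hφ⟩ := exists_bundleIso (I' := 𝓡 (p₁ + p₂ + 1 - n)) (J := (𝓡 p₁).prod (𝓡 p₂)) (n := n)
    (Fin 0 → ℝ) (Bundle.Trivial.isInducing_toProd _ _) f (HoPullback.eval f₁ f₂) (HoPullback.proj f₁ f₂) (τ := fun w => (S.incl w).2)
    hb hτ hsc (ContinuousLinearEquiv.funUnique (Fin 1) ℝ ℝ).symm hbij
  let L : LinkingCycle f₁ f₂ := { W := S.Carrier, f := f, φ := φ }
  have hts : ContMDiff (𝓡 (p₁ + p₂ + 1 - n)) (𝓡∂ 1) ∞ t :=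
    contMDiff_iff_comp_subtypeVal_Icc.2 ⟨htc, hτ⟩
  have hj : ContMDiff (𝓡 (p₁ + p₂ + 1 - n)) (((𝓡 p₁).prod (𝓡 p₂)).prod (𝓡∂ 1)) ∞
      fun w => ((S.incl w).1, t w) := hb.prodMk hts
  have hinj : Function.Injective fun w => ((S.incl w).1, t w) := fun w w' h =>
    S.injective_incl (congrArg cylinderIncl h)
  let κ : ℝ ≃L[ℝ] (Fin 1 → ℝ) := (ContinuousLinearEquiv.funUnique (Fin 1) ℝ ℝ).symm
  let A : S.Carrier → EuclideanSpace ℝ (Fin (p₁ + p₂ + 1 - n)) →L[ℝ]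
      (EuclideanSpace ℝ (Fin p₁) × EuclideanSpace ℝ (Fin p₂)) × ℝ :=
    pairModelDeriv (𝓡 (p₁ + p₂ + 1 - n)) ((𝓡 p₁).prod (𝓡 p₂)) (fun w => (S.incl w).1)
      (fun w => (S.incl w).2)
  have hφt : ∀ (w : S.Carrier) (v : EuclideanSpace ℝ (Fin (p₁ + p₂ + 1 - n))),
      φ.toEquiv w (v, (0, 0)) = ((A w v).1, κ (A w v).2) := fun w v => by
    have h1 : A w v + s w 0 = A w v := by rw [map_zero (s w), add_zero]
    exact (hφ w (v, (0, 0))).trans (congrArg (fun q => (q.1, κ q.2)) h1)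
  have hφn : ∀ (w : S.Carrier) (u : EuclideanSpace ℝ (Fin n)),
      φ.toEquiv w (0, (u, 0)) = ((s w u).1, κ (s w u).2) := fun w u => by
    have h1 : A w 0 + s w u = s w u := by rw [map_zero (A w), zero_add]
    exact (hφ w (0, (u, 0))).trans (congrArg (fun q => (q.1, κ q.2)) h1)
  refine ⟨L, t, hj, hinj, fun w => ?_, ?_, fun w a τ ha hτ => linkPath_left w a τ ha hτ,
    fun w a τ ha hτ => linkPath_right hΓ w a τ ha hτ, fun w v => ?_, fun w u => ?_⟩
  · have h1 : mfderiv (𝓡 (p₁ + p₂ + 1 - n)) (((𝓡 p₁).prod (𝓡 p₂)).prod 𝓘(ℝ)) S.incl w =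
        (mfderiv (((𝓡 p₁).prod (𝓡 p₂)).prod (𝓡∂ 1)) (((𝓡 p₁).prod (𝓡 p₂)).prod 𝓘(ℝ)) cylinderIncl
          ((S.incl w).1, t w)).comp
        (mfderiv (𝓡 (p₁ + p₂ + 1 - n)) (((𝓡 p₁).prod (𝓡 p₂)).prod (𝓡∂ 1))
          (fun w => ((S.incl w).1, t w)) w) :=
      mfderiv_comp w (contMDiff_cylinderIncl.mdifferentiable (by simp) _)
        (hj.mdifferentiable (by simp) w)
    have h2 := S.injective_mfderiv_incl w
    rw [h1] at h2
    exact Function.Injective.of_comp h2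
  · have h1 := α.coincidenceSet_eq hf
    rw [← S.range_incl] at h1
    refine Function.Injective.image_injective (f := cylinderIncl (P₁ := P₁) (P₂ := P₂)) ?_ ?_
    · intro z z' h
      exact Prod.ext (congrArg Prod.fst h :) (Subtype.ext (congrArg Prod.snd h :))
    · rw [← h1, ← Set.range_comp]
      rfl
  · exact hφt w v
  · have h2 := hs w u
    have h3 := α.pairDeriv_apply (z := ((S.incl w).1, t w)) (hmem w) (s w u).1 (s w u).2
    have h4 := congrArg (fun y : (EuclideanSpace ℝ (Fin p₁) × EuclideanSpace ℝ (Fin p₂)) ×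
      (Fin 1 → ℝ) => α.pairDeriv ((S.incl w).1, t w)
        (y.1, y.2 0 • (1 : TangentSpace (𝓡∂ 1) (t w)))) (hφn w u)
    have h5 := congrArg (fun q => q.2 - q.1) (h4.trans h3)
    exact h5.trans h2

/-- Every lift has a linking manifold. -/
theorem Lift.exists_isLinkingManifold (hf : IsLinkMap f₁ f₂) (α : Lift f₁ f₂) :
    ∃ L : LinkingCycle f₁ f₂, L.IsLinkingManifold α := by
  obtain ⟨β, h1, h2⟩ := α.exists_transverse hf
  obtain ⟨L, t, h3⟩ := h2.exists_isPreimage hf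
  exact ⟨L, β, h1, h2, t, h3⟩

end
end LinkMaps
end

/-! ### Homotopies of transverse lifts in general position relative to their ends. -/

noncomputable section

namespace GeneralPosition

section

variable {E : Type*} [NormedAddCommGroup E] [NormedSpace ℝ E]
  {H : Type*} [TopologicalSpace H] {J : ModelWithCorners ℝ E H}
  {M : Type*} [TopologicalSpace M] [ChartedSpace H M]
  {n : ℕ} {N : Type*} [TopologicalSpace N] [ChartedSpace (EuclideanSpace ℝ (Fin n)) N]

/-- The projection which forgets the second parameter. -/
def forgetParam (z : M × (ℝ × ℝ)) : M × ℝ := (z.1, z.2.1)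

theorem hasMFDerivAt_forgetParam (z : M × (ℝ × ℝ)) :
    HasMFDerivAt (J.prod 𝓘(ℝ, ℝ × ℝ)) (J.prod 𝓘(ℝ)) forgetParam z
      ((ContinuousLinearMap.id ℝ E).prodMap (ContinuousLinearMap.fst ℝ ℝ ℝ) :
        E × (ℝ × ℝ) →L[ℝ] E × ℝ) := by
  have h0 : HasMFDerivAt (J.prod 𝓘(ℝ, ℝ × ℝ)) J (Prod.fst : M × (ℝ × ℝ) → M) z _ :=
    hasMFDerivAt_fst z
  have h1 : HasMFDerivAt (J.prod 𝓘(ℝ, ℝ × ℝ)) 𝓘(ℝ, ℝ × ℝ)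
    (Prod.snd : M × (ℝ × ℝ) → ℝ × ℝ) z _ := hasMFDerivAt_snd z
  have h2 : HasMFDerivAt (J.prod 𝓘(ℝ, ℝ × ℝ)) 𝓘(ℝ) (fun z : M × (ℝ × ℝ) => z.2.1) z _ :=
    HasMFDerivAt.comp (I' := 𝓘(ℝ, ℝ × ℝ)) z (g := Prod.fst) (f := Prod.snd)
      hasFDerivAt_fst.hasMFDerivAt h1
  exact h0.prodMk h2

/-- Near a level where a family does not depend on the second parameter, its derivative factors
through the projection forgetting that parameter. -/
theorem modelDeriv_of_forgetParam {G : M × (ℝ × ℝ) → N} {g : M × ℝ → N} {z : M × (ℝ × ℝ)}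
    (hg : MDifferentiableAt (J.prod 𝓘(ℝ)) (𝓡 n) g (forgetParam z))
    (h : G =ᶠ[𝓝 z] g ∘ forgetParam) (v : E × (ℝ × ℝ)) :
    modelDeriv (J.prod 𝓘(ℝ, ℝ × ℝ)) n G z v =
      modelDeriv (J.prod 𝓘(ℝ)) n g (forgetParam z) (v.1, v.2.1) := by
  have h1 := (HasMFDerivAt.comp (I' := J.prod 𝓘(ℝ)) z (g := g) (f := forgetParam)
    hg.hasMFDerivAt (hasMFDerivAt_forgetParam z)).congr_of_eventuallyEq h
  exact DFunLike.congr_fun h1.mfderiv v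

theorem diffDeriv_of_forgetParam {G₁ G₂ : M × (ℝ × ℝ) → N} {g₁ g₂ : M × ℝ → N}
    {z : M × (ℝ × ℝ)}
    (hg₁ : MDifferentiableAt (J.prod 𝓘(ℝ)) (𝓡 n) g₁ (forgetParam z))
    (hg₂ : MDifferentiableAt (J.prod 𝓘(ℝ)) (𝓡 n) g₂ (forgetParam z))
    (h₁ : G₁ =ᶠ[𝓝 z] g₁ ∘ forgetParam) (h₂ : G₂ =ᶠ[𝓝 z] g₂ ∘ forgetParam) (v : E × (ℝ × ℝ)) :
    diffDeriv (J.prod 𝓘(ℝ, ℝ × ℝ)) n G₁ G₂ z v =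
      diffDeriv (J.prod 𝓘(ℝ)) n g₁ g₂ (forgetParam z) (v.1, v.2.1) :=
  congrArg₂ (· - ·) (modelDeriv_of_forgetParam hg₂ h₂ v) (modelDeriv_of_forgetParam hg₁ h₁ v)

theorem mfderiv_snd_snd (z : M × (ℝ × ℝ)) (v : E × (ℝ × ℝ)) :
    (mfderiv (J.prod 𝓘(ℝ, ℝ × ℝ)) 𝓘(ℝ) (fun z : M × (ℝ × ℝ) => z.2.2) z v : ℝ) = v.2.2 := by
  have h1 : HasMFDerivAt (J.prod 𝓘(ℝ, ℝ × ℝ)) 𝓘(ℝ, ℝ × ℝ)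
    (Prod.snd : M × (ℝ × ℝ) → ℝ × ℝ) z _ := hasMFDerivAt_snd z
  have h2 : HasMFDerivAt (J.prod 𝓘(ℝ, ℝ × ℝ)) 𝓘(ℝ) (fun z : M × (ℝ × ℝ) => z.2.2) z _ :=
    HasMFDerivAt.comp (I' := 𝓘(ℝ, ℝ × ℝ)) z (g := Prod.snd) (f := Prod.snd)
      hasFDerivAt_snd.hasMFDerivAt h1
  exact DFunLike.congr_fun h2.mfderiv v

theorem contMDiff_snd_snd :
    ContMDiff (J.prod 𝓘(ℝ, ℝ × ℝ)) 𝓘(ℝ) ∞ (fun z : M × (ℝ × ℝ) => z.2.2) :=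
  contDiff_snd.contMDiff.comp contMDiff_snd

end
end GeneralPosition

namespace LinkMaps
open GeneralPosition

section

variable {p₁ p₂ n : ℕ}
  {P₁ : Type*} [TopologicalSpace P₁] [ChartedSpace (EuclideanSpace ℝ (Fin p₁)) P₁] [T2Space P₁]
  [IsManifold (𝓡 p₁) ∞ P₁] [CompactSpace P₁]
  {P₂ : Type*} [TopologicalSpace P₂] [ChartedSpace (EuclideanSpace ℝ (Fin p₂)) P₂] [T2Space P₂]
  [IsManifold (𝓡 p₂) ∞ P₂] [CompactSpace P₂]
  {N : Type*} [TopologicalSpace N] [ChartedSpace (EuclideanSpace ℝ (Fin n)) N]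
  [IsManifold (𝓡 n) ∞ N] [T2Space N]
  {f₁ : SmoothMap p₁ n P₁ N} {f₂ : SmoothMap p₂ n P₂ N}

/-- The families `F` of maps restrict to the lift `α` for all values of the second parameter
in `V`. -/
def RestrictsTo (F : (P₁ × (ℝ × ℝ) → N) × (P₂ × (ℝ × ℝ) → N)) (α : Lift f₁ f₂) (V : Set ℝ) : Prop :=
  ∀ t, ∀ τ ∈ V, (∀ x, F.1 (x, (t, τ)) = α.extend.1 (x, t)) ∧
    ∀ x, F.2 (x, (t, τ)) = α.extend.2 (x, t)

theorem RestrictsTo.eventually {F : (P₁ × (ℝ × ℝ) → N) × (P₂ × (ℝ × ℝ) → N)} {α : Lift f₁ f₂}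
    {V : Set ℝ} (h : RestrictsTo F α V) (hV : IsOpen V) {z : (P₁ × P₂) × (ℝ × ℝ)}
    (hz : z.2.2 ∈ V) : onFst F.1 =ᶠ[𝓝 z] onFst α.extend.1 ∘ forgetParam ∧
      onSnd F.2 =ᶠ[𝓝 z] onSnd α.extend.2 ∘ forgetParam := by
  have hc : Continuous fun z : (P₁ × P₂) × (ℝ × ℝ) => z.2.2 := by fun_prop
  constructor
  · filter_upwards [(hV.preimage hc).mem_nhds hz] with w hw
    exact (h w.2.1 w.2.2 hw).1 w.1.1
  · filter_upwards [(hV.preimage hc).mem_nhds hz] with w hw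
    exact (h w.2.1 w.2.2 hw).2 w.1.2

theorem RestrictsTo.diffDeriv {F : (P₁ × (ℝ × ℝ) → N) × (P₂ × (ℝ × ℝ) → N)} {α : Lift f₁ f₂}
    {V : Set ℝ} (h : RestrictsTo F α V) (hV : IsOpen V) {z : (P₁ × P₂) × (ℝ × ℝ)}
    (hz : z.2.2 ∈ V) (ht : z.2.1 ∈ Set.Ioo (0 : ℝ) 1)
    (v : (EuclideanSpace ℝ (Fin p₁) × EuclideanSpace ℝ (Fin p₂)) × (ℝ × ℝ)) :
    diffDeriv (((𝓡 p₁).prod (𝓡 p₂)).prod 𝓘(ℝ, ℝ × ℝ)) n (onFst F.1) (onSnd F.2) z v =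
      diffDeriv (((𝓡 p₁).prod (𝓡 p₂)).prod 𝓘(ℝ)) n (onFst α.extend.1) (onSnd α.extend.2)
        (forgetParam z) (v.1, v.2.1) :=
  diffDeriv_of_forgetParam (α.mdifferentiableAt_extend_fst ht) (α.mdifferentiableAt_extend_snd ht)
    (h.eventually hV hz).1 (h.eventually hV hz).2 v

/-- Transversality of `α` produces the vector for `a`. The family is constant in the second
parameter, so the component `b` in that direction can be prescribed freely without affecting the
difference of derivatives. -/
theorem RestrictsTo.levelTransverseAt (hf : IsLinkMap f₁ f₂)
    {F : (P₁ × (ℝ × ℝ) → N) × (P₂ × (ℝ × ℝ) → N)} {α : Lift f₁ f₂} (hα : α.Transverse)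
    {V : Set ℝ} (h : RestrictsTo F α V) (hV : IsOpen V) {z : (P₁ × P₂) × (ℝ × ℝ)}
    (hz : z.2.2 ∈ V) (ht : z.2.1 ∈ Set.Ioo (0 : ℝ) 1) (hc : onFst F.1 z = onSnd F.2 z) :
    LevelTransverseAt (((𝓡 p₁).prod (𝓡 p₂)).prod 𝓘(ℝ, ℝ × ℝ)) n (onFst F.1) (onSnd F.2)
      (fun z => z.2.2) z := by
  intro a b
  have hc' : onFst α.extend.1 (forgetParam z) = onSnd α.extend.2 (forgetParam z) := by
    have h1 := (h.eventually hV hz).1.self_of_nhds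
    have h2 := (h.eventually hV hz).2.self_of_nhds
    exact h1.symm.trans (hc.trans h2)
  obtain ⟨v, hv⟩ := (α.transverse_iff hf).1 hα (forgetParam z) ht hc' a
  refine ⟨(v.1, (v.2, b)), ?_, mfderiv_snd_snd z _⟩
  rw [h.diffDeriv hV hz ht]
  exact hv

theorem RestrictsTo.familyTransverseAt (hf : IsLinkMap f₁ f₂)
    {F : (P₁ × (ℝ × ℝ) → N) × (P₂ × (ℝ × ℝ) → N)} {α : Lift f₁ f₂} (hα : α.Transverse)
    {V : Set ℝ} (h : RestrictsTo F α V) (hV : IsOpen V) {z : (P₁ × P₂) × (ℝ × ℝ)}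
    (hz : z.2.2 ∈ V) (ht : z.2.1 ∈ Set.Ioo (0 : ℝ) 1) :
    FamilyTransverseAt (𝓡 p₁) (𝓡 p₂) n F.1 F.2 z := by
  intro hc a
  obtain ⟨v, hv, -⟩ := h.levelTransverseAt hf hα hV hz ht hc a 0
  exact ⟨v, hv⟩

/-- A homotopy as a family of maps with two real parameters. -/
def extendSquare {P : Type*} (H : (P × I) × I → N) (z : P × (ℝ × ℝ)) : N :=
  H ((z.1, Set.projIcc 0 1 zero_le_one z.2.1), step 1 z.2.2)

theorem continuous_step (c : ℝ) : Continuous (step c) := (contMDiff_step c).continuous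

theorem continuous_extendSquare {P : Type*} [TopologicalSpace P] {H : (P × I) × I → N}
    (hH : Continuous H) : Continuous (extendSquare H) := by
  have := continuous_step 1
  unfold extendSquare
  fun_prop

theorem contMDiffOn_extendSquare {p : ℕ} {P : Type*} [TopologicalSpace P]
    [ChartedSpace (EuclideanSpace ℝ (Fin p)) P] (H : SmoothSquare p n P N) :
    ContMDiffOn ((𝓡 p).prod 𝓘(ℝ, ℝ × ℝ)) (𝓡 n) ∞ (extendSquare H)
      (Set.univ ×ˢ (Set.Ioo (0 : ℝ) 1 ×ˢ Set.univ)) := by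
  have h : ContMDiffOn 𝓘(ℝ) (𝓡∂ 1) ∞ (Set.projIcc (0 : ℝ) 1 zero_le_one) (Set.Icc 0 1) :=
    contMDiffOn_projIcc
  have h1 : ContMDiff ((𝓡 p).prod 𝓘(ℝ, ℝ × ℝ)) 𝓘(ℝ) ∞ fun z : P × (ℝ × ℝ) => z.2.1 :=
    contDiff_fst.contMDiff.comp contMDiff_snd
  refine H.contMDiff.comp_contMDiffOn ((contMDiff_fst.contMDiffOn.prodMk
    (h.comp h1.contMDiffOn fun z hz => Set.Ioo_subset_Icc_self hz.2.1)).prodMk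
      ((contMDiff_step 1).comp contMDiff_snd_snd).contMDiffOn)

/-- The families of maps obtained from a homotopy of transverse lifts in general position. -/
theorem Lift.Homotopic.exists_families (hf : IsLinkMap f₁ f₂) {α β : Lift f₁ f₂}
    (h : α.Homotopic β) (hα : α.Transverse) (hβ : β.Transverse) :
    ∃ F : (P₁ × (ℝ × ℝ) → N) × (P₂ × (ℝ × ℝ) → N),
      ContMDiffOn ((𝓡 p₁).prod 𝓘(ℝ, ℝ × ℝ)) (𝓡 n) ∞ F.1
        (Set.univ ×ˢ (Set.Ioo (0 : ℝ) 1 ×ˢ Set.univ)) ∧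
      ContMDiffOn ((𝓡 p₂).prod 𝓘(ℝ, ℝ × ℝ)) (𝓡 n) ∞ F.2
        (Set.univ ×ˢ (Set.Ioo (0 : ℝ) 1 ×ˢ Set.univ)) ∧
      Continuous F.1 ∧ Continuous F.2 ∧ (∀ x τ, F.1 (x, (0, τ)) = f₁ x) ∧
      (∀ x τ, F.2 (x, (0, τ)) = f₂ x) ∧ RestrictsTo F α (Set.Iio (1 / 4)) ∧
      RestrictsTo F β (Set.Ioi (3 / 4)) ∧
      (∀ z : (P₁ × P₂) × (ℝ × ℝ), z.2.1 ∈ Set.Icc (0 : ℝ) 1 → z.2.2 ∈ Set.Icc (0 : ℝ) 1 →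
        onFst F.1 z = onSnd F.2 z → z.2.1 ∈ Set.Ioo (0 : ℝ) 1) ∧
      ∀ z : (P₁ × P₂) × (ℝ × ℝ), z.2.1 ∈ Set.Ioo (0 : ℝ) 1 → z.2.2 ∈ Set.Icc (0 : ℝ) 1 →
        FamilyTransverseAt (𝓡 p₁) (𝓡 p₂) n F.1 F.2 z := by
  obtain ⟨H₁, H₂, h1, h2, h3, h4, h5⟩ := h
  let G : (P₁ × (ℝ × ℝ) → N) × (P₂ × (ℝ × ℝ) → N) := (extendSquare H₁, extendSquare H₂)
  have hGc₁ : Continuous G.1 := continuous_extendSquare H₁.contMDiff.continuous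
  have hGc₂ : Continuous G.2 := continuous_extendSquare H₂.contMDiff.continuous
  -- `step 1` is 0 up to 1/3 and 1 from 2/3 on, so the homotopy is constant in τ near both ends.
  have hGα : RestrictsTo G α (Set.Iio (1 / 3)) := by
    intro t τ hτ
    have hτ' : τ < 1 / 3 := hτ
    constructor <;> intro x <;> simp only [G, extendSquare, Lift.extend, extendPath]
    · rw [step_eq_zero (by linarith), (h1 _ _).1]
    · rw [step_eq_zero (by linarith), (h2 _ _).1]
  have hGβ : RestrictsTo G β (Set.Ioi (2 / 3)) := by
    intro t τ hτ
    have hτ' : 2 / 3 < τ := hτ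
    constructor <;> intro x <;> simp only [G, extendSquare, Lift.extend, extendPath]
    · rw [step_eq_one (by linarith), (h1 _ _).2]
    · rw [step_eq_one (by linarith), (h2 _ _).2]
  -- Coincidences over the closed square form a compact set. They avoid the time 0 because `(f₁,
  -- f₂)` is a link map, and the time 1 because every stage of the homotopy ends at a link map; this
  -- gives one ε for all stages.
  let K : Set (((P₁ × P₂) × I) × I) :=
    {z | H₁ ((z.1.1.1, z.1.2), z.2) = H₂ ((z.1.1.2, z.1.2), z.2)}
  have hK : IsCompact K := by
    have c₁ : Continuous fun z : ((P₁ × P₂) × I) × I => H₁ ((z.1.1.1, z.1.2), z.2) :=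
      H₁.contMDiff.continuous.comp (by fun_prop)
    have c₂ : Continuous fun z : ((P₁ × P₂) × I) × I => H₂ ((z.1.1.2, z.1.2), z.2) :=
      H₂.contMDiff.continuous.comp (by fun_prop)
    exact (isClosed_eq c₁ c₂).isCompact
  obtain ⟨ε, hε, hKε⟩ := exists_collar hK (t := fun z => (z.1.2 : ℝ)) (by fun_prop) (by
    intro z hz
    have hz : H₁ ((z.1.1.1, z.1.2), z.2) = H₂ ((z.1.1.2, z.1.2), z.2) := hz
    refine ⟨lt_of_le_of_ne z.1.2.2.1 fun h => ?_, lt_of_le_of_ne z.1.2.2.2 fun h => ?_⟩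
    · have h0 : z.1.2 = 0 := Subtype.ext h.symm
      rw [h0, h3, h4] at hz
      exact Set.disjoint_left.1 hf ⟨_, rfl⟩ ⟨_, hz.symm⟩
    · have h0 : z.1.2 = 1 := Subtype.ext h
      rw [h0] at hz
      exact Set.disjoint_left.1 (h5 z.2) ⟨_, rfl⟩ ⟨_, hz.symm⟩)
  have hne : ∀ z : (P₁ × P₂) × (ℝ × ℝ), z.2.1 ∈ Set.Icc (0 : ℝ) 1 → z.2.1 ∉ Set.Icc ε (1 - ε) →
      onFst G.1 z ≠ onSnd G.2 z := by
    intro z hz hz' heq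
    refine hz' (hKε ((z.1, ⟨z.2.1, hz⟩), step 1 z.2.2) ?_)
    have h6 : Set.projIcc (0 : ℝ) 1 zero_le_one z.2.1 = ⟨z.2.1, hz⟩ := Set.projIcc_of_mem _ hz
    have h7 := heq
    simp only [onFst, onSnd, G, extendSquare, h6] at h7
    exact h7
  have hε1 := hε.1
  have hε2 := hε.2
  -- Besides the collars in t, where no coincidences occur, A contains the bands τ ≤ 3/10 and τ ≥
  -- 7/10, where the transverse lifts α and β provide transversality. As 3/10 lies between 1/4 and
  -- 1/3, these bands overlap the support 1/4 < τ < 3/4 of the deformation, while the families stay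
  -- fixed for τ < 1/4 and τ > 3/4.
  let A : Set ((P₁ × P₂) × (ℝ × ℝ)) := Set.univ ×ˢ ((Set.Icc (ε / 4) (3 * ε / 4) ∪
    Set.Icc (1 - 3 * ε / 4) (1 - ε / 4)) ×ˢ Set.Icc 0 1 ∪
      Set.Icc (ε / 4) (1 - ε / 4) ×ˢ (Set.Icc 0 (3 / 10) ∪ Set.Icc (7 / 10) 1))
  let C : Set ((P₁ × P₂) × (ℝ × ℝ)) :=
    Set.univ ×ˢ (Set.Icc (3 * ε / 4) (1 - 3 * ε / 4) ×ˢ Set.Icc (3 / 10) (7 / 10))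
  have hA : ∀ z ∈ A, z.2.1 ∈ Set.Ioo (0 : ℝ) 1 := by
    rintro z ⟨-, ⟨hz | hz, -⟩ | ⟨hz, -⟩⟩ <;> exact ⟨by linarith [hz.1], by linarith [hz.2]⟩
  have hAR : ∀ z ∈ A, FamilyTransverseAt (𝓡 p₁) (𝓡 p₂) n G.1 G.2 z := by
    intro z hzA
    have hz01 := hA z hzA
    obtain ⟨-, ⟨hz, -⟩ | ⟨-, hz | hz⟩⟩ := hzA
    · refine fun hc => absurd hc (hne z (Set.Ioo_subset_Icc_self hz01) fun hz' => ?_)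
      rcases hz with hz | hz
      · linarith [hz.2, hz'.1]
      · linarith [hz.1, hz'.2]
    · exact hGα.familyTransverseAt hf hα isOpen_Iio (lt_of_le_of_lt hz.2 (by norm_num)) hz01
    · exact hGβ.familyTransverseAt hf hβ isOpen_Ioi (lt_of_lt_of_le (by norm_num) hz.1) hz01
  obtain ⟨F', k1, k2, k3, k4⟩ := exists_transverse_deformation (I₁ := 𝓡 p₁) (I₂ := 𝓡 p₂) (n := n)
    (T₀ := Set.Ioo (0 : ℝ) 1 ×ˢ (Set.univ : Set ℝ))
    (O := Set.Ioo (ε / 2) (1 - ε / 2) ×ˢ Set.Ioo (1 / 4 : ℝ) (3 / 4))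
    (isOpen_Ioo.prod isOpen_univ) (isOpen_Ioo.prod isOpen_Ioo)
    (Set.prod_mono (Set.Ioo_subset_Ioo (by linarith) (by linarith)) (Set.subset_univ _)) (F := G)
    (contMDiffOn_extendSquare H₁) (contMDiffOn_extendSquare H₂) (A := A)
    (isCompact_univ.prod ((((isCompact_Icc.union isCompact_Icc).prod isCompact_Icc).union
      (isCompact_Icc.prod (isCompact_Icc.union isCompact_Icc)))))
    (fun z hz => ⟨trivial, hA z hz, trivial⟩) hAR (C := C)
    (isCompact_univ.prod (isCompact_Icc.prod isCompact_Icc))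
    (fun z hz => ⟨trivial, ⟨by linarith [hz.2.1.1], by linarith [hz.2.1.2]⟩,
      ⟨by linarith [hz.2.2.1], by linarith [hz.2.2.2]⟩⟩)
  have hoff := fun {t : ℝ × ℝ} => eqOn_of_reflTransGen k1 (t := t)
  obtain ⟨⟨K₁, hK₁, hKO₁, hfix₁⟩, ⟨K₂, hK₂, hKO₂, hfix₂⟩⟩ := exists_isCompact_of_reflTransGen k1
  have hsub : ∀ z : ℝ × ℝ, z ∈ Set.Ioo (ε / 2) (1 - ε / 2) ×ˢ Set.Ioo (1 / 4 : ℝ) (3 / 4) →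
      z ∈ Set.Ioo (0 : ℝ) 1 ×ˢ (Set.univ : Set ℝ) := fun z hz =>
    ⟨⟨by linarith [hz.1.1], by linarith [hz.1.2]⟩, trivial⟩
  refine ⟨F', k2, k3, ?_, ?_, fun x τ => ?_, fun x τ => ?_, fun t τ hτ => ?_, fun t τ hτ => ?_,
    fun z hz hτ hc => ?_, fun z hz hτ => ?_⟩
  -- Smoothness is known over the open interval of times only. Continuity elsewhere follows because
  -- the deformation is supported in a compact set lying over that interval.
  · refine continuous_iff_continuousAt.2 fun y => ?_
    by_cases hy : y ∈ K₁
    · exact k2.continuousOn.continuousAt ((isOpen_univ.prod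
        (isOpen_Ioo.prod isOpen_univ)).mem_nhds ⟨trivial, hsub _ (hKO₁ hy).2⟩)
    · refine hGc₁.continuousAt.congr ?_
      filter_upwards [hK₁.isClosed.isOpen_compl.mem_nhds hy] with w hw
      exact (hfix₁ w hw).symm
  · refine continuous_iff_continuousAt.2 fun y => ?_
    by_cases hy : y ∈ K₂
    · exact k3.continuousOn.continuousAt ((isOpen_univ.prod
        (isOpen_Ioo.prod isOpen_univ)).mem_nhds ⟨trivial, hsub _ (hKO₂ hy).2⟩)
    · refine hGc₂.continuousAt.congr ?_
      filter_upwards [hK₂.isClosed.isOpen_compl.mem_nhds hy] with w hw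
      exact (hfix₂ w hw).symm
  · rw [(hoff (fun h => by linarith [h.1.1])).1 x]
    simp only [G, extendSquare, Set.projIcc_left]
    exact h3 x _
  · rw [(hoff (fun h => by linarith [h.1.1])).2 x]
    simp only [G, extendSquare, Set.projIcc_left]
    exact h4 x _
  · have hτ' : τ < 1 / 4 := hτ
    have h6 := hoff (t := (t, τ)) (fun h => by linarith [h.2.1])
    have h7 := hGα t τ (show τ < 1 / 3 by linarith)
    exact ⟨fun x => (h6.1 x).trans (h7.1 x), fun x => (h6.2 x).trans (h7.2 x)⟩
  · have hτ' : 3 / 4 < τ := hτ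
    have h6 := hoff (t := (t, τ)) (fun h => by linarith [h.2.2])
    have h7 := hGβ t τ (show 2 / 3 < τ by linarith)
    exact ⟨fun x => (h6.1 x).trans (h7.1 x), fun x => (h6.2 x).trans (h7.2 x)⟩
  · by_contra hz'
    have h6 : z.2.1 ∉ Set.Icc ε (1 - ε) := fun h =>
      hz' ⟨by linarith [h.1], by linarith [h.2]⟩
    have h7 := hoff (t := z.2) (fun h => hz' (hsub z.2 h).1)
    refine hne z hz h6 ?_
    rw [onFst, onSnd, ← h7.1, ← h7.2]
    exact hc
  · by_cases hz1 : z.2.1 < ε / 4 ∨ 1 - ε / 4 < z.2.1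
    · have hz2 : z.2 ∉ Set.Ioo (ε / 2) (1 - ε / 2) ×ˢ Set.Ioo (1 / 4 : ℝ) (3 / 4) := by
        rintro ⟨⟨h2, h3⟩, -⟩
        rcases hz1 with h | h <;> linarith
      have hz3 : z.2.1 ∉ Set.Icc ε (1 - ε) := by
        rintro ⟨h2, h3⟩
        rcases hz1 with h | h <;> linarith
      have h7 := hoff hz2
      intro hc
      refine absurd ?_ (hne z (Set.Ioo_subset_Icc_self hz) hz3)
      rw [onFst, onSnd, ← h7.1, ← h7.2]
      exact hc
    · push Not at hz1
      refine k4 z ?_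
      by_cases h5 : z.2.1 ≤ 3 * ε / 4
      · exact .inl ⟨trivial, .inl ⟨.inl ⟨hz1.1, h5⟩, hτ⟩⟩
      by_cases h6 : 1 - 3 * ε / 4 ≤ z.2.1
      · exact .inl ⟨trivial, .inl ⟨.inr ⟨h6, hz1.2⟩, hτ⟩⟩
      by_cases h7 : z.2.2 ≤ 3 / 10
      · exact .inl ⟨trivial, .inr ⟨hz1, .inl ⟨hτ.1, h7⟩⟩⟩
      by_cases h8 : 7 / 10 ≤ z.2.2
      · exact .inl ⟨trivial, .inr ⟨hz1, .inr ⟨h8, hτ.2⟩⟩⟩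
      · exact .inr ⟨trivial, ⟨(not_le.1 h5).le, (not_le.1 h6).le⟩,
          ⟨(not_le.1 h7).le, (not_le.1 h8).le⟩⟩

end
end LinkMaps
end

/-! ### The normal splitting carried by a given linking cycle. -/

noncomputable section

namespace GeneralPosition
open Bundle StableCobordism

section

variable {E' : Type*} [NormedAddCommGroup E'] [NormedSpace ℝ E']
  {H' : Type*} [TopologicalSpace H'] {I' : ModelWithCorners ℝ E' H'}
  {W : Type*} [TopologicalSpace W] [ChartedSpace H' W] [IsManifold I' 1 W]
  {E : Type*} [NormedAddCommGroup E] [NormedSpace ℝ E]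
  {H : Type*} [TopologicalSpace H] {J : ModelWithCorners ℝ E H}
  {M : Type*} [TopologicalSpace M] [ChartedSpace H M] [IsManifold J 1 M]
  {n : ℕ} {N : Type*} [TopologicalSpace N] [ChartedSpace (EuclideanSpace ℝ (Fin n)) N]
  [IsManifold (𝓡 n) 1 N]
  {X : Type*} [TopologicalSpace X]
  (S : Type*) [NormedAddCommGroup S] [NormedSpace ℝ S]
  {Q : Type*} [NormedAddCommGroup Q] [NormedSpace ℝ Q]

/-- A linking cycle may come with any isomorphism. Its restriction to the summand TN has to be
recovered as a continuous family of tangent vectors, so that it can be extended over a film. -/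
theorem BundleIso.continuous_normal {f : C(W, X)} {e : C(X, N)} {pr : C(X, M)}
    (φ : BundleIso (E' × (EuclideanSpace ℝ (Fin n) × S))
      ((TangentSpace I' : W → Type _) ×ᵇ
        (Pull f (Pull e (TangentSpace (𝓡 n) : N → Type)) ×ᵇ Trivial W S))
      (E × Q) (Pull f (Pull pr (TangentSpace J : M → Type _)) ×ᵇ Trivial W Q))
    {Z : Type*} [TopologicalSpace Z]
    {l : Z → W} (hl : Continuous l) {η : Z → TangentBundle (𝓡 n) N} (hη : Continuous η)
    (h : ∀ z, (η z).proj = e (f (l z))) :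
    Continuous fun z => (tangentPoint J (pr (f (l z)))
      (show E × Q from φ.toEquiv (l z) ((0 : E'), ((η z).snd : EuclideanSpace ℝ (Fin n)),
        (0 : S))).1,
      (show E × Q from φ.toEquiv (l z) ((0 : E'), ((η z).snd : EuclideanSpace ℝ (Fin n)),
        (0 : S))).2) := by
  let q : Z → TotalSpace (E' × (EuclideanSpace ℝ (Fin n) × S))
      ((TangentSpace I' : W → Type _) ×ᵇ
        (Pull f (Pull e (TangentSpace (𝓡 n) : N → Type)) ×ᵇ Trivial W S)) :=
    fun z => ⟨l z, ((0 : E'), ((η z).snd : EuclideanSpace ℝ (Fin n)), (0 : S))⟩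
  have hq : Continuous q := by
    rw [(FiberBundle.Prod.isInducing_diag E' (TangentSpace I' : W → Type _)
      (EuclideanSpace ℝ (Fin n) × S)
      (Pull f (Pull e (TangentSpace (𝓡 n) : N → Type)) ×ᵇ Trivial W S)).continuous_iff]
    refine Continuous.prodMk (continuous_iff_continuousAt.2 fun z =>
      continuousAt_tangentPoint_zero (J := I') hl.continuousAt) ?_
    rw [(FiberBundle.Prod.isInducing_diag (EuclideanSpace ℝ (Fin n))
      (Pull f (Pull e (TangentSpace (𝓡 n) : N → Type))) S (Trivial W S)).continuous_iff]
    refine Continuous.prodMk ?_ ?_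
    · rw [(inducing_pullbackTotalSpaceEmbedding (EuclideanSpace ℝ (Fin n))
        (Pull e (TangentSpace (𝓡 n) : N → Type)) f).continuous_iff]
      refine hl.prodMk ?_
      rw [(inducing_pullbackTotalSpaceEmbedding (EuclideanSpace ℝ (Fin n))
        (TangentSpace (𝓡 n) : N → Type) e).continuous_iff]
      refine (f.continuous.comp hl).prodMk (hη.congr fun z => ?_)
      have h1 : ∀ (p : TangentBundle (𝓡 n) N) (y : N), p.proj = y →
          p = tangentPoint (𝓡 n) y p.snd := by
        rintro ⟨y, v⟩ _ rfl
        rfl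
      exact h1 _ _ (h z)
    · rw [(Bundle.Trivial.isInducing_toProd W S).continuous_iff]
      exact hl.prodMk continuous_const
  have h1 := φ.continuous_total.comp hq
  have h2 := (FiberBundle.Prod.isInducing_diag E
    (Pull f (Pull pr (TangentSpace J : M → Type _))) Q (Trivial W Q)).continuous.comp h1
  have h3 := (Pullback.continuous_lift E (TangentSpace J : M → Type _) pr).comp
    ((Pullback.continuous_lift E (Pull pr (TangentSpace J : M → Type _)) f).comp h2.fst)
  have h4 := ((Bundle.Trivial.isInducing_toProd W Q).continuous.comp h2.snd).snd
  exact h3.prodMk h4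

end
end GeneralPosition

namespace LinkMaps
open GeneralPosition StableCobordism Bundle

section

variable {p₁ p₂ n : ℕ}
  {P₁ : Type u} [TopologicalSpace P₁] [ChartedSpace (EuclideanSpace ℝ (Fin p₁)) P₁] [T2Space P₁]
  [IsManifold (𝓡 p₁) ∞ P₁] [CompactSpace P₁]
  {P₂ : Type u} [TopologicalSpace P₂] [ChartedSpace (EuclideanSpace ℝ (Fin p₂)) P₂] [T2Space P₂]
  [IsManifold (𝓡 p₂) ∞ P₂] [CompactSpace P₂]
  {N : Type v} [TopologicalSpace N] [ChartedSpace (EuclideanSpace ℝ (Fin n)) N]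
  [IsManifold (𝓡 n) ∞ N] [T2Space N]
  {f₁ : SmoothMap p₁ n P₁ N} {f₂ : SmoothMap p₂ n P₂ N}

namespace LinkingCycle

/-- The stable isomorphism of a cycle as a map of model spaces. -/
def model (L : LinkingCycle f₁ f₂) (w : L.W) :
    EuclideanSpace ℝ (Fin (p₁ + p₂ + 1 - n)) × (EuclideanSpace ℝ (Fin n) × (Fin 0 → ℝ)) →L[ℝ]
      (EuclideanSpace ℝ (Fin p₁) × EuclideanSpace ℝ (Fin p₂)) × (Fin 1 → ℝ) :=
  (L.φ.toEquiv w).toContinuousLinearMap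

/-- The restriction of the stable isomorphism of a cycle to the tangent spaces of `N`. -/
def normal (L : LinkingCycle f₁ f₂) (w : L.W) : EuclideanSpace ℝ (Fin n) →L[ℝ]
    (EuclideanSpace ℝ (Fin p₁) × EuclideanSpace ℝ (Fin p₂)) × ℝ :=
  ((ContinuousLinearMap.id ℝ _).prodMap (ContinuousLinearMap.proj 0)).comp
    ((L.model w).comp ((ContinuousLinearMap.inr ℝ _ _).comp (ContinuousLinearMap.inl ℝ _ _)))

theorem continuous_normal (L : LinkingCycle f₁ f₂) {Z : Type*} [TopologicalSpace Z]
    {l : Z → L.W} (hl : Continuous l) {η : Z → TangentBundle (𝓡 n) N} (hη : Continuous η)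
    (h : ∀ z, (η z).proj = HoPullback.eval f₁ f₂ (L.f (l z))) :
    Continuous fun z => (tangentPoint ((𝓡 p₁).prod (𝓡 p₂)) (L.base (l z))
      (L.normal (l z) (η z).snd).1, (L.normal (l z) (η z).snd).2) := by
  have h1 := BundleIso.continuous_normal (J := (𝓡 p₁).prod (𝓡 p₂)) (Fin 0 → ℝ) L.φ hl hη h
  exact h1.fst.prodMk ((continuous_apply (0 : Fin 1)).comp h1.snd)

variable {L : LinkingCycle f₁ f₂} {α : Lift f₁ f₂} {t : L.W → I}

namespace IsPreimage

theorem mem_coincidence (hL : L.IsPreimage α t) (w : L.W) : (L.base w, t w) ∈ α.coincidence := by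
  rw [← hL.range_eq]
  exact ⟨w, rfl⟩

/-- This is the normalization `φ_normal` of the cycle, expressed over the line: the normal part of
the isomorphism is a right inverse of the difference of derivatives. -/
theorem diffDeriv_normal (hf : IsLinkMap f₁ f₂) (hL : L.IsPreimage α t) (w : L.W)
    (u : EuclideanSpace ℝ (Fin n)) :
    diffDeriv (((𝓡 p₁).prod (𝓡 p₂)).prod 𝓘(ℝ)) n (onFst α.extend.1) (onSnd α.extend.2)
      (L.base w, (t w : ℝ)) (L.normal w u) = u := by
  have h1 := α.pairDeriv_apply (z := (L.base w, t w))
    (α.mem_Ioo_of_mem_coincidence hf (hL.mem_coincidence w)) (L.normal w u).1 (L.normal w u).2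
  exact (congrArg (fun q => q.2 - q.1) h1).symm.trans (hL.φ_normal w u)

theorem eval_eq (hL : L.IsPreimage α t) (w : L.W) :
    HoPullback.eval f₁ f₂ (L.f w) = onFst α.extend.1 (L.base w, (t w : ℝ)) :=
  (hL.path_left w ⟨0, by norm_num⟩ (t w) le_rfl (by simp)).trans
    (extendPath_coe α.F₁ _ (t w)).symm

theorem isEmbedding (hL : L.IsPreimage α t) :
    Topology.IsEmbedding fun w => (L.base w, t w) :=
  (hL.contMDiff.continuous.isClosedEmbedding hL.injective).isEmbedding

/-- Near an end of a film, the normal structure of the end extends to the film. -/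
theorem exists_local_right_inverse (hf : IsLinkMap f₁ f₂) (hL : L.IsPreimage α t)
    {F : (P₁ × (ℝ × ℝ) → N) × (P₂ × (ℝ × ℝ) → N)} {V : Set ℝ} (hV : IsOpen V)
    (hF : RestrictsTo F α V) {W : Type*} [TopologicalSpace W]
    {i : W → (P₁ × P₂) × (ℝ × ℝ)} (hi : Continuous i)
    (hc : ∀ w, onFst F.1 (i w) = onSnd F.2 (i w)) (ht : ∀ w, (i w).2.1 ∈ Set.Ioo (0 : ℝ) 1)
    {y : W → N} (hy : ∀ w, onFst F.1 (i w) = y w) {w₀ : W} (hw₀ : (i w₀).2.2 ∈ V) :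
    ∃ s : W → EuclideanSpace ℝ (Fin n) →L[ℝ]
        (EuclideanSpace ℝ (Fin p₁) × EuclideanSpace ℝ (Fin p₂)) × (ℝ × ℝ),
      (∀ w, (i w).2.2 ∈ V → (∀ u, diffDeriv (((𝓡 p₁).prod (𝓡 p₂)).prod 𝓘(ℝ, ℝ × ℝ)) n
        (onFst F.1) (onSnd F.2) (i w) (s w u) = u) ∧
        ∀ l : L.W, L.base l = (i w).1 → (t l : ℝ) = (i w).2.1 → ∀ u,
          s w u = ((L.normal l u).1, ((L.normal l u).2, 0))) ∧
      ∀ q : PulledTangent n y, (i q.1.1).2.2 ∈ V →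
        ContinuousAt (familyMap ((𝓡 p₁).prod (𝓡 p₂)) (fun w => (i w).1) y s) q := by
  -- Over V the families restrict to α, so forgetting the second parameter maps coincidences of the
  -- families to coincidences of α, that is, to points of L.
  have hex : ∀ w, (i w).2.2 ∈ V → ∃ l : L.W, (L.base l, t l) =
      ((i w).1, (⟨(i w).2.1, Set.Ioo_subset_Icc_self (ht w)⟩ : I)) := by
    intro w hw
    have h1 : ((i w).1, (⟨(i w).2.1, Set.Ioo_subset_Icc_self (ht w)⟩ : I)) ∈ α.coincidence := by
      rw [← α.onFst_extend_eq_iff]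
      have h2 := hF.eventually hV hw
      exact h2.1.self_of_nhds.symm.trans ((hc w).trans h2.2.self_of_nhds)
    rw [← hL.range_eq] at h1
    exact h1
  have : Nonempty L.W := ⟨(hex w₀ hw₀).choose⟩
  have hex' : ∀ w, ∃ l : L.W, (i w).2.2 ∈ V → (L.base l, t l) =
      ((i w).1, (⟨(i w).2.1, Set.Ioo_subset_Icc_self (ht w)⟩ : I)) := fun w => by
    by_cases hw : (i w).2.2 ∈ V
    · obtain ⟨l, hl⟩ := hex w hw
      exact ⟨l, fun _ => hl⟩
    · exact ⟨Classical.arbitrary _, fun h => absurd h hw⟩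
  choose l hl using hex'
  -- The splitting of L is used at every level in V, with zero component in the direction of the
  -- homotopy parameter.
  let A : (EuclideanSpace ℝ (Fin p₁) × EuclideanSpace ℝ (Fin p₂)) × ℝ →L[ℝ]
      (EuclideanSpace ℝ (Fin p₁) × EuclideanSpace ℝ (Fin p₂)) × (ℝ × ℝ) :=
    (ContinuousLinearMap.id ℝ _).prodMap (ContinuousLinearMap.inl ℝ ℝ ℝ)
  have hl₁ : ∀ w, (i w).2.2 ∈ V → L.base (l w) = (i w).1 := fun w hw =>
    (congrArg Prod.fst (hl w hw) :)
  have hl₂ : ∀ w, (i w).2.2 ∈ V → (t (l w) : ℝ) = (i w).2.1 := fun w hw =>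
    congrArg Subtype.val (congrArg Prod.snd (hl w hw) :)
  refine ⟨fun w => A.comp (L.normal (l w)), fun w hw => ⟨fun u => ?_, fun l' h1 h2 u => ?_⟩,
    fun q hq => ?_⟩
  · rw [hF.diffDeriv hV hw (ht w)]
    have h1 := hL.diffDeriv_normal hf (l w) u
    have h2 : (L.base (l w), (t (l w) : ℝ)) = forgetParam (i w) :=
      Prod.ext (hl₁ w hw) (hl₂ w hw)
    rw [h2] at h1
    exact h1
  · have h3 : l w = l' := hL.injective
      (Prod.ext ((hl₁ w hw).trans h1.symm) (Subtype.ext ((hl₂ w hw).trans h2.symm)))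
    rw [← h3]
    rfl
  · let U : Set (PulledTangent n y) := {q | (i q.1.1).2.2 ∈ V}
    have hU : IsOpen U := hV.preimage (by fun_prop : Continuous fun q : PulledTangent n y =>
      (i q.1.1).2.2)
    -- The projection to L is continuous since L is embedded in P₁ × P₂ × I.
    have hlc : Continuous fun z : U => l z.1.1.1 := by
      rw [hL.isEmbedding.isInducing.continuous_iff]
      have h1 : Continuous fun z : U => ((i z.1.1.1).1,
          (⟨(i z.1.1.1).2.1, Set.Ioo_subset_Icc_self (ht z.1.1.1)⟩ : I)) := by
        fun_prop
      exact h1.congr fun z => (hl z.1.1.1 z.2).symm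
    have h2 : ∀ z : U, (z.1.1.2).proj = HoPullback.eval f₁ f₂ (L.f (l z.1.1.1)) := fun z => by
      rw [hL.eval_eq, z.1.2, ← hy]
      have h3 : (L.base (l z.1.1.1), (t (l z.1.1.1) : ℝ)) = forgetParam (i z.1.1.1) :=
        Prod.ext (hl₁ _ z.2) (hl₂ _ z.2)
      rw [h3]
      exact (hF.eventually hV z.2).1.self_of_nhds
    have h4 := L.continuous_normal hlc (by fun_prop : Continuous fun z : U => z.1.1.2) h2
    have h5 : Continuous fun z : U =>
        familyMap ((𝓡 p₁).prod (𝓡 p₂)) (fun w => (i w).1) y (fun w => A.comp (L.normal (l w))) z.1 := by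
      refine (h4.fst.prodMk (h4.snd.prodMk (continuous_const (y := (0 : ℝ))))).congr fun z => ?_
      refine Prod.ext ?_ rfl
      exact congrArg (fun b => tangentPoint ((𝓡 p₁).prod (𝓡 p₂)) b
        (L.normal (l z.1.1.1) z.1.1.2.snd).1) (hl₁ _ z.2)
    exact (hU.isOpenEmbedding_subtypeVal.continuousAt_iff (x := ⟨q, hq⟩)).1 h5.continuousAt

end IsPreimage
end LinkingCycle

end
end LinkMaps
end

/-! ### The coincidences of a homotopy as a film, and its ends. -/

noncomputable section

namespace LinkMaps
open GeneralPosition StableCobordism Bundle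

section

variable {p₁ p₂ n : ℕ}
  {P₁ : Type u} [TopologicalSpace P₁] [ChartedSpace (EuclideanSpace ℝ (Fin p₁)) P₁] [T2Space P₁]
  [IsManifold (𝓡 p₁) ∞ P₁] [CompactSpace P₁]
  {P₂ : Type u} [TopologicalSpace P₂] [ChartedSpace (EuclideanSpace ℝ (Fin p₂)) P₂] [T2Space P₂]
  [IsManifold (𝓡 p₂) ∞ P₂] [CompactSpace P₂]
  {N : Type v} [TopologicalSpace N] [ChartedSpace (EuclideanSpace ℝ (Fin n)) N]
  [IsManifold (𝓡 n) ∞ N] [T2Space N]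
  {f₁ : SmoothMap p₁ n P₁ N} {f₂ : SmoothMap p₂ n P₂ N}
  {F : (P₁ × (ℝ × ℝ) → N) × (P₂ × (ℝ × ℝ) → N)}

variable (F) in
/-- The coincidences of two families of maps for parameters in the square. -/
abbrev squareCoincidence : Set ((P₁ × P₂) × (ℝ × ℝ)) :=
  coincidenceSlab (Set.univ ×ˢ (Set.Ioo (0 : ℝ) 1 ×ˢ Set.univ)) (onFst F.1) (onSnd F.2)
    fun z => z.2.2

variable (F) in
/-- An atlas which makes the set of coincidences a manifold with boundary. -/
abbrev FilmAtlas :=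
  SliceAtlas (((𝓡 p₁).prod (𝓡 p₂)).prod 𝓘(ℝ, ℝ × ℝ)) (𝓡∂ (p₁ + p₂ + 1 - n + 1))
    (EuclideanSpace ℝ (Fin n)) (squareCoincidence F)

/-- Stable isomorphisms of films. -/
abbrev FilmIso (S : FilmAtlas (p₁ := p₁) (p₂ := p₂) (n := n) F)
    (f : C(S.Carrier, HoPullback f₁ f₂)) :=
  BundleIso (EuclideanSpace ℝ (Fin (p₁ + p₂ + 1 - n + 1)) ×
      (EuclideanSpace ℝ (Fin n) × ((Fin 0 → ℝ) × (Fin 0 → ℝ))))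
    ((TangentSpace (𝓡∂ (p₁ + p₂ + 1 - n + 1)) : S.Carrier → Type) ×ᵇ
      (Pull f (Pull (HoPullback.eval f₁ f₂) (TangentSpace (𝓡 n) : N → Type)) ×ᵇ
        Trivial S.Carrier ((Fin 0 → ℝ) × (Fin 0 → ℝ))))
    ((EuclideanSpace ℝ (Fin p₁) × EuclideanSpace ℝ (Fin p₂)) ×
      ((Fin 1 → ℝ) × (ℝ × (Fin 0 → ℝ))))
    (Pull f (Pull (HoPullback.proj f₁ f₂)
      (TangentSpace ((𝓡 p₁).prod (𝓡 p₂)) : P₁ × P₂ → Type)) ×ᵇ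
        Trivial S.Carrier ((Fin 1 → ℝ) × (ℝ × (Fin 0 → ℝ))))

theorem contMDiff_snd_snd_incl (S : FilmAtlas (p₁ := p₁) (p₂ := p₂) (n := n) F) :
    ContMDiff (𝓡∂ (p₁ + p₂ + 1 - n + 1)) 𝓘(ℝ) ∞ fun w => (S.incl w).2.2 :=
  contMDiff_snd_snd.comp S.contMDiff_incl

/-- The film of the coincidences of two families of maps. -/
abbrev slabFilm (S : FilmAtlas (p₁ := p₁) (p₂ := p₂) (n := n) F) [CompactSpace S.Carrier]
    [T2Space S.Carrier]
    (hS : ∀ w, w ∈ (𝓡∂ (p₁ + p₂ + 1 - n + 1)).boundary S.Carrier ↔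
      (S.incl w).2.2 = 0 ∨ (S.incl w).2.2 = 1)
    (f : C(S.Carrier, HoPullback f₁ f₂)) (φ : FilmIso S f) :
    Film.{u} (EuclideanSpace ℝ (Fin n))
    (Pull (HoPullback.eval f₁ f₂) (TangentSpace (𝓡 n) : N → Type))
    (EuclideanSpace ℝ (Fin p₁) × EuclideanSpace ℝ (Fin p₂))
    (Pull (HoPullback.proj f₁ f₂) (TangentSpace ((𝓡 p₁).prod (𝓡 p₂)) : P₁ × P₂ → Type))
    (p₁ + p₂ + 1 - n) 0 1 where
  W := S.Carrier
  s w := (S.incl w).2.2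
  contMDiff_s := contMDiff_snd_snd_incl S
  s_mem w := (S.incl_mem w).2
  boundary_eq := Set.ext hS
  f := f
  m := 0
  φ := φ

/-- The identification of the trivial summand of a film. -/
def filmEquiv : (ℝ × ℝ) ≃L[ℝ] (Fin 1 → ℝ) × (ℝ × (Fin 0 → ℝ)) :=
  LinearEquiv.toContinuousLinearEquiv
    { toFun := fun q => (fun _ => q.1, (q.2, 0))
      invFun := fun q => (q.1 0, q.2.1)
      map_add' := fun _ _ => Prod.ext rfl (Prod.ext rfl (Subsingleton.elim _ _))
      map_smul' := fun _ _ => Prod.ext rfl (Prod.ext rfl (Subsingleton.elim _ _))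
      left_inv := fun _ => rfl
      right_inv := fun q => Prod.ext (funext fun _ => congrArg q.1 (Subsingleton.elim _ _))
        (Prod.ext rfl (Subsingleton.elim _ _)) }

/-- The derivative of the inclusion of a film. -/
def filmDeriv (S : FilmAtlas (p₁ := p₁) (p₂ := p₂) (n := n) F) (w : S.Carrier) :
    EuclideanSpace ℝ (Fin (p₁ + p₂ + 1 - n + 1)) →L[ℝ]
      (EuclideanSpace ℝ (Fin p₁) × EuclideanSpace ℝ (Fin p₂)) × (ℝ × ℝ) :=
  pairModelDeriv (𝓡∂ (p₁ + p₂ + 1 - n + 1)) ((𝓡 p₁).prod (𝓡 p₂)) (fun w => (S.incl w).1)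
    (fun w => (S.incl w).2) w

theorem hasMFDerivAt_filmIncl (S : FilmAtlas (p₁ := p₁) (p₂ := p₂) (n := n) F) (w : S.Carrier) :
    HasMFDerivAt (𝓡∂ (p₁ + p₂ + 1 - n + 1)) (((𝓡 p₁).prod (𝓡 p₂)).prod 𝓘(ℝ, ℝ × ℝ)) S.incl w
      (filmDeriv S w) :=
  hasMFDerivAt_pair ((contMDiff_fst.comp S.contMDiff_incl).mdifferentiable (by simp) w)
    ((contMDiff_snd.comp S.contMDiff_incl).mdifferentiable (by simp) w)

theorem mfderiv_snd_snd_incl (S : FilmAtlas (p₁ := p₁) (p₂ := p₂) (n := n) F) (w : S.Carrier)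
    (v : EuclideanSpace ℝ (Fin (p₁ + p₂ + 1 - n + 1))) :
    (mfderiv (𝓡∂ (p₁ + p₂ + 1 - n + 1)) 𝓘(ℝ) (fun w => (S.incl w).2.2) w v : ℝ) =
      (filmDeriv S w v).2.2 := by
  have h1 := HasMFDerivAt.comp (I' := ((𝓡 p₁).prod (𝓡 p₂)).prod 𝓘(ℝ, ℝ × ℝ)) w
    (g := fun z : (P₁ × P₂) × (ℝ × ℝ) => z.2.2) (f := S.incl)
    (contMDiff_snd_snd.mdifferentiable (by simp) _).hasMFDerivAt (hasMFDerivAt_filmIncl S w)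
  exact (DFunLike.congr_fun h1.mfderiv v).trans
    (mfderiv_snd_snd (J := (𝓡 p₁).prod (𝓡 p₂)) (S.incl w) (filmDeriv S w v))

theorem LinkingCycle.injective_model (L : LinkingCycle f₁ f₂) (w : L.W) :
    Function.Injective (L.model w) := (L.φ.toEquiv w).injective

/-- By linearity, the whole isomorphism of a cycle is the derivative of the inclusion on TL plus its
normal part on TN. -/
theorem LinkingCycle.model_apply {L : LinkingCycle f₁ f₂} {α : Lift f₁ f₂} {t : L.W → I}
    (hL : L.IsPreimage α t) (w : L.W) (v : EuclideanSpace ℝ (Fin (p₁ + p₂ + 1 - n)))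
    (u : EuclideanSpace ℝ (Fin n)) (y : Fin 0 → ℝ) :
    L.model w (v, (u, y)) =
      ((pairModelDeriv (𝓡 (p₁ + p₂ + 1 - n)) ((𝓡 p₁).prod (𝓡 p₂)) L.base (fun w => (t w : ℝ)) w v +
        L.normal w u).1, fun _ => (pairModelDeriv (𝓡 (p₁ + p₂ + 1 - n)) ((𝓡 p₁).prod (𝓡 p₂)) L.base
          (fun w => (t w : ℝ)) w v + L.normal w u).2) := by
  have h1 : (v, (u, y)) = (v, ((0 : EuclideanSpace ℝ (Fin n)), (0 : Fin 0 → ℝ))) +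
      ((0 : EuclideanSpace ℝ (Fin (p₁ + p₂ + 1 - n))), (u, (0 : Fin 0 → ℝ))) :=
    Prod.ext (add_zero v).symm (Prod.ext (zero_add u).symm (Subsingleton.elim _ _))
  rw [h1, map_add]
  have h2 : L.model w (v, ((0 : EuclideanSpace ℝ (Fin n)), (0 : Fin 0 → ℝ))) = _ := hL.φ_tangent w v
  rw [h2]
  refine Prod.ext rfl (funext fun i => ?_)
  obtain rfl : i = 0 := Subsingleton.elim _ _
  rfl

/-- All fibres are the model space as types, so elements of the total space may be compared by base
point and component. -/
theorem mk_proj_congr {x y : HoPullback f₁ f₂} (h : x = y)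
    {a b : EuclideanSpace ℝ (Fin p₁) × EuclideanSpace ℝ (Fin p₂)} (h' : a = b) :
    (⟨x, a⟩ : TotalSpace (EuclideanSpace ℝ (Fin p₁) × EuclideanSpace ℝ (Fin p₂))
      (Pull (HoPullback.proj f₁ f₂) (TangentSpace ((𝓡 p₁).prod (𝓡 p₂)) : P₁ × P₂ → Type))) =
      ⟨y, b⟩ := by
  subst h h'
  rfl

set_option maxHeartbeats 800000 in
/-- A linking cycle of a lift is an end of a film which restricts to the lift. -/
theorem LinkingCycle.IsPreimage.exists_isEnd (hf : IsLinkMap f₁ f₂) {L : LinkingCycle f₁ f₂}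
    {α : Lift f₁ f₂} {t : L.W → I} (hL : L.IsPreimage α t) {V : Set ℝ} (hV : IsOpen V)
    (hF : RestrictsTo F α V) {r : ℝ} (hrV : r ∈ V) (hr : r ∈ Set.Icc (0 : ℝ) 1)
    (S : FilmAtlas (p₁ := p₁) (p₂ := p₂) (n := n) F) [CompactSpace S.Carrier]
    [T2Space S.Carrier]
    (hS : ∀ w, w ∈ (𝓡∂ (p₁ + p₂ + 1 - n + 1)).boundary S.Carrier ↔
      (S.incl w).2.2 = 0 ∨ (S.incl w).2.2 = 1)
    (f : C(S.Carrier, HoPullback f₁ f₂)) (φ : FilmIso S f)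
    (hp : ∀ w, HoPullback.proj f₁ f₂ (f w) = (S.incl w).1)
    (hl : ∀ w (a : Set.Icc (-1 : ℝ) 1) (τ : I), (a : ℝ) ≤ 0 → (τ : ℝ) = (1 + a) * (S.incl w).2.1 →
      (f w).1.2.2 a = F.1 ((S.incl w).1.1, ((τ : ℝ), (S.incl w).2.2)))
    (hr' : ∀ w (a : Set.Icc (-1 : ℝ) 1) (τ : I), 0 ≤ (a : ℝ) →
      (τ : ℝ) = (1 - a) * (S.incl w).2.1 →
      (f w).1.2.2 a = F.2 ((S.incl w).1.2, ((τ : ℝ), (S.incl w).2.2)))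
    {s : S.Carrier → EuclideanSpace ℝ (Fin n) →L[ℝ]
        (EuclideanSpace ℝ (Fin p₁) × EuclideanSpace ℝ (Fin p₂)) × (ℝ × ℝ)}
    (hs : ∀ w u, diffDeriv (((𝓡 p₁).prod (𝓡 p₂)).prod 𝓘(ℝ, ℝ × ℝ)) n (onFst F.1) (onSnd F.2)
      (S.incl w) (s w u) = u)
    (hs' : ∀ w, (S.incl w).2.2 = r → ∀ l : L.W, L.base l = (S.incl w).1 →
      (t l : ℝ) = (S.incl w).2.1 → ∀ u, s w u = ((L.normal l u).1, ((L.normal l u).2, 0)))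
    (hDA : ∀ w v, diffDeriv (((𝓡 p₁).prod (𝓡 p₂)).prod 𝓘(ℝ, ℝ × ℝ)) n (onFst F.1) (onSnd F.2)
      (S.incl w) (filmDeriv S w v) = 0)
    (hbij : ∀ w, Function.Bijective fun p : EuclideanSpace ℝ (Fin (p₁ + p₂ + 1 - n + 1)) ×
      EuclideanSpace ℝ (Fin n) => filmDeriv S w p.1 + s w p.2)
    (hφ : ∀ (w : S.Carrier) (p : EuclideanSpace ℝ (Fin (p₁ + p₂ + 1 - n + 1)) ×
      (EuclideanSpace ℝ (Fin n) × ((Fin 0 → ℝ) × (Fin 0 → ℝ)))), φ.toEquiv w p =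
      ((filmDeriv S w p.1 + s w p.2.1).1, filmEquiv (filmDeriv S w p.1 + s w p.2.1).2)) :
    ∃ ι : L.W → S.Carrier, IsEnd (slabFilm S hS f φ) L r ι := by
  have ht : ∀ l, (t l : ℝ) ∈ Set.Ioo (0 : ℝ) 1 := fun l =>
    α.mem_Ioo_of_mem_coincidence hf (hL.mem_coincidence l)
  -- The end is L placed at the level r.
  let g : L.W → (P₁ × P₂) × (ℝ × ℝ) := fun l => (L.base l, ((t l : ℝ), r))
  have hg : ∀ l, g l ∈ squareCoincidence F := fun l => by
    have h1 := hF.eventually hV (z := g l) hrV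
    exact ⟨⟨⟨trivial, ht l, trivial⟩, h1.1.self_of_nhds.trans
      (((α.onFst_extend_eq_iff _).2 (hL.mem_coincidence l)).trans h1.2.self_of_nhds.symm)⟩, hr⟩
  let ι : L.W → S.Carrier := fun l => S.point (g l) (hg l)
  have hbs : ContMDiff (𝓡 (p₁ + p₂ + 1 - n)) ((𝓡 p₁).prod (𝓡 p₂)) ∞ L.base :=
    contMDiff_fst.comp hL.contMDiff
  have hts : ContMDiff (𝓡 (p₁ + p₂ + 1 - n)) 𝓘(ℝ) ∞ fun l => (t l : ℝ) :=
    contMDiff_coe_interval.comp (contMDiff_snd.comp hL.contMDiff)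
  have hgs : ContMDiff (𝓡 (p₁ + p₂ + 1 - n)) (((𝓡 p₁).prod (𝓡 p₂)).prod 𝓘(ℝ, ℝ × ℝ)) ∞ g :=
    hbs.prodMk (hts.prodMk_space contMDiff_const)
  have hιs : ContMDiff (𝓡 (p₁ + p₂ + 1 - n)) (𝓡∂ (p₁ + p₂ + 1 - n + 1)) ∞ ι :=
    S.contMDiff_of_incl_comp hgs
  let B : ∀ l : L.W, EuclideanSpace ℝ (Fin (p₁ + p₂ + 1 - n)) →L[ℝ]
      EuclideanSpace ℝ (Fin (p₁ + p₂ + 1 - n + 1)) := fun l =>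
    mfderiv (𝓡 (p₁ + p₂ + 1 - n)) (𝓡∂ (p₁ + p₂ + 1 - n + 1)) ι l
  let b : ∀ l : L.W, EuclideanSpace ℝ (Fin (p₁ + p₂ + 1 - n)) →L[ℝ]
      EuclideanSpace ℝ (Fin p₁) × EuclideanSpace ℝ (Fin p₂) := fun l =>
    mfderiv (𝓡 (p₁ + p₂ + 1 - n)) ((𝓡 p₁).prod (𝓡 p₂)) L.base l
  let c : ∀ l : L.W, EuclideanSpace ℝ (Fin (p₁ + p₂ + 1 - n)) →L[ℝ] ℝ := fun l =>
    mfderiv (𝓡 (p₁ + p₂ + 1 - n)) 𝓘(ℝ) (fun l => (t l : ℝ)) l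
  have hB : ∀ l v, filmDeriv S (ι l) (B l v) = (b l v, (c l v, 0)) := by
    intro l v
    have h1 := HasMFDerivAt.comp (I' := 𝓡∂ (p₁ + p₂ + 1 - n + 1)) l (g := S.incl) (f := ι)
      (hasMFDerivAt_filmIncl S (ι l)) (hιs.mdifferentiable (by simp) l).hasMFDerivAt
    have h2 : HasMFDerivAt (𝓡 (p₁ + p₂ + 1 - n)) 𝓘(ℝ, ℝ × ℝ) (fun l => ((t l : ℝ), r)) l
        ((ContinuousLinearMap.inl ℝ ℝ ℝ).comp (c l)) :=
      HasMFDerivAt.comp (I' := 𝓘(ℝ)) l (g := fun x : ℝ => (x, r)) (f := fun l => (t l : ℝ))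
        (hasFDerivAt_prodMk_left (𝕜 := ℝ) (t l : ℝ) r).hasMFDerivAt
        (hts.mdifferentiable (by simp) l).hasMFDerivAt
    have h3 : HasMFDerivAt (𝓡 (p₁ + p₂ + 1 - n)) (((𝓡 p₁).prod (𝓡 p₂)).prod 𝓘(ℝ, ℝ × ℝ)) g l
        ((b l).prod ((ContinuousLinearMap.inl ℝ ℝ ℝ).comp (c l))) := (hbs.mdifferentiable (by simp) l).hasMFDerivAt.prodMk h2
    exact DFunLike.congr_fun (hasMFDerivAt_unique h1 h3) v
  have hLt : ∀ l v, L.model l (v, (0, 0)) = (b l v, fun _ => c l v) := hL.φ_tangent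
  have hfι : ∀ l, f (ι l) = L.f l := by
    intro l
    have h1 : HoPullback.proj f₁ f₂ (f (ι l)) = HoPullback.proj f₁ f₂ (L.f l) := hp (ι l)
    refine Subtype.ext (Prod.ext (congrArg Prod.fst h1 :) (Prod.ext (congrArg Prod.snd h1 :) ?_))
    refine ContinuousMap.ext fun a => ?_
    have ha := a.2
    rcases le_total (a : ℝ) 0 with h2 | h2
    · let τ : I := ⟨(1 + a) * t l, mul_nonneg (by linarith [ha.1]) (ht l).1.le,
        mul_le_one₀ (by linarith) (ht l).1.le (ht l).2.le⟩
      refine (hl (ι l) a τ h2 rfl).trans (Eq.trans ?_ (hL.path_left l a τ h2 rfl).symm)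
      exact ((hF (τ : ℝ) r hrV).1 _).trans (extendPath_coe α.F₁ _ τ)
    · let τ : I := ⟨(1 - a) * t l, mul_nonneg (by linarith [ha.2]) (ht l).1.le,
        mul_le_one₀ (by linarith) (ht l).1.le (ht l).2.le⟩
      refine (hr' (ι l) a τ h2 rfl).trans (Eq.trans ?_ (hL.path_right l a τ h2 rfl).symm)
      exact ((hF (τ : ℝ) r hrV).2 _).trans (extendPath_coe α.F₂ _ τ)
  -- The unit vector in the direction of the homotopy parameter is tangent to the film. Write it as
  -- di(p.1) + s(p.2); the difference of derivatives kills it, because the families are constant in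
  -- that direction, and it kills di(p.1), so p.2 = 0. This vector serves as ν, with ds(ν) = 1.
  have hν : ∀ l, ∃ v, filmDeriv S (ι l) v = (0, ((0 : ℝ), (1 : ℝ))) := by
    intro l
    obtain ⟨p, hp⟩ := (hbij (ι l)).2 (0, ((0 : ℝ), (1 : ℝ)))
    have h1 := hF.diffDeriv hV (z := S.incl (ι l)) hrV (ht l) (0, ((0 : ℝ), (1 : ℝ)))
    have h2 := h1.trans (map_zero (diffDeriv (((𝓡 p₁).prod (𝓡 p₂)).prod 𝓘(ℝ)) n
      (onFst α.extend.1) (onSnd α.extend.2) (forgetParam (S.incl (ι l)))))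
    have hp' : filmDeriv S (ι l) p.1 + s (ι l) p.2 = (0, ((0 : ℝ), (1 : ℝ))) := hp
    rw [← hp', map_add, hDA, hs, zero_add] at h2
    rw [h2, map_zero (s (ι l)), add_zero] at hp'
    exact ⟨p.1, hp'⟩
  choose ν hν using hν
  -- On tangent vectors of L, on ν and on TN, the isomorphism of the film has the block form of the
  -- stabilized isomorphism of L; this uses that `s` is the normal part of L at the level r.
  have key : ∀ (l : L.W) (v : EuclideanSpace ℝ (Fin (p₁ + p₂ + 1 - n)))
      (u : EuclideanSpace ℝ (Fin n)) (y z : Fin 0 → ℝ) (d : ℝ),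
      (show (EuclideanSpace ℝ (Fin p₁) × EuclideanSpace ℝ (Fin p₂)) ×
        ((Fin 1 → ℝ) × (ℝ × (Fin 0 → ℝ))) from
          φ.toEquiv (ι l) (B l v + d • ν l, (u, (y, z)))) =
        ((L.model l (v, (u, y))).1, ((L.model l (v, (u, y))).2, (d, z))) := by
    intro l v u y z d
    have h1 : filmDeriv S (ι l) (B l v + d • ν l) + s (ι l) u =
        (b l v + (L.normal l u).1, (c l v + (L.normal l u).2, d)) := by
      rw [map_add (filmDeriv S (ι l)), map_smul (filmDeriv S (ι l)), hB, hν,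
        hs' (ι l) rfl l rfl rfl]
      refine Prod.ext ?_ (Prod.ext ?_ ?_) <;> simp
    have h2 := hφ (ι l) (B l v + d • ν l, (u, (y, z)))
    rw [h1] at h2
    refine h2.trans ?_
    rw [LinkingCycle.model_apply hL l v u y]
    exact Prod.ext rfl (Prod.ext rfl (Prod.ext rfl (Subsingleton.elim _ _)))
  refine ⟨ι, ⟨hιs, fun l l' h => ?_, fun l v v' h => ?_, ?_, hfι, ν, fun l => ?_, ?_⟩⟩
  · have h1 : g l = g l' := congrArg S.incl h
    exact hL.injective (Prod.ext (congrArg Prod.fst h1 :)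
      (Subtype.ext (congrArg (fun z => z.2.1) h1 :)))
  -- The derivative of `ι` determines that of the inclusion of L, on which the isomorphism of L is
  -- injective.
  · have h1 : (b l v, (c l v, (0 : ℝ))) = (b l v', (c l v', (0 : ℝ))) :=
      (hB l v).symm.trans ((congrArg (filmDeriv S (ι l)) h).trans (hB l v'))
    have h2 : (b l v, fun _ : Fin 1 => c l v) = (b l v', fun _ : Fin 1 => c l v') :=
      congrArg (fun z => (z.1, fun _ : Fin 1 => z.2.1)) h1
    exact congrArg Prod.fst (L.injective_model l ((hLt l v).trans (h2.trans (hLt l v').symm)))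
  · ext w
    constructor
    · rintro ⟨l, rfl⟩
      rfl
    · intro hw
      have hw : (S.incl w).2.2 = r := hw
      have hw1 := (S.incl_mem w).1
      have h1 : ((S.incl w).1, (⟨(S.incl w).2.1, Set.Ioo_subset_Icc_self hw1.1.2.1⟩ : I)) ∈
          α.coincidence := by
        rw [← α.onFst_extend_eq_iff]
        have h2 := hF.eventually hV (z := S.incl w) (hw ▸ hrV)
        exact h2.1.self_of_nhds.symm.trans (hw1.2.trans h2.2.self_of_nhds)
      rw [← hL.range_eq] at h1
      obtain ⟨l, hl⟩ := h1
      refine ⟨l, S.injective_incl (Prod.ext (congrArg Prod.fst hl :) (Prod.ext ?_ hw.symm))⟩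
      exact congrArg Subtype.val (congrArg Prod.snd hl :)
  · have h1 := mfderiv_snd_snd_incl S (ι l) (ν l)
    rw [hν] at h1
    exact lt_of_lt_of_eq zero_lt_one h1.symm
  · intro l v u u' hu y d z
    have hu' : (show EuclideanSpace ℝ (Fin n) from u') = u := congrArg (fun p : TotalSpace
      (EuclideanSpace ℝ (Fin n)) (Pull (HoPullback.eval f₁ f₂) (TangentSpace (𝓡 n) : N → Type)) =>
        (show EuclideanSpace ℝ (Fin n) from p.snd)) hu
    have h1 := (congrArg (fun x : EuclideanSpace ℝ (Fin n) =>
      (show (EuclideanSpace ℝ (Fin p₁) × EuclideanSpace ℝ (Fin p₂)) ×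
        ((Fin 1 → ℝ) × (ℝ × (Fin 0 → ℝ))) from
          φ.toEquiv (ι l) (B l v + d • ν l, (x, (y, z))))) hu').trans (key l v u y z d)
    exact ⟨mk_proj_congr (hfι l) (congrArg Prod.fst h1), congrArg Prod.snd h1⟩

end
end LinkMaps
end

/-! ### The cobordism between linking manifolds of homotopic transverse lifts. -/

noncomputable section

namespace GeneralPosition
open Bundle StableCobordism

section

variable {E' : Type*} [NormedAddCommGroup E'] [NormedSpace ℝ E'] [FiniteDimensional ℝ E']
  {H' : Type*} [TopologicalSpace H'] {I' : ModelWithCorners ℝ E' H'}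
  {W : Type*} [TopologicalSpace W] [ChartedSpace H' W] [IsManifold I' ∞ W]
  {E : Type*} [NormedAddCommGroup E] [NormedSpace ℝ E] [FiniteDimensional ℝ E]
  {H : Type*} [TopologicalSpace H] {J : ModelWithCorners ℝ E H}
  {M : Type*} [TopologicalSpace M] [ChartedSpace H M] [IsManifold J ∞ M]
  {n : ℕ} {N : Type*} [TopologicalSpace N] [ChartedSpace (EuclideanSpace ℝ (Fin n)) N]
  [IsManifold (𝓡 n) ∞ N]
  {X : Type*} [TopologicalSpace X]
  {T : Type*} [NormedAddCommGroup T] [NormedSpace ℝ T] [FiniteDimensional ℝ T]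
  (S₁ S₂ : Type*) [NormedAddCommGroup S₁] [NormedSpace ℝ S₁] [FiniteDimensional ℝ S₁]
  [NormedAddCommGroup S₂] [NormedSpace ℝ S₂] [FiniteDimensional ℝ S₂]
  {Q₁ Q₂ Q₃ : Type*} [NormedAddCommGroup Q₁] [NormedSpace ℝ Q₁] [FiniteDimensional ℝ Q₁]
  [NormedAddCommGroup Q₂] [NormedSpace ℝ Q₂] [FiniteDimensional ℝ Q₂]
  [NormedAddCommGroup Q₃] [NormedSpace ℝ Q₃] [FiniteDimensional ℝ Q₃]

/-- A trivial bundle with fibre A × B is here given the topology of the product of two trivial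
bundles. The lemma compares it with the topology of W × (A × B), as needed for the trivial summands
of a film. -/
theorem isInducing_toProd_prod {W A B : Type*} [TopologicalSpace W] [TopologicalSpace A]
    [TopologicalSpace B] [TopologicalSpace (TotalSpace A (Trivial W A))]
    [TopologicalSpace (TotalSpace B (Trivial W B))]
    (hA : Topology.IsInducing (TotalSpace.toProd W A))
    (hB : Topology.IsInducing (TotalSpace.toProd W B)) :
    @Topology.IsInducing _ _ (FiberBundle.Prod.topologicalSpace A (Trivial W A) B (Trivial W B)) _
      (TotalSpace.toProd W (A × B)) := by
  let g : W × (A × B) → (W × A) × (W × B) := fun q => ((q.1, q.2.1), (q.1, q.2.2))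
  have hg : Topology.IsInducing g := by
    refine .of_comp (g := fun q => (q.1.1, (q.1.2, q.2.2))) (by fun_prop) (by fun_prop) ?_
    exact .id
  rw [← hg.of_comp_iff]
  exact (hA.prodMap hB).comp (FiberBundle.Prod.isInducing_diag A (Trivial W A) B (Trivial W B))

/-- A family of complements defines a stable isomorphism, for products of trivial bundles. -/
theorem exists_bundleIso_prod (f : C(W, X)) (e : C(X, N)) (pr : C(X, M)) {τ : W → T}
    (hb : ContMDiff I' J ∞ fun w => pr (f w)) (hτ : ContMDiff I' 𝓘(ℝ, T) ∞ τ)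
    {s : W → EuclideanSpace ℝ (Fin n) →L[ℝ] E × T}
    (hs : Continuous (familyMap J (fun w => pr (f w)) (fun w => e (f w)) s))
    (κ : T ≃L[ℝ] Q₁ × (Q₂ × Q₃)) [Subsingleton S₁] [Subsingleton S₂]
    (hbij : ∀ w, Function.Bijective fun p : E' × EuclideanSpace ℝ (Fin n) =>
      pairModelDeriv I' J (fun w => pr (f w)) τ w p.1 + s w p.2) :
    ∃ φ : BundleIso (E' × (EuclideanSpace ℝ (Fin n) × (S₁ × S₂)))
      ((TangentSpace I' : W → Type _) ×ᵇ
        (Pull f (Pull e (TangentSpace (𝓡 n) : N → Type)) ×ᵇ Trivial W (S₁ × S₂)))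
      (E × (Q₁ × (Q₂ × Q₃)))
      (Pull f (Pull pr (TangentSpace J : M → Type _)) ×ᵇ Trivial W (Q₁ × (Q₂ × Q₃))),
      ∀ (w : W) (p : E' × (EuclideanSpace ℝ (Fin n) × (S₁ × S₂))),
        (show E × (Q₁ × (Q₂ × Q₃)) from φ.toEquiv w p) =
          ((pairModelDeriv I' J (fun w => pr (f w)) τ w p.1 + s w p.2.1).1,
            κ (pairModelDeriv I' J (fun w => pr (f w)) τ w p.1 + s w p.2.1).2) := by
  have hQ : Topology.IsInducing (TotalSpace.toProd W (Q₁ × (Q₂ × Q₃))) :=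
    isInducing_toProd_prod (Trivial.isInducing_toProd _ _)
      (isInducing_toProd_prod (Trivial.isInducing_toProd _ _) (Trivial.isInducing_toProd _ _))
  exact exists_bundleIso (S₁ × S₂) hQ f e pr hb hτ hs κ hbij

end
end GeneralPosition

namespace LinkMaps
open GeneralPosition StableCobordism Bundle

section

variable {p₁ p₂ n : ℕ}
  {P₁ : Type u} [TopologicalSpace P₁] [ChartedSpace (EuclideanSpace ℝ (Fin p₁)) P₁] [T2Space P₁]
  [IsManifold (𝓡 p₁) ∞ P₁] [CompactSpace P₁]
  {P₂ : Type u} [TopologicalSpace P₂] [ChartedSpace (EuclideanSpace ℝ (Fin p₂)) P₂] [T2Space P₂]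
  [IsManifold (𝓡 p₂) ∞ P₂] [CompactSpace P₂]
  {N : Type v} [TopologicalSpace N] [ChartedSpace (EuclideanSpace ℝ (Fin n)) N]
  [IsManifold (𝓡 n) ∞ N] [T2Space N]
  {f₁ : SmoothMap p₁ n P₁ N} {f₂ : SmoothMap p₂ n P₂ N}
  {F : (P₁ × (ℝ × ℝ) → N) × (P₂ × (ℝ × ℝ) → N)}

theorem contMDiffOn_onFst_square (h : ContMDiffOn ((𝓡 p₁).prod 𝓘(ℝ, ℝ × ℝ)) (𝓡 n) ∞ F.1
    (Set.univ ×ˢ (Set.Ioo (0 : ℝ) 1 ×ˢ Set.univ))) :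
    ContMDiffOn (((𝓡 p₁).prod (𝓡 p₂)).prod 𝓘(ℝ, ℝ × ℝ)) (𝓡 n) ∞
      (onFst F.1 : (P₁ × P₂) × (ℝ × ℝ) → N) (Set.univ ×ˢ (Set.Ioo (0 : ℝ) 1 ×ˢ Set.univ)) :=
  h.comp (f := fun z : (P₁ × P₂) × (ℝ × ℝ) => (z.1.1, z.2))
    ((contMDiff_fst.comp contMDiff_fst).prodMk contMDiff_snd).contMDiffOn fun _ hz => ⟨trivial, hz.2⟩

theorem contMDiffOn_onSnd_square (h : ContMDiffOn ((𝓡 p₂).prod 𝓘(ℝ, ℝ × ℝ)) (𝓡 n) ∞ F.2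
    (Set.univ ×ˢ (Set.Ioo (0 : ℝ) 1 ×ˢ Set.univ))) :
    ContMDiffOn (((𝓡 p₁).prod (𝓡 p₂)).prod 𝓘(ℝ, ℝ × ℝ)) (𝓡 n) ∞
      (onSnd F.2 : (P₁ × P₂) × (ℝ × ℝ) → N) (Set.univ ×ˢ (Set.Ioo (0 : ℝ) 1 ×ˢ Set.univ)) :=
  h.comp (f := fun z : (P₁ × P₂) × (ℝ × ℝ) => (z.1.2, z.2))
    ((contMDiff_snd.comp contMDiff_fst).prodMk contMDiff_snd).contMDiffOn fun _ hz => ⟨trivial, hz.2⟩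

/-- The slab is defined over open times, where the families are smooth. Since no coincidence has
time 0 or 1, it equals the set of coincidences over the closed square, which is closed in a compact
set. -/
theorem isCompact_squareCoincidence (h₁ : Continuous F.1) (h₂ : Continuous F.2)
    (h : ∀ z : (P₁ × P₂) × (ℝ × ℝ), z.2.1 ∈ Set.Icc (0 : ℝ) 1 → z.2.2 ∈ Set.Icc (0 : ℝ) 1 →
      onFst F.1 z = onSnd F.2 z → z.2.1 ∈ Set.Ioo (0 : ℝ) 1) :
    IsCompact (squareCoincidence F) := by
  have h3 : squareCoincidence F = (Set.univ ×ˢ (Set.Icc (0 : ℝ) 1 ×ˢ Set.Icc (0 : ℝ) 1)) ∩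
      {z | onFst F.1 z = onSnd F.2 z} := by
    ext z
    constructor
    · rintro ⟨⟨⟨-, hz, -⟩, hc⟩, hz'⟩
      exact ⟨⟨trivial, Set.Ioo_subset_Icc_self hz, hz'⟩, hc⟩
    · rintro ⟨⟨-, hz, hz'⟩, hc⟩
      exact ⟨⟨⟨trivial, h z hz hz' hc, trivial⟩, hc⟩, hz'⟩
  rw [h3]
  refine (isCompact_univ.prod (isCompact_Icc.prod isCompact_Icc)).inter_right (isClosed_eq ?_ ?_)
  · exact h₁.comp (f := fun z : (P₁ × P₂) × (ℝ × ℝ) => (z.1.1, z.2)) (by fun_prop)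
  · exact h₂.comp (f := fun z : (P₁ × P₂) × (ℝ × ℝ) => (z.1.2, z.2)) (by fun_prop)

/-- The linear maps which agree with the normal structure of a cycle over the level `r`. -/
def endCondition (L : LinkingCycle f₁ f₂) (t : L.W → I) (r : ℝ) (z : (P₁ × P₂) × (ℝ × ℝ)) :
    Set (EuclideanSpace ℝ (Fin n) →L[ℝ]
      (EuclideanSpace ℝ (Fin p₁) × EuclideanSpace ℝ (Fin p₂)) × (ℝ × ℝ)) :=
  {R | z.2.2 = r → ∀ l : L.W, L.base l = z.1 → (t l : ℝ) = z.2.1 →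
    ∀ u, R u = ((L.normal l u).1, ((L.normal l u).2, 0))}

theorem convex_endCondition (L : LinkingCycle f₁ f₂) (t : L.W → I) (r : ℝ)
    (z : (P₁ × P₂) × (ℝ × ℝ)) : Convex ℝ (endCondition L t r z) := by
  intro R hR R' hR' a b _ _ hab hz l h1 h2 u
  have h3 : a • R u + b • R' u = ((L.normal l u).1, ((L.normal l u).2, 0)) := by
    rw [hR hz l h1 h2, hR' hz l h1 h2, ← add_smul, hab, one_smul]
  exact h3

set_option maxHeartbeats 1000000 in
theorem exists_filmIso (S : FilmAtlas (p₁ := p₁) (p₂ := p₂) (n := n) F)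
    (f : C(S.Carrier, HoPullback f₁ f₂)) (hp : ∀ w, HoPullback.proj f₁ f₂ (f w) = (S.incl w).1)
    {s : S.Carrier → EuclideanSpace ℝ (Fin n) →L[ℝ]
        (EuclideanSpace ℝ (Fin p₁) × EuclideanSpace ℝ (Fin p₂)) × (ℝ × ℝ)}
    (hs : Continuous (familyMap ((𝓡 p₁).prod (𝓡 p₂)) (fun w => HoPullback.proj f₁ f₂ (f w))
      (fun w => HoPullback.eval f₁ f₂ (f w)) s))
    (hbij : ∀ w, Function.Bijective fun p : EuclideanSpace ℝ (Fin (p₁ + p₂ + 1 - n + 1)) ×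
      EuclideanSpace ℝ (Fin n) => filmDeriv S w p.1 + s w p.2) :
    ∃ φ : FilmIso S f, ∀ (w : S.Carrier) (p : EuclideanSpace ℝ (Fin (p₁ + p₂ + 1 - n + 1)) ×
      (EuclideanSpace ℝ (Fin n) × ((Fin 0 → ℝ) × (Fin 0 → ℝ)))), φ.toEquiv w p =
      ((filmDeriv S w p.1 + s w p.2.1).1, filmEquiv (filmDeriv S w p.1 + s w p.2.1).2) := by
  have hp' : (fun w => HoPullback.proj f₁ f₂ (f w)) = fun w => (S.incl w).1 := funext hp
  have hb : ContMDiff (𝓡∂ (p₁ + p₂ + 1 - n + 1)) ((𝓡 p₁).prod (𝓡 p₂)) ∞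
      fun w => HoPullback.proj f₁ f₂ (f w) := hp' ▸ contMDiff_fst.comp S.contMDiff_incl
  have hτ : ContMDiff (𝓡∂ (p₁ + p₂ + 1 - n + 1)) 𝓘(ℝ, ℝ × ℝ) ∞ fun w => (S.incl w).2 :=
    contMDiff_snd.comp S.contMDiff_incl
  have hA : filmDeriv S = pairModelDeriv (𝓡∂ (p₁ + p₂ + 1 - n + 1)) ((𝓡 p₁).prod (𝓡 p₂))
      (fun w => HoPullback.proj f₁ f₂ (f w)) (fun w => (S.incl w).2) := by
    rw [hp']
    rfl
  rw [hA] at hbij ⊢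
  exact exists_bundleIso_prod (I' := 𝓡∂ (p₁ + p₂ + 1 - n + 1)) (J := (𝓡 p₁).prod (𝓡 p₂))
    (n := n) (Fin 0 → ℝ) (Fin 0 → ℝ) f (HoPullback.eval f₁ f₂) (HoPullback.proj f₁ f₂)
    hb hτ hs filmEquiv hbij

set_option maxHeartbeats 800000 in
/-- Linking manifolds of homotopic transverse lifts are cobordant. -/
theorem LinkingCycle.IsPreimage.cobordant (hf : IsLinkMap f₁ f₂) (hn : n ≤ p₁ + p₂ + 1)
    {α β : Lift f₁ f₂} (h : α.Homotopic β) (hα : α.Transverse) (hβ : β.Transverse)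
    {Lα Lβ : LinkingCycle f₁ f₂} {tα : Lα.W → I} {tβ : Lβ.W → I} (hLα : Lα.IsPreimage α tα)
    (hLβ : Lβ.IsPreimage β tβ) : Cobordant Lα Lβ := by
  obtain ⟨F, hF₁, hF₂, hc₁, hc₂, hs₁, hs₂, hFα, hFβ, hIoo, hR⟩ := h.exists_families hf hα hβ
  have hG₁ := contMDiffOn_onFst_square (p₂ := p₂) (P₂ := P₂) hF₁
  have hG₂ := contMDiffOn_onSnd_square (p₁ := p₁) (P₁ := P₁) hF₂
  have hT : IsOpen (Set.univ ×ˢ (Set.Ioo (0 : ℝ) 1 ×ˢ Set.univ) : Set ((P₁ × P₂) × (ℝ × ℝ))) :=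
    isOpen_univ.prod (isOpen_Ioo.prod isOpen_univ)
  have hd : Module.finrank ℝ ((EuclideanSpace ℝ (Fin p₁) × EuclideanSpace ℝ (Fin p₂)) × (ℝ × ℝ)) =
      n + (p₁ + p₂ + 1 - n + 1) := by
    simp
    omega
  obtain ⟨S, hS⟩ := exists_sliceAtlas_coincidenceSlab
    (J := ((𝓡 p₁).prod (𝓡 p₂)).prod 𝓘(ℝ, ℝ × ℝ)) hT hG₁ hG₂ (k := p₁ + p₂ + 1 - n)
    (h := fun z => z.2.2) contMDiff_snd_snd (fun z hz => hR z hz.1.1.2.1 hz.2)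
    (fun z hz hz' => by
      rcases hz' with hz' | hz'
      · exact hFα.levelTransverseAt hf hα isOpen_Iio (by rw [Set.mem_Iio, hz']; norm_num)
          hz.1.1.2.1 hz.1.2
      · exact hFβ.levelTransverseAt hf hβ isOpen_Ioi (by rw [Set.mem_Ioi, hz']; norm_num)
          hz.1.1.2.1 hz.1.2) hd
  have hcompact : CompactSpace S.Carrier :=
    S.compactSpace (isCompact_squareCoincidence hc₁ hc₂ hIoo)
  have hT2 : T2Space S.Carrier := S.isEmbedding_incl.t2Space
  have hmem : ∀ w, (S.incl w).2.1 ∈ Set.Ioo (0 : ℝ) 1 := fun w => (S.incl_mem w).1.1.2.1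
  have hi := S.continuous_incl
  let t : S.Carrier → I := fun w => ⟨(S.incl w).2.1, Set.Ioo_subset_Icc_self (hmem w)⟩
  have htc : Continuous t := (S.continuous_incl.snd.fst).subtype_mk _
  have hΓ : ∀ w, F.1 ((S.incl w).1.1, ((t w : ℝ), (S.incl w).2.2)) =
      F.2 ((S.incl w).1.2, ((t w : ℝ), (S.incl w).2.2)) := fun w => (S.incl_mem w).1.2
  let f : C(S.Carrier, HoPullback f₁ f₂) := referenceMap ⟨fun w => (S.incl w).1, by fun_prop⟩
    ⟨t, htc⟩
    ⟨fun p => F.1 ((S.incl p.1).1.1, ((p.2 : ℝ), (S.incl p.1).2.2)), hc₁.comp (by fun_prop)⟩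
    ⟨fun p => F.2 ((S.incl p.1).1.2, ((p.2 : ℝ), (S.incl p.1).2.2)), hc₂.comp (by fun_prop)⟩
    (fun w => hs₁ _ _) (fun w => hs₂ _ _) hΓ
  have hy : ∀ w, onFst F.1 (S.incl w) = HoPullback.eval f₁ f₂ (f w) := fun w => by
    refine Eq.trans ?_ (linkPath_left w ⟨0, by norm_num⟩ (t w) le_rfl (by simp)).symm
    rfl
  let D : ∀ w, (EuclideanSpace ℝ (Fin p₁) × EuclideanSpace ℝ (Fin p₂)) × (ℝ × ℝ) →L[ℝ]
      EuclideanSpace ℝ (Fin n) := fun w =>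
    diffDeriv (((𝓡 p₁).prod (𝓡 p₂)).prod 𝓘(ℝ, ℝ × ℝ)) n (onFst F.1) (onSnd F.2) (S.incl w)
  have hlevel : ∀ {V : Set ℝ}, IsOpen V → IsOpen {w | (S.incl w).2.2 ∈ V} := fun hV =>
    hV.preimage (by fun_prop : Continuous fun w => (S.incl w).2.2)
  -- The splitting of the film is a right inverse which agrees with the splittings of both cycles
  -- over the two ends. These conditions are convex, so it suffices to meet them locally.
  obtain ⟨s, hs, hsc⟩ := exists_continuous_family ((𝓡 p₁).prod (𝓡 p₂)) (fun w => (S.incl w).1)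
    (fun w => HoPullback.eval f₁ f₂ (f w)) (by fun_prop)
    (fun w => {R | ∀ u, D w (R u) = u} ∩
      (endCondition Lα tα 0 (S.incl w) ∩ endCondition Lβ tβ 1 (S.incl w)))
    (fun w => (convex_setOf_rightInverse (D w)).inter
      ((convex_endCondition _ _ _ _).inter (convex_endCondition _ _ _ _)))
    (by
      intro w₀
      -- In the collar τ < 1/4 the splitting of the first cycle is used, and the condition at τ = 1
      -- is vacuous; the collar τ > 3/4 is symmetric.
      by_cases h0 : (S.incl w₀).2.2 < 1 / 4
      · obtain ⟨s, h1, h2⟩ := hLα.exists_local_right_inverse hf isOpen_Iio hFα hi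
          (fun w => (S.incl_mem w).1.2) hmem hy (w₀ := w₀) h0
        refine ⟨_, s, hlevel isOpen_Iio, h0, fun w hw => ⟨(h1 w hw).1, fun _ => (h1 w hw).2,
          fun h3 => ?_⟩, h2⟩
        have h4 : (S.incl w).2.2 < 1 / 4 := hw
        linarith
      by_cases h0' : 3 / 4 < (S.incl w₀).2.2
      · obtain ⟨s, h1, h2⟩ := hLβ.exists_local_right_inverse hf isOpen_Ioi hFβ hi
          (fun w => (S.incl_mem w).1.2) hmem hy (w₀ := w₀) h0'
        refine ⟨_, s, hlevel isOpen_Ioi, h0', fun w hw => ⟨(h1 w hw).1, fun h3 => ?_,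
          fun _ => (h1 w hw).2⟩, h2⟩
        have h4 : 3 / 4 < (S.incl w).2.2 := hw
        linarith
      -- Away from the ends any local right inverse will do, over a neighbourhood within 0 < τ < 1,
      -- where both end conditions are vacuous.
      · obtain ⟨U, s, hU, hwU, h1, h2⟩ :=
          GeneralPosition.exists_local_right_inverse hT hG₁ hG₂ hi
          (fun w => (S.incl_mem w).1) hy w₀ (hR _ (hmem w₀) (S.incl_mem w₀).2)
        refine ⟨_, s, hU.inter (hlevel (isOpen_Ioo (a := 0) (b := 1))), ⟨hwU, ?_⟩,
          fun w hw => ⟨h1 w hw.1, fun h3 => ?_, fun h3 => ?_⟩, fun q hq => h2 q hq.1⟩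
        · exact ⟨by linarith, by linarith⟩
        · exact absurd h3 hw.2.1.ne'
        · exact absurd h3 hw.2.2.ne)
  have hb : ContMDiff (𝓡∂ (p₁ + p₂ + 1 - n + 1)) ((𝓡 p₁).prod (𝓡 p₂)) ∞ fun w => (S.incl w).1 :=
    contMDiff_fst.comp S.contMDiff_incl
  have hτ : ContMDiff (𝓡∂ (p₁ + p₂ + 1 - n + 1)) 𝓘(ℝ, ℝ × ℝ) ∞ fun w => (S.incl w).2 :=
    contMDiff_snd.comp S.contMDiff_incl
  have hDA : ∀ w v, D w (filmDeriv S w v) = 0 := fun w v =>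
    diffDeriv_pairModelDeriv (hb.mdifferentiable (by simp) w) (hτ.mdifferentiable (by simp) w)
      ((hG₁.contMDiffAt (hT.mem_nhds (S.incl_mem w).1.1)).mdifferentiableAt (by simp))
      ((hG₂.contMDiffAt (hT.mem_nhds (S.incl_mem w).1.1)).mdifferentiableAt (by simp))
      (fun w => (S.incl_mem w).1.2) v
  have hbij : ∀ w, Function.Bijective fun p : EuclideanSpace ℝ (Fin (p₁ + p₂ + 1 - n + 1)) ×
      EuclideanSpace ℝ (Fin n) => filmDeriv S w p.1 + s w p.2 := by
    intro w
    refine bijective_add_of_complement ?_ (hDA w) (hs w).1 ?_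
    · have h := S.injective_mfderiv_incl w
      rw [(hasMFDerivAt_filmIncl S w).mfderiv] at h
      exact h
    · rw [finrank_euclideanSpace_fin, finrank_euclideanSpace_fin]
      exact hd
  obtain ⟨φ, hφ⟩ := exists_filmIso S f (fun w => rfl) hsc hbij
  obtain ⟨ια, hια⟩ := hLα.exists_isEnd hf isOpen_Iio hFα (r := 0) (by norm_num) (by norm_num) S hS
    f φ (fun w => rfl) (fun w a τ h1 h2 => linkPath_left w a τ h1 h2)
    (fun w a τ h1 h2 => linkPath_right hΓ w a τ h1 h2) (fun w => (hs w).1) (fun w => (hs w).2.1)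
    hDA hbij hφ
  obtain ⟨ιβ, hιβ⟩ := hLβ.exists_isEnd hf isOpen_Ioi hFβ (r := 1) (by norm_num) (by norm_num) S hS
    f φ (fun w => rfl) (fun w a τ h1 h2 => linkPath_left w a τ h1 h2)
    (fun w a τ h1 h2 => linkPath_right hΓ w a τ h1 h2) (fun w => (hs w).1) (fun w => (hs w).2.2)
    hDA hbij hφ
  exact ⟨slabFilm S hS f φ, ια, ιβ, hια, hιβ⟩

end
end LinkMaps
end

/-! ### Negative dimensions, arbitrary lifts and simply connected mapping spaces. -/

noncomputable section

namespace StableCobordism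
open Bundle

/-- The empty film serves. It settles the case n > p₁ + p₂ + 1, where the truncated dimension does
not permit the general construction. -/
theorem cobordant_of_isEmpty {X : Type*} [TopologicalSpace X]
    {Fξ : Type*} [NormedAddCommGroup Fξ] [NormedSpace ℝ Fξ] {ξ : X → Type*}
    [∀ x, TopologicalSpace (ξ x)] [∀ x, AddCommMonoid (ξ x)] [∀ x, Module ℝ (ξ x)]
    [TopologicalSpace (TotalSpace Fξ ξ)] [FiberBundle Fξ ξ] [VectorBundle ℝ Fξ ξ]
    {Fη : Type*} [NormedAddCommGroup Fη] [NormedSpace ℝ Fη] {η : X → Type*}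
    [∀ x, TopologicalSpace (η x)] [∀ x, AddCommMonoid (η x)] [∀ x, Module ℝ (η x)]
    [TopologicalSpace (TotalSpace Fη η)] [FiberBundle Fη η] [VectorBundle ℝ Fη η] {k a b : ℕ}
    (L₀ L₁ : StableCycle.{u} Fξ ξ Fη η k a b) [IsEmpty L₀.W] [IsEmpty L₁.W] :
    Cobordant L₀ L₁ := by
  let _ : ChartedSpace (EuclideanHalfSpace (k + 1)) PEmpty.{u + 1} := ChartedSpace.empty _ _
  have hM : IsManifold (𝓡∂ (k + 1)) ∞ PEmpty.{u + 1} := inferInstance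
  let f : C(PEmpty.{u + 1}, X) := ⟨fun x => x.elim, continuous_of_discreteTopology⟩
  let V : Film.{u} Fξ ξ Fη η k a b :=
    { W := PEmpty.{u + 1}
      s := fun _ => 0
      contMDiff_s := contMDiff_const
      s_mem := fun w => w.elim
      boundary_eq := Set.ext fun w => w.elim
      f := f
      m := 0
      φ := ⟨fun w => w.elim, continuous_iff_continuousAt.2 fun z => z.proj.elim⟩ }
  have hV : ∀ w : V.W, False := fun w => PEmpty.elim w
  have key : ∀ (L : StableCycle.{u} Fξ ξ Fη η k a b) [IsEmpty L.W] (r : ℝ),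
      IsEnd V L r (fun x => isEmptyElim x) := fun L _ r =>
    ⟨fun x => isEmptyElim x, fun x => isEmptyElim x, fun x => isEmptyElim x,
      Set.ext fun w => (hV w).elim, fun x => isEmptyElim x,
      fun x => isEmptyElim x, fun x => isEmptyElim x, fun x => isEmptyElim x⟩
  exact ⟨V, _, _, key L₀ 0, key L₁ 1⟩

end StableCobordism

namespace LinkMaps
open GeneralPosition StableCobordism

section

variable {p₁ p₂ n : ℕ}
  {P₁ : Type u} [TopologicalSpace P₁] [ChartedSpace (EuclideanSpace ℝ (Fin p₁)) P₁] [T2Space P₁]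
  [IsManifold (𝓡 p₁) ∞ P₁] [CompactSpace P₁]
  {P₂ : Type u} [TopologicalSpace P₂] [ChartedSpace (EuclideanSpace ℝ (Fin p₂)) P₂] [T2Space P₂]
  [IsManifold (𝓡 p₂) ∞ P₂] [CompactSpace P₂]
  {N : Type v} [TopologicalSpace N] [ChartedSpace (EuclideanSpace ℝ (Fin n)) N]
  [IsManifold (𝓡 n) ∞ N] [T2Space N]
  {f₁ : SmoothMap p₁ n P₁ N} {f₂ : SmoothMap p₂ n P₂ N}

/-- At a coincidence, a space of dimension p₁ + p₂ + 1 < n would be mapped linearly onto ℝⁿ. -/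
theorem LinkingCycle.IsPreimage.isEmpty (hf : IsLinkMap f₁ f₂) (hn : p₁ + p₂ + 1 < n)
    {α : Lift f₁ f₂} (hα : α.Transverse) {L : LinkingCycle f₁ f₂} {t : L.W → I}
    (hL : L.IsPreimage α t) : IsEmpty L.W := by
  refine ⟨fun w => ?_⟩
  have hw := hL.mem_coincidence w
  have h1 := finrank_le_of_surjective ((α.transverse_iff hf).1 hα (cylinderIncl (L.base w, t w))
    (α.mem_Ioo_of_mem_coincidence hf hw) ((α.onFst_extend_eq_iff _).2 hw))
  rw [finrank_euclideanSpace_fin, finrank_model] at h1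
  omega

/-- Linking manifolds of homotopic lifts are cobordant. -/
theorem LinkingCycle.IsLinkingManifold.cobordant (hf : IsLinkMap f₁ f₂) {α β : Lift f₁ f₂}
    (h : α.Homotopic β) {Lα Lβ : LinkingCycle f₁ f₂} (hLα : Lα.IsLinkingManifold α)
    (hLβ : Lβ.IsLinkingManifold β) : Cobordant Lα Lβ := by
  obtain ⟨α', hα, hα', tα, h1⟩ := hLα
  obtain ⟨β', hβ, hβ', tβ, h2⟩ := hLβ
  rcases le_or_gt n (p₁ + p₂ + 1) with hn | hn
  -- The transverse representatives are joined by the homotopies α' ~ α ~ β ~ β'. This also covers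
  -- different choices of representative for one lift.
  · exact h1.cobordant hf hn ((hα.symm.trans h).trans hβ) hα' hβ' h2
  · have := h1.isEmpty hf hn hα'
    have := h2.isEmpty hf hn hβ'
    exact cobordant_of_isEmpty Lα Lβ

theorem exists_lift_endsAt (h₁ : MapSimplyConnected p₁ n P₁ N) (h₂ : MapSimplyConnected p₂ n P₂ N)
    (g₁ : SmoothMap p₁ n P₁ N) (g₂ : SmoothMap p₂ n P₂ N) (hg : IsLinkMap g₁ g₂) :
    ∃ α : Lift f₁ f₂, α.EndsAt g₁ g₂ := by
  obtain ⟨F₁, hF₁⟩ := h₁.joined f₁ g₁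
  obtain ⟨F₂, hF₂⟩ := h₂.joined f₂ g₂
  refine ⟨⟨F₁, F₂, fun x => (hF₁ x).1, fun x => (hF₂ x).1, ?_⟩, fun x => (hF₁ x).2,
    fun x => (hF₂ x).2⟩
  simpa only [hF₁, hF₂] using hg

/-- Lifts with the same end are homotopic if the mapping spaces are simply connected. -/
theorem Lift.SameEnd.homotopic (h₁ : MapSimplyConnected p₁ n P₁ N)
    (h₂ : MapSimplyConnected p₂ n P₂ N) {α β : Lift f₁ f₂} (h : α.SameEnd β) :
    α.Homotopic β := by
  obtain ⟨H₁, hH₁, hH₁'⟩ := h₁.homotopic α.F₁ β.F₁ fun x =>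
    ⟨(α.start₁ x).trans (β.start₁ x).symm, h.1 x⟩
  obtain ⟨H₂, hH₂, hH₂'⟩ := h₂.homotopic α.F₂ β.F₂ fun x =>
    ⟨(α.start₂ x).trans (β.start₂ x).symm, h.2 x⟩
  refine ⟨H₁, H₂, hH₁, hH₂, fun x s => (hH₁' x s).1.trans (α.start₁ x),
    fun x s => (hH₂' x s).1.trans (α.start₂ x), fun s => ?_⟩
  simpa only [hH₁', hH₂'] using α.isLinkMap

end
end LinkMaps
end

theorem mainTheorem7 {p₁ p₂ n : ℕ}
    {P₁ : Type u} [TopologicalSpace P₁] [ChartedSpace (EuclideanSpace ℝ (Fin p₁)) P₁]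
    [IsManifold (𝓡 p₁) ∞ P₁] [CompactSpace P₁] [T2Space P₁]
    {P₂ : Type u} [TopologicalSpace P₂] [ChartedSpace (EuclideanSpace ℝ (Fin p₂)) P₂]
    [IsManifold (𝓡 p₂) ∞ P₂] [CompactSpace P₂] [T2Space P₂]
    {N : Type v} [TopologicalSpace N] [ChartedSpace (EuclideanSpace ℝ (Fin n)) N]
    [IsManifold (𝓡 n) ∞ N] [T2Space N] [SecondCountableTopology N]
    (f₁ : SmoothMap p₁ n P₁ N) (f₂ : SmoothMap p₂ n P₂ N) (hf : IsLinkMap f₁ f₂) :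
    (∀ α : Lift f₁ f₂, ∃ L : LinkingCycle f₁ f₂, L.IsLinkingManifold α) ∧
    (∀ α β : Lift f₁ f₂, α.SameEnd β → α.Homotopic β →
      ∀ Lα Lβ : LinkingCycle f₁ f₂, Lα.IsLinkingManifold α → Lβ.IsLinkingManifold β →
        Cobordant Lα Lβ) ∧
    (MapSimplyConnected p₁ n P₁ N → MapSimplyConnected p₂ n P₂ N →
      ∀ (g₁ : SmoothMap p₁ n P₁ N) (g₂ : SmoothMap p₂ n P₂ N), IsLinkMap g₁ g₂ →
        (∃ α : Lift f₁ f₂, α.EndsAt g₁ g₂) ∧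
        ∀ α β : Lift f₁ f₂, α.EndsAt g₁ g₂ → β.EndsAt g₁ g₂ →
          ∀ Lα Lβ : LinkingCycle f₁ f₂, Lα.IsLinkingManifold α → Lβ.IsLinkingManifold β →
            Cobordant Lα Lβ) := by
  refine ⟨fun α => α.exists_isLinkingManifold hf, fun α β _ h Lα Lβ hα hβ => hα.cobordant hf h hβ,
    fun h₁ h₂ g₁ g₂ hg => ⟨exists_lift_endsAt h₁ h₂ g₁ g₂ hg, fun α β hα hβ Lα Lβ hLα hLβ => ?_⟩⟩
  have h : α.SameEnd β :=
    ⟨fun x => (hα.1 x).trans (hβ.1 x).symm, fun x => (hα.2 x).trans (hβ.2 x).symm⟩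
  exact hLα.cobordant hf (h.homotopic h₁ h₂) hLβ
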